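/- **Theorem.** Let $\mathcal D=\{z\in\mathbb C:|z|<1\}$ and let $X$ be a (Hausdorff) complex manifold of dimension $n$. Let $\pi\colon X\to\mathcal D$ be a totally real complex semi-stable degeneration with real structure $\iota$, that is: * $\pi$ is proper and holomorphic, it is regular at every point over $\mathcal D\setminus\{0\}$, and its special fibre $X_0=\pi^{-1}(0)$ is a reduced normal crossing divisor, i.e. at each $p\in X_0$ there are centred holomorphic coordinates in which $\pi$ is $z_1\cdots z_k$ times a nowhere vanishing holomorphic function, for some $1\le k\le n$ (then the tangent cone $T_pX_0$ is the union of the hyperplanes $\ker dz_j\subset T_pX$, $1\le j\le k$); * $\iota\colon X\to X$ is an anti-holomorphic involution with $\pi\circ\iota=\overline{\pi}$; * at each $p\in X_0$ with $\iota(p)=p$, the differential $d\iota_p$ maps every hyperplane of the tangent cone $T_pX_0$ to itself. Let $\alpha\colon\widetilde X\to X$ be the real-oriented blow-up of $X$ along $X_0$. A point of $\widetilde X$ is a point $p\in X$ together with a multiplicative assignment $h$ of phases $h(f)\in S^1$ to the germs $f$ at $p$ of holomorphic functions without zeros outside $X_0$, such that $f(p)=|f(p)|\,h(f)$; the topology is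 the coarsest one for which $\alpha$ and the phases of such functions on open subsets of $X$ are continuous. In coordinates in which $X_0=\{z_1\cdots z_k=0\}$ this is the map $$(S^1\times\mathbb R_{\ge0})^k\times\mathbb C^{n-k}\to\mathbb C^n,\qquad((\theta_j,r_j)_j,w)\mapsto((\theta_jr_j)_j,w),\qquad \theta_j=h(z_j).$$ Let $\widetilde\pi=(h(\pi),|\pi(p)|)\colon\widetilde X\to S^1\times[0,1)$ be the blown-up family, locally $((\theta,r),w)\mapsto(\theta_1\cdots\theta_k,r_1\cdots r_k)$ when $\pi=z_1\cdots z_k$, and let $\widetilde X$ carry the real structure $(p,h)\mapsto\big(\iota(p),\,f\mapsto\overline{h(\overline{f\circ\iota})}\big)$ induced by $\iota$, locally $(\theta_j,r_j)\mapsto(\theta_j^{-1},r_j)$ in coordinates in which $\iota$ is complex conjugation. Put $\widetilde X^+=\widetilde\pi^{-1}(\{+1\}\times[0,1))$, $\widetilde X^+_0=\widetilde\pi^{-1}(\{+1\}\times\{0\})$ and $X_t=\pi^{-1}(t)$, and let $\mathbb R$ denote restriction to the fixed points of the real structure. Then there exists a homeomorphism $$H\colon\mathbb R\widetilde X_0^+\times[0,1)\to\mathbb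 R\widetilde X^+$$ such that $\widetilde\pi(H(x,t))=(+1,t)$ for all $(x,t)\in\mathbb R\widetilde X_0^+\times[0,1)$. In particular, $\mathbb R\widetilde X_0^+$ is homeomorphic to $\mathbb RX_t$ for every $t\in(0,1)$. -/

import Mathlib

open scoped Manifold ContDiff Topology ComplexConjugate Complex.UnitDisc

noncomputable section

namespace SemistableDegeneration

variable (n : ℕ) {X : Type*} [TopologicalSpace X] [ChartedSpace (Fin n → ℂ) X]

/-! ### Complex semi-stable degenerations -/

/-- `e` is a holomorphic chart of `X`, centred at `p`, in which the divisor of zeros of `π`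
is the reduced normal crossing divisor `∑_{j ∈ J} {z_j = 0}` (with `J` non-empty): on the domain
of `e`, the function `π` is the product of the coordinates `z_j`, `j ∈ J`,
and a nowhere vanishing holomorphic function. -/
structure IsNormalCrossingChart (π : X → 𝔻) (p : X) (e : OpenPartialHomeomorph X (Fin n → ℂ))
    (J : Finset (Fin n)) : Prop where
  mem_maximalAtlas : e ∈ IsManifold.maximalAtlas 𝓘(ℂ, Fin n → ℂ) ω X
  mem_source : p ∈ e.source
  centred : e p = 0
  nonempty : J.Nonempty
  eq_mul_prod : ∃ u : X → ℂ, ContMDiffOn 𝓘(ℂ, Fin n → ℂ) 𝓘(ℂ, ℂ) ω u e.source ∧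
    ∀ x ∈ e.source, u x ≠ 0 ∧ (π x : ℂ) = u x * ∏ j ∈ J, e x j

/-- A complex semi-stable degeneration over the open unit disc: a proper holomorphic function
which is regular over the punctured disc and whose special fibre (the divisor `π = 0`) is a
reduced normal crossing divisor. -/
structure IsSemistable (π : X → 𝔻) : Prop where
  proper : IsProperMap π
  holomorphic : ContMDiff 𝓘(ℂ, Fin n → ℂ) 𝓘(ℂ, ℂ) ω (fun x => (π x : ℂ))
  regular : ∀ p : X, (π p : ℂ) ≠ 0 →
    Function.Surjective (mfderiv 𝓘(ℂ, Fin n → ℂ) 𝓘(ℂ, ℂ) (fun x => (π x : ℂ)) p)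
  normalCrossing : ∀ p : X, (π p : ℂ) = 0 → ∃ e J, IsNormalCrossingChart n π p e J

/-- The complex hyperplanes of `T_p X` whose union is the tangent cone of the special fibre
at `p`: these are the kernels of `dz_j`, `j ∈ J`, for a normal crossing chart at `p`.
Here `T_p X` is the model space `ℂ^n`, as always in Mathlib. -/
def tangentConeHyperplanes (π : X → 𝔻) (p : X) :
    Set (Submodule ℂ (Fin n → ℂ)) :=
  {H | ∃ e J, IsNormalCrossingChart n π p e J ∧ ∃ j ∈ J,
    ∀ v : Fin n → ℂ, v ∈ H ↔ mfderiv 𝓘(ℂ, Fin n → ℂ) 𝓘(ℂ, ℂ) (fun x => e x j) p v = 0}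

/-! ### Real structures -/

/-- A real structure for `π`: an anti-holomorphic involution `ι` of `X` with
`conj ∘ π = π ∘ ι`. Anti-holomorphic means that `ι` is continuous and pulls back holomorphic
functions to conjugates of holomorphic functions. -/
structure IsRealStructure (π : X → 𝔻) (ι : X → X) : Prop where
  continuous : Continuous ι
  involutive : Function.Involutive ι
  antiholomorphic : ∀ (p : X) (f : X → ℂ),
    ContMDiffAt 𝓘(ℂ, Fin n → ℂ) 𝓘(ℂ, ℂ) ω f (ι p) →
      ContMDiffAt 𝓘(ℂ, Fin n → ℂ) 𝓘(ℂ, ℂ) ω (fun x => conj (f (ι x))) p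
  map_conj : ∀ x : X, π (ι x) = star (π x)

/-- `(π, ι)` is totally real if, at every real point of the special fibre, the (real) differential
of `ι` maps each hyperplane of the tangent cone of the special fibre to itself. -/
def IsTotallyReal (π : X → 𝔻) (ι : X → X) : Prop :=
  ∀ p : X, ι p = p → (π p : ℂ) = 0 → ∀ H ∈ tangentConeHyperplanes n π p,
    ((mfderiv 𝓘(ℝ, Fin n → ℂ) 𝓘(ℝ, Fin n → ℂ) ι p : (Fin n → ℂ) → (Fin n → ℂ)) ''
      (H : Set (Fin n → ℂ))) = (H : Set (Fin n → ℂ))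

/-! ### The real-oriented blow-up of the special fibre -/

/-- The multiplicative monoid of germs at `p` of holomorphic functions that have no zeros
outside the special fibre. -/
def divisorMonoid (π : X → 𝔻) (p : X) : Submonoid ((𝓝 p).Germ ℂ) where
  carrier := {φ | ∃ f : X → ℂ, φ = (f : (𝓝 p).Germ ℂ) ∧
    ContMDiffAt 𝓘(ℂ, Fin n → ℂ) 𝓘(ℂ, ℂ) ω f p ∧ ∀ᶠ x in 𝓝 p, (π x : ℂ) ≠ 0 → f x ≠ 0}
  one_mem' := ⟨fun _ => 1, rfl, contMDiffAt_const, by simp⟩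
  mul_mem' := by
    rintro _ _ ⟨f, rfl, hf, hf'⟩ ⟨g, rfl, hg, hg'⟩
    refine ⟨f * g, rfl, hf.mul hg, ?_⟩
    filter_upwards [hf', hg'] with x h1 h2 hx
    exact mul_ne_zero (h1 hx) (h2 hx)

/-- The real-oriented blow-up of `X` along the special fibre of `π`. A point consists of a point
`p` of `X` and a choice of phases, in the unit circle, of the germs at `p` of holomorphic functions
without zeros outside the special fibre; the choice is multiplicative and is the usual phase
`f(p) / |f(p)|` if `f(p) ≠ 0`.

If `z` is a chart in which the special fibre is `z_1 ⋯ z_k = 0`, then such a germ is in a unique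
way a unit times a monomial in the `z_j`, `j ≤ k`, with `z_j(p) = 0`. Hence a point over the domain
of `z` is the same as its polar coordinates `(θ_j, r_j) = (phase z_j, |z_j(p)|)`, `j ≤ k`, together
with the `z_j(p)`, `j > k`, and over this chart the blow-up is the map
`(S¹ × [0, ∞))^k × ℂ^(n-k) → ℂ^n`, `(θ, r, w) ↦ (θ r, w)`. -/
@[ext]
structure Blowup (π : X → 𝔻) where
  pt : X
  phase : divisorMonoid n π pt →* Circle
  value_eq : ∀ φ : divisorMonoid n π pt, φ.1.value = (‖φ.1.value‖ : ℂ) * (phase φ : ℂ)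

/-- The topology of the real-oriented blow-up: the coarsest one for which the blow-down map
is continuous and, for each holomorphic function `f` on an open set `U` without zeros outside
the special fibre, the phase of `f` is continuous over `U`. -/
instance (π : X → 𝔻) : TopologicalSpace (Blowup n π) :=
  TopologicalSpace.generateFrom
    ({W | ∃ U : Set X, IsOpen U ∧ W = Blowup.pt ⁻¹' U} ∪
     {W | ∃ (U : Set X) (f : X → ℂ) (hf : ∀ p ∈ U, (f : (𝓝 p).Germ ℂ) ∈ divisorMonoid n π p)
        (V : Set Circle), IsOpen U ∧ IsOpen V ∧
        W = {x : Blowup n π | ∃ hx : x.pt ∈ U, x.phase ⟨(f : (𝓝 x.pt).Germ ℂ), hf x.pt hx⟩ ∈ V}})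

variable {n} {π : X → 𝔻} {ι : X → X}

lemma IsSemistable.germ_mem (hπ : IsSemistable n π) (p : X) :
    ((fun x => (π x : ℂ) : X → ℂ) : (𝓝 p).Germ ℂ) ∈ divisorMonoid n π p :=
  ⟨_, rfl, hπ.holomorphic p, Filter.Eventually.of_forall fun _ h => h⟩

/-- The blown-up family `π̃ : X̃ → S¹ × [0,1)`; in polar coordinates on a chart with
`π = z_1 ⋯ z_k` it is `(θ, r, w) ↦ (θ_1 ⋯ θ_k, r_1 ⋯ r_k)`. -/
def IsSemistable.blowupMap (hπ : IsSemistable n π) (x : Blowup n π) :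
    Circle × Set.Ico (0 : ℝ) 1 :=
  (x.phase ⟨_, hπ.germ_mem x.pt⟩, ⟨‖(π x.pt : ℂ)‖, norm_nonneg _, (π x.pt).norm_lt_one⟩)

/-- The homomorphism `f ↦ conj ∘ f ∘ ι` on germs. -/
def IsRealStructure.pullback (hι : IsRealStructure n π ι) (p : X) :
    divisorMonoid n π (ι p) →* divisorMonoid n π p where
  toFun φ := ⟨(φ.1.compTendsto ι (hι.continuous.tendsto p)).map conj, by
    obtain ⟨_, f, rfl, hf, hf'⟩ := φ
    refine ⟨fun x => conj (f (ι x)), rfl, hι.antiholomorphic p f hf, ?_⟩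
    filter_upwards [(hι.continuous.tendsto p).eventually hf'] with x hx h
    have : ((π (ι x) : 𝔻) : ℂ) ≠ 0 := by
      rw [hι.map_conj, Complex.UnitDisc.coe_star]
      simpa using h
    simpa using hx this⟩
  map_one' := by
    apply Subtype.ext
    change ((fun _ => conj (1 : ℂ) : X → ℂ) : (𝓝 p).Germ ℂ) = ((fun _ => (1 : ℂ) : X → ℂ) : _)
    simp
  map_mul' := by
    rintro ⟨_, f, rfl, hf⟩ ⟨_, g, rfl, hg⟩
    apply Subtype.ext
    change ((fun x => conj (f (ι x) * g (ι x)) : X → ℂ) : (𝓝 p).Germ ℂ) =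
      ((fun x => conj (f (ι x)) * conj (g (ι x)) : X → ℂ) : _)
    simp

lemma IsRealStructure.value_pullback (hι : IsRealStructure n π ι) (p : X)
    (φ : divisorMonoid n π (ι p)) : (hι.pullback p φ).1.value = conj φ.1.value := by
  obtain ⟨_, f, rfl, hf⟩ := φ
  rfl

/-- The real structure of the real-oriented blow-up induced by `ι`: the phase of `f` at the image
of `x` is the conjugate (that is, the inverse) of the phase of `conj ∘ f ∘ ι` at `x`. In polar
coordinates on a chart in which `ι` is the complex conjugation, it is `(θ, r) ↦ (θ⁻¹, r)`
on the first `k` factors. -/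
def IsRealStructure.blowupConj (hι : IsRealStructure n π ι) (x : Blowup n π) : Blowup n π where
  pt := ι x.pt
  phase := invMonoidHom.comp (x.phase.comp (hι.pullback x.pt))
  value_eq φ := by
    have h := congrArg conj (x.value_eq (hι.pullback x.pt φ))
    rw [hι.value_pullback] at h
    rw [Complex.conj_conj, map_mul, Complex.conj_ofReal, RCLike.norm_conj,
      ← Circle.coe_inv_eq_conj] at h
    exact h

/-- The real locus `ℝX̃` of the real-oriented blow-up. -/
def IsRealStructure.realBlowup (hι : IsRealStructure n π ι) : Set (Blowup n π) :=
  {x | hι.blowupConj x = x}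

/-- `X̃⁺`, the part of the real-oriented blow-up over `{+1} × [0,1)`. -/
def IsSemistable.positivePart (hπ : IsSemistable n π) : Set (Blowup n π) :=
  hπ.blowupMap ⁻¹' ({1} ×ˢ Set.univ)

/-- `X̃₀⁺`, the part of the real-oriented blow-up over `{+1} × {0}`. -/
def IsSemistable.positiveSpecialFibre (hπ : IsSemistable n π) : Set (Blowup n π) :=
  hπ.blowupMap ⁻¹' ({1} ×ˢ {⟨0, le_rfl, one_pos⟩})

/-- The real locus `ℝX_t` of the fibre of `π` over `t`. -/
def realFibre (π : X → 𝔻) (ι : X → X) (t : ℝ) : Set X :=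
  {p | ι p = p ∧ (π p : ℂ) = t}

end SemistableDegeneration

end

/-! The proof produces local product structures on the real positive part of the blow-up and glues
them without integrating a vector field.

Local picture. At a real point there are coordinates in which `ι` is complex conjugation and `π` is
the product of the coordinates `z_j`, `j ∈ J` (`IsSemistable.exists_isRealChart`). At points of the
special fibre this is where total reality enters: it forces `ι` to preserve each branch, so that the
branch equations can be made real one by one, and the remaining real unit is absorbed into one of
them. A germ without zeros outside the special fibre is a unit times a monomial in the coordinates
(`exists_eq_unit_mul_monomial`), so a point of the blow-up over the chart is determined by its image
and the phases of the `z_j`. At a real point these phases are signs, and positivity means that their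
product is `1`. Over the chart, the real positive part is thus a disjoint union of pieces of closed
orthants of `ℝ^n`, one for each sign vector `v`. On each orthant one can move along the lines
parallel to `v`.

The height. Along such a line, `|π|` may vanish to higher order at a corner, but `|π|^(1/n)` grows
at least linearly, by superadditivity of the geometric mean (`rpow_prod_add_le`). The exponent `1/n`
does not depend on the chart. With this height the lines are uniformly transverse to the levels, and
`C¹` functions are Lipschitz along them with respect to the height; this is recorded in `SlideBox`
and proved in `IsRealChart.exists_slideBox`.

Gluing. Over a short interval `[s, s']`, bump functions `b_i` give levels `h = s + (t - s) min(1,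
∑_{i ∈ F} b_i)` interpolating between `h = s` and `h = t`. Adding one index to `F` changes the level
only where `b_i > 0`, and the points there are slid along the lines of the `i`-th chart; the
Lipschitz estimate makes the intersection point unique (`SlideBox.exists_levelRetraction`,
`exists_isTrivialization_of_slideBoxes`). Properness of `π` gives compact sublevels and hence a
uniform step, and the trivializations are concatenated up to height `1`
(`exists_homeomorph_of_isTrivialization`).

Finally the parameter is changed from `|π|^(1/n)` to `|π|`. Over `t > 0` the phases are determined
by the underlying point, so the blow-down identifies the fibre with the real fibre of `π`. -/

namespace SemistableDegeneration

open Set Filter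

/-! ### Trivializations of a height function by sliding along fibres -/

section Slide

variable {M : Type*} [TopologicalSpace M]

/-- A closed equivalence relation whose classes are transverse to the levels of `h` and extend
at least `η` upwards, and `η` (or until height `0`) downwards, from every point with `b x > 0`. -/
structure SlideBox (h b : M → ℝ) (η : ℝ) where
  rel : M → M → Prop
  equiv : Equivalence rel
  closed : IsClosed {p : M × M | rel p.1 p.2}
  inj : ∀ x y, rel x y → h x = h y → x = y
  up : ∀ x, 0 < b x → ∃ S : Set M, IsPreconnected S ∧ x ∈ S ∧ (∀ y ∈ S, rel x y) ∧
    ∃ y ∈ S, h x + η ≤ h y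
  down : ∀ x, 0 < b x → ∃ S : Set M, IsPreconnected S ∧ x ∈ S ∧ (∀ y ∈ S, rel x y) ∧
    ∃ y ∈ S, h y ≤ max 0 (h x - η)

/-- The graph over `[s, s']` of the levels `h = s + (t - s) Y`. -/
def levelGraph (h Y : M → ℝ) (s s' : ℝ) : Set (M × ℝ) :=
  {p | p.2 ∈ Icc s s' ∧ h p.1 = s + (p.2 - s) * Y p.1}

/-- `q` retracts the levels `h = s + (t - s) Y`, for `t ∈ [s, s']`, bijectively
and continuously onto the level `h = s`. -/
structure IsLevelRetraction (h Y : M → ℝ) (s s' : ℝ) (q : M × ℝ → M) : Prop where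
  continuousOn : ContinuousOn q (levelGraph h Y s s')
  bijOn : ∀ t ∈ Icc s s', BijOn (fun x => q (x, t)) {x | h x = s + (t - s) * Y x} {x | h x = s}
  base : ∀ x, h x = s → q (x, s) = x

/-- `q` retracts `h⁻¹[a, b]` onto `h⁻¹(a)`, bijectively on each level of `h`. -/
structure IsTrivialization (h : M → ℝ) (a b : ℝ) (q : M → M) : Prop where
  continuousOn : ContinuousOn q (h ⁻¹' Icc a b)
  bijOn : ∀ t ∈ Icc a b, BijOn q {x | h x = t} {x | h x = a}
  base : ∀ x, h x = a → q x = x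

variable {h : M → ℝ}

/-- A contraction argument: on a class, `h` determines the point, and `(t - s) Y` is Lipschitz in
`h` with constant less than `1`. Hence a class crosses the tilted level at most once. -/
theorem SlideBox.eq_of_rel {b : M → ℝ} {η : ℝ} (B : SlideBox h b η) {Y : M → ℝ} {C : ℝ}
    (hL : ∀ x y, B.rel x y → |Y x - Y y| ≤ C * |h x - h y|)
    {s s' : ℝ} (hC : (s' - s) * C < 1) (hC0 : 0 ≤ C) {t : ℝ} (ht : t ∈ Icc s s') {x y : M}
    (hxy : B.rel x y) (hx : h x = s + (t - s) * Y x) (hy : h y = s + (t - s) * Y y) : x = y := by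
  have ht0 : 0 ≤ t - s := sub_nonneg.2 ht.1
  apply B.inj x y hxy
  have h1 := hL x y hxy
  have h2 : |h x - h y| = (t - s) * |Y x - Y y| := by
    have : h x - h y = (t - s) * (Y x - Y y) := by
      rw [hx, hy]
      ring
    rw [this, abs_mul, abs_of_nonneg ht0]
  have h3 : |h x - h y| ≤ (s' - s) * C * |h x - h y| := by
    rw [mul_assoc]
    calc |h x - h y| = (t - s) * |Y x - Y y| := h2
      _ ≤ (t - s) * (C * |h x - h y|) := by gcongr
      _ ≤ _ := by gcongr; exact ht.2
  have h4 : |h x - h y| ≤ 0 := by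
    by_contra! h5
    nlinarith
  linarith [abs_nonpos_iff.1 h4]

theorem SlideBox.existsUnique_down {b : M → ℝ} {η : ℝ} (B : SlideBox h b η)
    (hc : Continuous h) {Y Z : M → ℝ} (hY : Continuous Y) (hY0 : ∀ x, 0 ≤ Y x)
    (hYZ : ∀ x, Y x ≤ Z x) (hZ1 : ∀ x, Z x ≤ 1)
    (hb : ∀ x, Y x < Z x → 0 < b x) {C : ℝ} (hL : ∀ x y, B.rel x y → |Y x - Y y| ≤ C * |h x - h y|)
    {s s' : ℝ} (hs : 0 ≤ s) (hη : s' - s ≤ η) (hC : (s' - s) * C < 1) (hC0 : 0 ≤ C)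
    {t : ℝ} (ht : t ∈ Icc s s') {x : M} (hx : h x = s + (t - s) * Z x) :
    ∃! y, B.rel x y ∧ h y = s + (t - s) * Y y := by
  have ht0 : 0 ≤ t - s := sub_nonneg.2 ht.1
  have hts : t - s ≤ η := by linarith [ht.2]
  have ex : ∃ y, B.rel x y ∧ h y = s + (t - s) * Y y := by
    rcases (hYZ x).eq_or_lt with e | e
    · exact ⟨x, B.equiv.refl x, by rw [e, hx]⟩
    obtain ⟨S, hS, hxS, hrel, y, hyS, hy⟩ := B.down x (hb x e)
    have hg : Continuous fun y => h y - s - (t - s) * Y y := by fun_prop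
    -- The lower end of the class lies on or below the target level: either it is at height at most
    -- `0 ≤ s`, or it is `η ≥ t - s` below `x`, whose height is at most `t`.
    have h1 : h y - s - (t - s) * Y y ≤ 0 := by
      have h2 : 0 ≤ (t - s) * Y y := mul_nonneg ht0 (hY0 y)
      rcases le_total 0 (h x - η) with h3 | h3
      · rw [max_eq_right h3] at hy
        have : (t - s) * Z x ≤ t - s := mul_le_of_le_one_right ht0 (hZ1 x)
        linarith
      · rw [max_eq_left h3] at hy
        linarith
    have h2 : 0 ≤ h x - s - (t - s) * Y x := by
      rw [hx]
      have := mul_le_mul_of_nonneg_left (hYZ x) ht0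
      linarith
    obtain ⟨z, hz, hz'⟩ := hS.intermediate_value hyS hxS hg.continuousOn ⟨h1, h2⟩
    exact ⟨z, hrel z hz, by linarith⟩
  obtain ⟨y, hy, hy'⟩ := ex
  refine ⟨y, ⟨hy, hy'⟩, ?_⟩
  rintro z ⟨hz, hz'⟩
  exact B.eq_of_rel hL hC hC0 ht (B.equiv.trans (B.equiv.symm hz) hy) hz' hy'

theorem SlideBox.exists_up {b : M → ℝ} {η : ℝ} (B : SlideBox h b η)
    (hc : Continuous h) {Y Z : M → ℝ} (hZ : Continuous Z)
    (hYZ : ∀ x, Y x ≤ Z x) (hY0 : ∀ x, 0 ≤ Y x) (hZ1 : ∀ x, Z x ≤ 1)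
    (hb : ∀ x, Y x < Z x → 0 < b x)
    {s s' : ℝ} (hη : s' - s ≤ η)
    {t : ℝ} (ht : t ∈ Icc s s') {x : M} (hx : h x = s + (t - s) * Y x) :
    ∃ y, B.rel x y ∧ h y = s + (t - s) * Z y := by
  have ht0 : 0 ≤ t - s := sub_nonneg.2 ht.1
  have hts : t - s ≤ η := by linarith [ht.2]
  rcases (hYZ x).eq_or_lt with e | e
  · exact ⟨x, B.equiv.refl x, by rw [← e, hx]⟩
  obtain ⟨S, hS, hxS, hrel, y, hyS, hy⟩ := B.up x (hb x e)
  have hg : Continuous fun y => h y - s - (t - s) * Z y := by fun_prop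
  have h1 : 0 ≤ h y - s - (t - s) * Z y := by
    have h2 : 0 ≤ (t - s) * Y x := mul_nonneg ht0 (hY0 x)
    have : (t - s) * Z y ≤ t - s := mul_le_of_le_one_right ht0 (hZ1 y)
    linarith
  have h2 : h x - s - (t - s) * Z x ≤ 0 := by
    rw [hx]
    have := mul_le_mul_of_nonneg_left (hYZ x) ht0
    linarith
  obtain ⟨z, hz, hz'⟩ := hS.intermediate_value hxS hyS hg.continuousOn ⟨h2, h1⟩
  exact ⟨z, hrel z hz, by linarith⟩

/-- The inductive step of the gluing: points of the `Z`-level are slid down inside their classes to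
the `Y`-level, and then `q` is applied. Sliding is injective by `SlideBox.eq_of_rel` on the
`Z`-level and surjective because one can also slide up. -/
theorem SlideBox.exists_levelRetraction {b : M → ℝ} {η : ℝ} (B : SlideBox h b η)
    (hc : Continuous h) {Y Z : M → ℝ} (hY : Continuous Y) (hZ : Continuous Z)
    (hY0 : ∀ x, 0 ≤ Y x) (hYZ : ∀ x, Y x ≤ Z x) (hZ1 : ∀ x, Z x ≤ 1)
    (hb : ∀ x, Y x < Z x → 0 < b x) {C : ℝ}
    (hLY : ∀ x y, B.rel x y → |Y x - Y y| ≤ C * |h x - h y|)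
    (hLZ : ∀ x y, B.rel x y → |Z x - Z y| ≤ C * |h x - h y|)
    {s s' : ℝ} (hs : 0 ≤ s) (hss : s ≤ s') (hη : s' - s ≤ η) (hC : (s' - s) * C < 1)
    (hC0 : 0 ≤ C) (hK : IsCompact {x | h x ≤ s'})
    {q : M × ℝ → M} (hq : IsLevelRetraction h Y s s' q) :
    ∃ q', IsLevelRetraction h Z s s' q' := by
  classical
  have key : ∀ p : M × ℝ, ∃ y, p ∈ levelGraph h Z s s' →
      B.rel p.1 y ∧ h y = s + (p.2 - s) * Y y := by
    intro p
    by_cases hp : p ∈ levelGraph h Z s s'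
    · obtain ⟨y, hy, -⟩ := B.existsUnique_down hc hY hY0 hYZ hZ1 hb hLY hs hη hC hC0 hp.1 hp.2
      exact ⟨y, fun _ => hy⟩
    · exact ⟨p.1, fun h' => absurd h' hp⟩
  choose d hd using key
  have huniq : ∀ p ∈ levelGraph h Z s s', ∀ y, B.rel p.1 y → h y = s + (p.2 - s) * Y y →
      y = d p := fun p hp y h1 h2 =>
    (B.existsUnique_down hc hY hY0 hYZ hZ1 hb hLY hs hη hC hC0 hp.1 hp.2).unique ⟨h1, h2⟩ (hd p hp)
  have hmem : ∀ p ∈ levelGraph h Z s s', (d p, p.2) ∈ levelGraph h Y s s' :=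
    fun p hp => ⟨hp.1, (hd p hp).2⟩
  have hdc : ContinuousOn d (levelGraph h Z s s') := by
    intro p hp
    -- Closed graph argument: the values of `d` stay in the compact sublevel, and a cluster point is
    -- again related to `p` and on the `Y`-level, hence equal to `d p`.
    refine hK.tendsto_nhds_of_unique_mapClusterPt ?_ ?_
    · filter_upwards [self_mem_nhdsWithin] with p' hp'
      have h1 := (hd p' hp').2
      have h2 : (p'.2 - s) * Y (d p') ≤ p'.2 - s :=
        mul_le_of_le_one_right (sub_nonneg.2 hp'.1.1) ((hYZ _).trans (hZ1 _))
      have := hp'.1.2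
      change h (d p') ≤ s'
      linarith
    · intro y _ hy
      have hcl : IsClosed {r : (M × ℝ) × M | B.rel r.1.1 r.2 ∧ h r.2 = s + (r.1.2 - s) * Y r.2} := by
        refine IsClosed.inter ?_ (isClosed_eq (by fun_prop) (by fun_prop))
        exact B.closed.preimage (f := fun r : (M × ℝ) × M => (r.1.1, r.2)) (by fun_prop)
      have h2 : (p, y) ∈ {r : (M × ℝ) × M | B.rel r.1.1 r.2 ∧ h r.2 = s + (r.1.2 - s) * Y r.2} := by
        by_contra hn
        obtain ⟨U, hU, V, hV, hUV⟩ := mem_nhds_prod_iff.1 (hcl.isOpen_compl.mem_nhds hn)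
        obtain ⟨p', hp', hpU, hpL⟩ := ((mapClusterPt_iff_frequently.1 hy V hV).and_eventually
          (inter_mem (mem_nhdsWithin_of_mem_nhds hU) self_mem_nhdsWithin)).exists
        exact hUV (mk_mem_prod hpU hp') (hd p' hpL)
      exact huniq p hp y h2.1 h2.2
  refine ⟨fun p => q (d p, p.2), ?_, ?_, ?_⟩
  · refine hq.continuousOn.comp (hdc.prodMk continuousOn_snd) hmem
  · intro t ht
    refine (hq.bijOn t ht).comp (g := fun x => q (x, t)) (f := fun x => d (x, t)) ⟨?_, ?_, ?_⟩
    · intro x hx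
      exact (hd (x, t) ⟨ht, hx⟩).2
    · intro x hx x' hx' e
      have h1 := hd (x, t) ⟨ht, hx⟩
      have h2 := hd (x', t) ⟨ht, hx'⟩
      simp only at e h1 h2
      rw [← e] at h2
      exact B.eq_of_rel hLZ hC hC0 ht (B.equiv.trans h1.1 (B.equiv.symm h2.1)) hx hx'
    · intro y hy
      obtain ⟨x, hx, hx'⟩ := B.exists_up hc hZ hYZ hY0 hZ1 hb hη ht hy
      exact ⟨x, hx', (huniq (x, t) ⟨ht, hx'⟩ y (B.equiv.symm hx) hy).symm⟩
  · intro x hx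
    have : (x, s) ∈ levelGraph h Z s s' := ⟨⟨le_rfl, hss⟩, by simp [hx]⟩
    rw [← huniq (x, s) this x (B.equiv.refl x) (by simp [hx])]
    exact hq.base x hx

theorem abs_min_one_sub_min_one_le (u v : ℝ) : |min 1 u - min 1 v| ≤ |u - v| := by
  simpa using abs_min_sub_min_le_max 1 u 1 v

/-- The boxes are used one after another. The truncated sums `Y F` run from `0`, where the level is
`h = s` and the retraction is the identity, to a function equal to `1` below height `s'`, where the
level is `h = t`. Truncation at `1` keeps the levels below `s'` and does not increase Lipschitz
constants. -/
theorem exists_isTrivialization_of_slideBoxes {κ : Type*} [Fintype κ] {b : κ → M → ℝ}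
    {η : κ → ℝ} (B : ∀ i, SlideBox h (b i) (η i)) (hc : Continuous h)
    (hb : ∀ i, Continuous (b i)) (hb0 : ∀ i x, 0 ≤ b i x) {C : ℝ} (hC0 : 0 ≤ C)
    (hL : ∀ i l x y, (B i).rel x y → |b l x - b l y| ≤ C * |h x - h y|)
    {s s' : ℝ} (hs : 0 ≤ s) (hss : s ≤ s') (hη : ∀ i, s' - s ≤ η i)
    (hC : (s' - s) * (Fintype.card κ * C) < 1) (hK : IsCompact {x | h x ≤ s'})
    (hb1 : ∀ x, h x ≤ s' → 1 ≤ ∑ i, b i x) : ∃ q, IsTrivialization h s s' q := by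
  classical
  let Y : Finset κ → M → ℝ := fun F x => min 1 (∑ i ∈ F, b i x)
  have hYL : ∀ F i x y, (B i).rel x y → |Y F x - Y F y| ≤ Fintype.card κ * C * |h x - h y| := by
    intro F i x y hxy
    calc |Y F x - Y F y| ≤ |∑ l ∈ F, b l x - ∑ l ∈ F, b l y| := abs_min_one_sub_min_one_le _ _
      _ = |∑ l ∈ F, (b l x - b l y)| := by rw [Finset.sum_sub_distrib]
      _ ≤ ∑ l ∈ F, |b l x - b l y| := Finset.abs_sum_le_sum_abs _ _
      _ ≤ ∑ l ∈ F, C * |h x - h y| := Finset.sum_le_sum fun l _ => hL i l x y hxy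
      _ = F.card * (C * |h x - h y|) := by rw [Finset.sum_const, nsmul_eq_mul]
      _ ≤ Fintype.card κ * (C * |h x - h y|) := by
        gcongr
        exact F.card_le_univ
      _ = _ := by ring
  have hYc : ∀ F, Continuous (Y F) := fun F =>
    continuous_const.min (continuous_finsetSum _ fun i _ => hb i)
  have main : ∀ F : Finset κ, ∃ q, IsLevelRetraction h (Y F) s s' q := by
    intro F
    induction F using Finset.induction_on with
    | empty =>
      have h0 : ∀ x, Y ∅ x = 0 := fun x => by simp [Y]
      refine ⟨Prod.fst, continuousOn_fst, fun t _ => ?_, fun _ _ => rfl⟩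
      simp only [h0, mul_zero, add_zero]
      exact bijOn_id _
    | insert i F hi ih =>
      obtain ⟨q, hq⟩ := ih
      have hsum : ∀ x, ∑ l ∈ insert i F, b l x = b i x + ∑ l ∈ F, b l x :=
        fun x => Finset.sum_insert hi
      refine (B i).exists_levelRetraction hc (hYc F) (hYc _) ?_ ?_ ?_ ?_ (hYL F i) (hYL _ i) hs hss
        (hη i) hC (by positivity) hK hq
      · exact fun x => le_min zero_le_one (Finset.sum_nonneg fun l _ => hb0 l x)
      · intro x
        simp only [Y, hsum]
        exact min_le_min le_rfl (by linarith [hb0 i x])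
      · exact fun x => min_le_left _ _
      -- Points outside the support of `b i` stay where they are, so extension of the classes is
      -- needed only where `b i > 0`.
      · intro x hx
        by_contra hn
        have : b i x = 0 := le_antisymm (not_lt.1 hn) (hb0 i x)
        simp [Y, hsum, this] at hx
  obtain ⟨q, hq⟩ := main Finset.univ
  have hY1 : ∀ x, h x ≤ s' → Y Finset.univ x = 1 := fun x hx => min_eq_left (hb1 x hx)
  have hset : ∀ t ∈ Icc s s', {x | h x = s + (t - s) * Y Finset.univ x} = {x | h x = t} := by
    intro t ht
    ext x
    have hle : h x ≤ s' ↔ h x ≤ s' := Iff.rfl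
    constructor
    · intro hx
      have hx' : h x = s + (t - s) * Y Finset.univ x := hx
      -- As `Y ≤ 1` everywhere, a point of the tilted level has height at most `s'`, where `Y = 1`
      -- is known.
      have h1 : (t - s) * Y Finset.univ x ≤ t - s :=
        mul_le_of_le_one_right (sub_nonneg.2 ht.1) (min_le_left _ _)
      have h2 : h x ≤ s' := by linarith [ht.2]
      rw [hY1 x h2] at hx'
      change h x = t
      linarith
    · intro hx
      have hx' : h x = t := hx
      change h x = s + (t - s) * Y Finset.univ x
      rw [hY1 x (by linarith [ht.2])]
      linarith
  refine ⟨fun x => q (x, h x), ?_, ?_, ?_⟩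
  · refine hq.continuousOn.comp (by fun_prop) fun x hx => ⟨hx, ?_⟩
    change h x = s + (h x - s) * Y Finset.univ x
    rw [hY1 x hx.2]
    ring
  · intro t ht
    have h1 := hq.bijOn t ht
    rw [hset t ht] at h1
    exact h1.congr fun x hx => by rw [show h x = t from hx]
  · intro x hx
    simp only [hx]
    exact hq.base x hx

/-- Above `b` one retracts first by `r` and then by `q`; as `r` is the identity on the level `b`,
the pieces agree there. That `q` is left unchanged below `b` is what permits an infinite
concatenation. -/
theorem IsTrivialization.exists_extension {a b c : ℝ} (hc : Continuous h) (hab : a ≤ b)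
    (hbc : b ≤ c) {q r : M → M} (hq : IsTrivialization h a b q) (hr : IsTrivialization h b c r) :
    ∃ q', IsTrivialization h a c q' ∧ ∀ x, h x ≤ b → q' x = q x := by
  classical
  let g : M → M := fun x => if h x ≤ b then x else r x
  have hg1 : ∀ x, h x ≤ b → g x = x := fun x hx => if_pos hx
  have hg2 : ∀ x, b ≤ h x → g x = r x := by
    intro x hx
    by_cases h' : h x ≤ b
    · rw [hg1 x h', hr.base x (le_antisymm h' hx)]
    · exact if_neg h'
  have hgc : ContinuousOn g (h ⁻¹' Icc a c) := by
    have h1 : ContinuousOn g (h ⁻¹' Icc a b) :=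
      continuousOn_id.congr fun x hx => hg1 x hx.2
    have h2 : ContinuousOn g (h ⁻¹' Icc b c) := hr.continuousOn.congr fun x hx => hg2 x hx.1
    have h3 := h1.union_of_isClosed h2 (isClosed_Icc.preimage hc) (isClosed_Icc.preimage hc)
    rwa [← preimage_union, Icc_union_Icc_eq_Icc hab hbc] at h3
  have hgm : MapsTo g (h ⁻¹' Icc a c) (h ⁻¹' Icc a b) := by
    intro x hx
    rcases le_total (h x) b with h' | h'
    · rw [hg1 x h']
      exact ⟨hx.1, h'⟩
    · rw [hg2 x h']
      have : h (r x) = b := (hr.bijOn (h x) ⟨h', hx.2⟩).mapsTo rfl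
      exact ⟨by rw [this]; exact hab, this.le⟩
  refine ⟨fun x => q (g x), ⟨hq.continuousOn.comp hgc hgm, ?_, ?_⟩, ?_⟩
  · intro t ht
    rcases le_total t b with h' | h'
    · exact (hq.bijOn t ⟨ht.1, h'⟩).congr fun x hx => by
        rw [hg1 x (by rw [show h x = t from hx]; exact h')]
    · refine ((hq.bijOn b ⟨hab, le_rfl⟩).comp (hr.bijOn t ⟨h', ht.2⟩)).congr fun x hx => ?_
      simp only [Function.comp]
      rw [hg2 x (by rw [show h x = t from hx]; exact h')]
  · intro x hx
    rw [hg1 x (hx.trans_le hab), hq.base x hx]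
  · intro x hx
    simp only
    rw [hg1 x hx]

theorem exists_isTrivialization_of_uniform (hc : Continuous h) {T δ : ℝ} (hδ : 0 < δ)
    (H : ∀ s s', 0 ≤ s → s ≤ s' → s' ≤ T → s' - s ≤ δ → ∃ q, IsTrivialization h s s' q)
    {a b : ℝ} (ha : 0 ≤ a) (hab : a ≤ b) (hb : b ≤ T) : ∃ q, IsTrivialization h a b q := by
  have key : ∀ k : ℕ, ∀ c, a ≤ c → c ≤ T → c - a ≤ k * δ → ∃ q, IsTrivialization h a c q := by
    intro k
    induction k with
    | zero =>
      intro c hac hcT hk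
      exact H a c ha hac hcT (by simp at hk; linarith)
    | succ k ih =>
      intro c hac hcT hk
      push_cast at hk
      have h1 : a ≤ max a (c - δ) := le_max_left _ _
      have h2 : max a (c - δ) ≤ c := max_le hac (by linarith)
      obtain ⟨q, hq⟩ := ih (max a (c - δ)) h1 (h2.trans hcT) (by
        rcases max_choice a (c - δ) with h | h <;> rw [h]
        · rw [sub_self]; positivity
        · linarith)
      obtain ⟨r, hr⟩ := H (max a (c - δ)) c (ha.trans h1) h2 hcT (by linarith [le_max_right a (c - δ)])
      obtain ⟨q', hq', -⟩ := hq.exists_extension hc h1 h2 hr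
      exact ⟨q', hq'⟩
  obtain ⟨k, hk⟩ := exists_nat_ge ((b - a) / δ)
  exact key k b hab hb (by rwa [div_le_iff₀ hδ] at hk)

/-- Trivializations over an exhaustion of `[0, 1)` are chosen compatibly, so they stabilize to a
retraction `q` onto the level `0`. Then `x ↦ (q x, h x)` is a continuous bijection, and it is closed
because compact sublevels make `h` proper onto `[0, 1)`. -/
theorem exists_homeomorph_of_isTrivialization [T2Space M] (hc : Continuous h)
    (h0 : ∀ x, 0 ≤ h x) (h1 : ∀ x, h x < 1) (hK : ∀ T < 1, IsCompact {x | h x ≤ T})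
    (H : ∀ a b, 0 ≤ a → a ≤ b → b < 1 → ∃ q, IsTrivialization h a b q) :
    ∃ e : {x // h x = 0} × Ico (0 : ℝ) 1 ≃ₜ M, ∀ p, h (e p) = p.2 := by
  let t : ℕ → ℝ := fun k => 1 - 1 / (k + 1)
  have ht0 : ∀ k, 0 ≤ t k := fun k => by
    have : (1 : ℝ) / (k + 1) ≤ 1 := by
      rw [div_le_one (by positivity)]
      linarith [(Nat.cast_nonneg k : (0 : ℝ) ≤ k)]
    simp only [t]
    linarith
  have ht1 : ∀ k, t k < 1 := fun k => by
    have : (0 : ℝ) < 1 / (k + 1) := by positivity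
    simp only [t]
    linarith
  have htm : Monotone t := fun k l hkl => by
    have : (1 : ℝ) / (l + 1) ≤ 1 / (k + 1) := by gcongr
    simp only [t]
    linarith
  have htlim : ∀ x : ℝ, x < 1 → ∃ k, x < t k := by
    intro x hx
    obtain ⟨k, hk⟩ := exists_nat_one_div_lt (sub_pos.2 hx)
    exact ⟨k, by simp only [t]; linarith⟩
  have step : ∀ (k : ℕ) (q : {q // IsTrivialization h 0 (t k) q}),
      ∃ q' : {q // IsTrivialization h 0 (t (k + 1)) q}, ∀ x, h x ≤ t k → q'.1 x = q.1 x := by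
    rintro k ⟨q, hq⟩
    obtain ⟨r, hr⟩ := H (t k) (t (k + 1)) (ht0 k) (htm k.le_succ) (ht1 _)
    obtain ⟨q', hq', h'⟩ := hq.exists_extension hc (ht0 k) (htm k.le_succ) hr
    exact ⟨⟨q', hq'⟩, h'⟩
  choose next hnext using step
  obtain ⟨q0, hq0⟩ := H 0 (t 0) le_rfl (ht0 0) (ht1 0)
  let Q : ∀ k, {q // IsTrivialization h 0 (t k) q} := fun k => Nat.rec ⟨q0, hq0⟩ next k
  have hQ : ∀ k l, k ≤ l → ∀ x, h x ≤ t k → (Q l).1 x = (Q k).1 x := by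
    intro k l hkl
    induction l, hkl using Nat.le_induction with
    | base => exact fun _ _ => rfl
    | succ l hl ih =>
      intro x hx
      rw [← ih x hx]
      exact hnext l (Q l) x (hx.trans (htm hl))
  choose N hN using fun x => htlim (h x) (h1 x)
  let q : M → M := fun x => (Q (N x)).1 x
  have hqQ : ∀ k x, h x ≤ t k → q x = (Q k).1 x := by
    intro k x hx
    rcases le_total k (N x) with h' | h'
    · exact hQ _ _ h' x hx
    · exact (hQ _ _ h' x (hN x).le).symm
  have hqc : Continuous q := by
    rw [continuous_iff_continuousAt]
    intro x
    have hU : h ⁻¹' Iio (t (N x)) ∈ 𝓝 x := (isOpen_Iio.preimage hc).mem_nhds (hN x)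
    have h2 : ContinuousOn (Q (N x)).1 (h ⁻¹' Iio (t (N x))) :=
      (Q (N x)).2.continuousOn.mono fun y hy => ⟨h0 y, le_of_lt hy⟩
    refine (h2.continuousAt hU).congr ?_
    filter_upwards [hU] with y hy
    exact (hqQ _ _ (le_of_lt hy)).symm
  have hqb : ∀ s : ℝ, 0 ≤ s → s < 1 → BijOn q {x | h x = s} {x | h x = 0} := by
    intro s hs hs1
    obtain ⟨k, hk⟩ := htlim s hs1
    exact ((Q k).2.bijOn s ⟨hs, hk.le⟩).congr fun x hx =>
      (hqQ k x (by rw [show h x = s from hx]; exact hk.le)).symm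
  let f : M → {x // h x = 0} × Ico (0 : ℝ) 1 := fun x =>
    (⟨q x, (hqb (h x) (h0 x) (h1 x)).mapsTo rfl⟩, ⟨h x, h0 x, h1 x⟩)
  have hfc : Continuous f := by fun_prop
  have hfb : Function.Bijective f := by
    constructor
    · intro x y hxy
      have h2 : h x = h y := congrArg (fun p => (p.2 : ℝ)) hxy
      have h3 : q x = q y := congrArg (fun p => (p.1 : M)) hxy
      exact (hqb (h x) (h0 x) (h1 x)).injOn rfl h2.symm h3
    · rintro ⟨⟨y, hy⟩, s, hs0, hs1⟩
      obtain ⟨x, hx, hx'⟩ := (hqb s hs0 hs1).surjOn hy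
      exact ⟨x, Prod.ext (Subtype.ext hx') (Subtype.ext hx)⟩
  have hprop : IsProperMap fun x => (⟨h x, h0 x, h1 x⟩ : Ico (0 : ℝ) 1) := by
    have hcont : Continuous fun x => (⟨h x, h0 x, h1 x⟩ : Ico (0 : ℝ) 1) := by fun_prop
    have : LocallyCompactSpace (Ico (0 : ℝ) 1) := isLocallyClosed_Ico.locallyCompactSpace
    refine isProperMap_iff_isCompact_preimage.2 ⟨hcont, fun K hKc => ?_⟩
    rcases K.eq_empty_or_nonempty with rfl | hne
    · simp
    -- A compact subset of `[0, 1)` has a maximum, which is less than `1`, so its preimage lies in a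
    -- compact sublevel.
    obtain ⟨m, hm, hmax⟩ := hKc.exists_isMaxOn hne continuous_subtype_val.continuousOn
    refine (hK m m.2.2).of_isClosed_subset (hKc.isClosed.preimage hcont) fun x hx => ?_
    exact hmax hx
  have hfp : IsProperMap f :=
    isProperMap_of_comp_of_t2 hfc continuous_snd (g := Prod.snd) hprop
  let e : M ≃ₜ {x // h x = 0} × Ico (0 : ℝ) 1 :=
    (Equiv.ofBijective f hfb).toHomeomorphOfContinuousClosed hfc hfp.isClosedMap
  refine ⟨e.symm, fun p => ?_⟩
  have : (e (e.symm p)).2 = p.2 := by rw [e.apply_symm_apply]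
  exact congrArg Subtype.val this

end Slide

end SemistableDegeneration

namespace SemistableDegeneration

open Set Filter

/-! ### Factorization of holomorphic germs without zeros outside coordinate hyperplanes -/

section SeveralVariables

/-- The power series of `F` is composed with `L t` and integrated term by term; as the `L t` are
contractions, the coefficients do not grow and dominated convergence applies. -/
theorem analyticAt_integral_comp {E : Type*} [NormedAddCommGroup E] [NormedSpace ℂ E]
    {F : E → ℂ} (hF : AnalyticAt ℂ F 0) {L : ℝ → E →L[ℂ] E} (hL : Continuous L)
    (hL1 : ∀ t ∈ Icc (0 : ℝ) 1, ‖L t‖ ≤ 1) :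
    AnalyticAt ℂ (fun z => ∫ t in (0 : ℝ)..1, F (L t z)) 0 := by
  obtain ⟨p, r, hp⟩ := hF
  obtain ⟨r', hr'0, hr'⟩ := ENNReal.lt_iff_exists_nnreal_btwn.1 hp.r_pos
  have hr'p : (r' : ENNReal) < p.radius := hr'.trans_le hp.r_le
  have hcont : ∀ m, Continuous fun t => (p m).compContinuousLinearMap fun _ => L t := by
    intro m
    have h1 : Continuous fun t =>
        ContinuousMultilinearMap.compContinuousLinearMapContinuousMultilinear ℂ
          (fun _ : Fin m => E) (fun _ : Fin m => E) ℂ (fun _ => L t) :=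
      (ContinuousMultilinearMap.cont _).comp (by fun_prop)
    exact h1.clm_apply continuous_const
  let q : FormalMultilinearSeries ℂ E ℂ := fun m =>
    ∫ t in (0 : ℝ)..1, (p m).compContinuousLinearMap fun _ => L t
  have hI : ∀ t ∈ uIoc (0 : ℝ) 1, t ∈ Icc (0 : ℝ) 1 := fun t ht => by
    rw [uIoc_of_le zero_le_one] at ht
    exact ⟨ht.1.le, ht.2⟩
  have hq : ∀ m, ‖q m‖ ≤ ‖p m‖ := by
    intro m
    have := intervalIntegral.norm_integral_le_of_norm_le_const (a := (0 : ℝ)) (b := 1)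
      (C := ‖p m‖) (f := fun t => (p m).compContinuousLinearMap fun _ => L t) ?_
    · simpa using this
    · intro t ht
      refine ((p m).norm_compContinuousLinearMap_le _).trans ?_
      refine mul_le_of_le_one_right (norm_nonneg _) ?_
      exact Finset.prod_le_one (fun _ _ => norm_nonneg _) fun _ _ => hL1 t (hI t ht)
  refine ⟨q, r', ?_, ?_, ?_⟩
  · obtain ⟨C, -, hC⟩ := p.norm_mul_pow_le_of_lt_radius hr'p
    exact q.le_radius_of_bound C fun m =>
      (mul_le_mul_of_nonneg_right (hq m) (by positivity)).trans (hC m)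
  · exact hr'0
  · intro y hy
    have hy' : ‖y‖ < r' := by simpa using hy
    have hq_apply : ∀ m, q m (fun _ => y) = ∫ t in (0 : ℝ)..1, p m fun _ => L t y := by
      intro m
      have := (ContinuousMultilinearMap.apply ℂ (fun _ : Fin m => E) ℂ fun _ => y
        ).intervalIntegral_comp_comm ((hcont m).intervalIntegrable (μ := MeasureTheory.volume) 0 1)
      simpa using this.symm
    simp only [hq_apply, zero_add]
    have hLy : ∀ t ∈ Icc (0 : ℝ) 1, ‖L t y‖ ≤ ‖y‖ := fun t ht =>
      ((L t).le_opNorm y).trans (mul_le_of_le_one_left (norm_nonneg _) (hL1 t ht))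
    refine intervalIntegral.hasSum_integral_of_dominated_convergence
      (fun m _ => ‖p m‖ * (r' : ℝ) ^ m) ?_ ?_ ?_ ?_ ?_
    · intro m
      have : Continuous fun t => p m fun _ => L t y :=
        (p m).cont.comp (continuous_pi fun _ => hL.clm_apply continuous_const)
      exact this.aestronglyMeasurable
    · intro m
      refine Eventually.of_forall fun t ht => ((p m).le_opNorm _).trans ?_
      rw [Finset.prod_const, Finset.card_univ, Fintype.card_fin]
      gcongr
      exact (hLy t (hI t ht)).trans hy'.le
    · exact Eventually.of_forall fun t _ => p.summable_norm_mul_pow hr'p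
    · exact intervalIntegrable_const
    · refine Eventually.of_forall fun t ht => ?_
      have := hp.hasSum (y := L t y) (by
        rw [Metric.mem_eball, edist_zero_right]
        refine lt_trans ?_ hr'
        rw [← ofReal_norm, ← ENNReal.ofReal_coe_nnreal]
        exact (ENNReal.ofReal_lt_ofReal_iff_of_nonneg (norm_nonneg _)).2
          ((hLy t (hI t ht)).trans_lt hy'))
      simpa using this

/-- Analytic germs form a domain: where `f` is non-zero, `g` vanishes on an open set, hence on the
whole ball by the identity theorem. -/
theorem eventually_eq_zero_or_eq_zero_of_mul {E : Type*} [NormedAddCommGroup E] [NormedSpace ℂ E]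
    {f g : E → ℂ} {a : E} (hf : AnalyticAt ℂ f a) (hg : AnalyticAt ℂ g a)
    (h : ∀ᶠ z in 𝓝 a, f z * g z = 0) : (∀ᶠ z in 𝓝 a, f z = 0) ∨ ∀ᶠ z in 𝓝 a, g z = 0 := by
  obtain ⟨r, hr, hB⟩ := Metric.eventually_nhds_iff_ball.1
    (hf.eventually_analyticAt.and (hg.eventually_analyticAt.and h))
  by_cases hz : ∃ b ∈ Metric.ball a r, f b ≠ 0
  · right
    obtain ⟨b, hb, hfb⟩ := hz
    have h1 : ∀ᶠ z in 𝓝 b, g z = 0 := by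
      filter_upwards [(hB b hb).1.continuousAt.eventually_ne hfb,
        Metric.isOpen_ball.mem_nhds hb] with z hz hzB
      exact (mul_eq_zero.1 (hB z hzB).2.2).resolve_left hz
    have h2 : AnalyticOnNhd ℂ g (Metric.ball a r) := fun z hz => (hB z hz).2.1
    have h3 := h2.eqOn_zero_of_preconnected_of_eventuallyEq_zero
      (convex_ball a r).isPreconnected hb h1
    filter_upwards [Metric.ball_mem_nhds a hr] with z hz using h3 hz
  · left
    push Not at hz
    filter_upwards [Metric.ball_mem_nhds a hr] with z hz' using hz z hz'

theorem exists_eventually_eq_zero_of_prod {E κ : Type*} [NormedAddCommGroup E] [NormedSpace ℂ E]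
    {f : κ → E → ℂ} {a : E} (J : Finset κ) (hf : ∀ j ∈ J, AnalyticAt ℂ (f j) a)
    (h : ∀ᶠ z in 𝓝 a, ∏ j ∈ J, f j z = 0) : ∃ j ∈ J, ∀ᶠ z in 𝓝 a, f j z = 0 := by
  classical
  induction J using Finset.induction_on with
  | empty => simpa using h.self_of_nhds
  | insert i J hi ih =>
    simp only [Finset.prod_insert hi] at h
    rcases eventually_eq_zero_or_eq_zero_of_mul (hf i (Finset.mem_insert_self _ _))
      (Finset.analyticAt_fun_prod J fun j hj => hf j (Finset.mem_insert_of_mem hj)) h with h | h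
    · exact ⟨i, Finset.mem_insert_self _ _, h⟩
    · obtain ⟨j, hj, hj'⟩ := ih (fun j hj => hf j (Finset.mem_insert_of_mem hj)) h
      exact ⟨j, Finset.mem_insert_of_mem hj, hj'⟩

variable {n : ℕ}

/-- Hadamard's lemma: `f` is integrated along the segment that joins `z` to its projection to `z_j =
0`. The quotient is the integral of `∂f/∂z_j` over this segment, where `L t` multiplies the `j`-th
coordinate by `t`. -/
theorem exists_eq_coord_mul {f : (Fin n → ℂ) → ℂ} {a : Fin n → ℂ} (hf : AnalyticAt ℂ f a)
    {j : Fin n} (ha : a j = 0) (h : ∀ᶠ z in 𝓝 a, z j = 0 → f z = 0) :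
    ∃ g, AnalyticAt ℂ g a ∧ ∀ᶠ z in 𝓝 a, f z = z j * g z := by
  classical
  let e : Fin n → ℂ := Pi.single j 1
  let L : ℝ → (Fin n → ℂ) →L[ℂ] (Fin n → ℂ) := fun t =>
    ContinuousLinearMap.id ℂ (Fin n → ℂ) -
      ((1 - t : ℝ) : ℂ) • (ContinuousLinearMap.proj (R := ℂ) (φ := fun _ : Fin n => ℂ) j).smulRight e
  have hLapp : ∀ t w, L t w = w - (((1 - t : ℝ) : ℂ) * w j) • e := fun t w => by
    simp [L, mul_smul]
  have hLj : ∀ t w, L t w j = t * w j := fun t w => by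
    simp [hLapp, e]
    ring
  have hLi : ∀ t w i, i ≠ j → L t w i = w i := fun t w i hi => by
    simp [hLapp, e, hi]
  have hL : Continuous L := by fun_prop
  have hLw : ∀ t ∈ Icc (0 : ℝ) 1, ∀ w, ‖L t w‖ ≤ ‖w‖ := by
    intro t ht w
    refine (pi_norm_le_iff_of_nonneg (norm_nonneg _)).2 fun i => ?_
    by_cases hi : i = j
    · subst hi
      rw [hLj, norm_mul]
      refine (mul_le_of_le_one_left (norm_nonneg _) ?_).trans (norm_le_pi_norm w i)
      rw [Complex.norm_real, Real.norm_of_nonneg ht.1]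
      exact ht.2
    · rw [hLi t w i hi]
      exact norm_le_pi_norm w i
  have hL1 : ∀ t ∈ Icc (0 : ℝ) 1, ‖L t‖ ≤ 1 := fun t ht =>
    ContinuousLinearMap.opNorm_le_bound _ zero_le_one fun w => by
      rw [one_mul]
      exact hLw t ht w
  let F : (Fin n → ℂ) → ℂ := fun w => fderiv ℂ f (a + w) e
  have hF0 : AnalyticAt ℂ F 0 := by
    have h1 : AnalyticAt ℂ (fderiv ℂ f) (a + 0) := by
      rw [add_zero]
      exact hf.fderiv
    have h2 : AnalyticAt ℂ (fun w => fderiv ℂ f (a + w)) 0 :=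
      h1.comp (f := fun w => a + w) (analyticAt_const.add analyticAt_id)
    exact (((ContinuousLinearMap.apply ℂ ℂ e).analyticAt _).comp h2)
  have hg := analyticAt_integral_comp hF0 hL hL1
  refine ⟨fun z => ∫ t in (0 : ℝ)..1, F (L t (z - a)), ?_, ?_⟩
  · refine AnalyticAt.fun_comp (g := fun z => ∫ t in (0 : ℝ)..1, F (L t z)) (f := fun z => z - a) ?_
      (analyticAt_id.sub analyticAt_const)
    rwa [sub_self]
  · obtain ⟨r, hr, hB⟩ := Metric.eventually_nhds_iff_ball.1 (hf.eventually_analyticAt.and h)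
    filter_upwards [Metric.ball_mem_nhds a hr] with z hz
    have hmem : ∀ t ∈ Icc (0 : ℝ) 1, a + L t (z - a) ∈ Metric.ball a r := by
      intro t ht
      rw [mem_ball_iff_norm, add_sub_cancel_left]
      exact (hLw t ht _).trans_lt (mem_ball_iff_norm.1 hz)
    have hd : ∀ t ∈ uIcc (0 : ℝ) 1,
        HasDerivAt (fun t : ℝ => f (a + L t (z - a))) (z j * F (L t (z - a))) t := by
      intro t ht
      rw [uIcc_of_le zero_le_one] at ht
      have h1 := (hB _ (hmem t ht)).1.differentiableAt.hasFDerivAt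
      have h2 : HasDerivAt (fun t : ℝ => a + L t (z - a)) (z j • e) t := by
        simp only [hLapp]
        have h3 : HasDerivAt (fun t : ℝ => (((1 - t : ℝ) : ℂ) * (z - a) j)) (-z j) t := by
          have h4 : HasDerivAt (fun t : ℝ => ((1 - t : ℝ) : ℂ)) (-1) t := by
            have := ((hasDerivAt_id t).const_sub 1).ofReal_comp
            simpa using this
          simpa [ha] using h4.mul_const ((z - a) j)
        have h5 := ((h3.smul_const e).const_sub (z - a)).const_add a
        simpa using h5
      have h6 := (h1.restrictScalars ℝ).comp_hasDerivAt t h2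
      simpa [F, Function.comp_def] using h6
    have hc : ContinuousOn (fun t => z j * F (L t (z - a))) (uIcc (0 : ℝ) 1) := by
      intro t ht
      rw [uIcc_of_le zero_le_one] at ht
      have h1 : ContinuousAt (fun w => fderiv ℂ f w e) (a + L t (z - a)) :=
        ((hB _ (hmem t ht)).1.fderiv.continuousAt).clm_apply continuousAt_const
      have h2 : ContinuousAt (fun t => a + L t (z - a)) t :=
        (continuous_const.add (hL.clm_apply continuous_const)).continuousAt
      have h3 : ContinuousAt (fun t => F (L t (z - a))) t :=
        ContinuousAt.comp (f := fun t => a + L t (z - a)) (g := fun w => fderiv ℂ f w e) h1 h2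
      exact (continuousAt_const.mul h3).continuousWithinAt
    have h1 := intervalIntegral.integral_eq_sub_of_hasDerivAt hd hc.intervalIntegrable
    have h2 : f (a + L 0 (z - a)) = 0 := by
      apply (hB _ (hmem 0 ⟨le_rfl, zero_le_one⟩)).2
      simp [hLj, ha]
    have h3 : a + L 1 (z - a) = z := by simp [hLapp]
    rw [h2, h3, sub_zero, intervalIntegral.integral_const_mul] at h1
    exact h1.symm

/-- A Hurwitz type statement on the lines parallel to `(1, …, 1)`. -/
theorem eventually_exists_eq_zero_on_diagonal {f : (Fin n → ℂ) → ℂ} {a : Fin n → ℂ}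
    (hf : AnalyticAt ℂ f a) (hfa : f a = 0) {J : Finset (Fin n)}
    (ha : ∀ j ∈ J, a j = 0) (h : ∀ᶠ z in 𝓝 a, (∀ j ∈ J, z j ≠ 0) → f z ≠ 0) :
    ∀ᶠ c in 𝓝 a, ∃ j ∈ J, f (c - fun _ => c j) = 0 := by
  obtain ⟨r, hr, hB⟩ := Metric.eventually_nhds_iff_ball.1 (hf.eventually_analyticAt.and h)
  let d : ℂ → Fin n → ℂ := fun s _ => s
  have hdc : Continuous d := by fun_prop
  have hdn : ∀ s, ‖d s‖ ≤ ‖s‖ := fun s =>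
    (pi_norm_le_iff_of_nonneg (norm_nonneg _)).2 fun _ => le_rfl
  have hadd : ∀ c ∈ Metric.ball a (r / 2), ∀ s : ℂ, ‖s‖ ≤ r / 2 → c + d s ∈ Metric.ball a r := by
    intro c hc s hs
    rw [mem_ball_iff_norm] at hc ⊢
    calc ‖c + d s - a‖ = ‖(c - a) + d s‖ := by congr 1; abel
      _ ≤ ‖c - a‖ + ‖d s‖ := norm_add_le _ _
      _ < r := by linarith [hdn s]
  have hr2 : 0 < r / 2 := by positivity
  have haB : a ∈ Metric.ball a (r / 2) := Metric.mem_ball_self hr2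
  -- On the diagonal line through `a`, all coordinates in `J` equal the parameter `s`, so `f` can
  -- vanish only at `s = 0`.
  have hcirc : ∀ s ∈ Metric.sphere (0 : ℂ) (r / 2), f (a + d s) ≠ 0 := by
    intro s hs
    have hs' : ‖s‖ = r / 2 := by simpa using hs
    refine (hB _ (hadd a haB s hs'.le)).2 fun j hj => ?_
    have : s ≠ 0 := by
      rintro rfl
      simp at hs'
      linarith
    simpa [d, ha j hj] using this
  have hcont : ∀ c ∈ Metric.ball a (r / 2), ∀ s : ℂ, ‖s‖ ≤ r / 2 →
      ContinuousAt (fun p : (Fin n → ℂ) × ℂ => f (p.1 + d p.2)) (c, s) := by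
    intro c hc s hs
    exact ContinuousAt.comp (f := fun p : (Fin n → ℂ) × ℂ => p.1 + d p.2) (g := f)
      (hB _ (hadd c hc s hs)).1.continuousAt (by fun_prop)
  obtain ⟨m, hm0, hm⟩ : ∃ m > 0, ∀ s ∈ Metric.sphere (0 : ℂ) (r / 2), m < ‖f (a + d s)‖ := by
    have hne : (Metric.sphere (0 : ℂ) (r / 2)).Nonempty := NormedSpace.sphere_nonempty.2 hr2.le
    have hco : ContinuousOn (fun s => ‖f (a + d s)‖) (Metric.sphere (0 : ℂ) (r / 2)) := by
      intro s hs
      have hs' : ‖s‖ = r / 2 := by simpa using hs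
      exact (ContinuousAt.comp (f := fun s => (a, s))
        (g := fun p : (Fin n → ℂ) × ℂ => f (p.1 + d p.2)) (hcont a haB s hs'.le)
        (by fun_prop)).norm.continuousWithinAt
    obtain ⟨s, hs, hmin⟩ := (isCompact_sphere (0 : ℂ) (r / 2)).exists_isMinOn hne hco
    have := norm_pos_iff.2 (hcirc s hs)
    exact ⟨‖f (a + d s)‖ / 2, by positivity, fun t ht => (by linarith [show ‖f (a + d s)‖ ≤ ‖f (a + d t)‖ from hmin ht])⟩
  have hev : ∀ᶠ c in 𝓝 a, ∀ s ∈ Metric.sphere (0 : ℂ) (r / 2), m < ‖f (c + d s)‖ := by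
    refine (isCompact_sphere (0 : ℂ) (r / 2)).eventually_forall_of_forall_eventually fun s hs => ?_
    have hs' : ‖s‖ = r / 2 := by simpa using hs
    exact (hcont a haB s hs'.le).norm.eventually (lt_mem_nhds (hm s hs))
  have hev2 : ∀ᶠ c in 𝓝 a, ‖f c‖ < m := by
    have := hf.continuousAt.norm
    apply this.eventually (gt_mem_nhds _)
    simpa [hfa] using hm0
  filter_upwards [hev, hev2, Metric.ball_mem_nhds a hr2] with c hc1 hc2 hcB
  have hex : ∃ s : ℂ, ‖s‖ ≤ r / 2 ∧ f (c + d s) = 0 := by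
    by_contra! hno
    -- Without zeros in the disc, the maximum principle for `1 / f` contradicts `|f c| < m < |f|` on
    -- the circle.
    have hdiff : DiffContOnCl ℂ (fun s => (f (c + d s))⁻¹) (Metric.ball (0 : ℂ) (r / 2)) := by
      apply DifferentiableOn.diffContOnCl
      rw [closure_ball _ hr2.ne']
      intro s hs
      have hs' : ‖s‖ ≤ r / 2 := by simpa using hs
      have h1 : DifferentiableAt ℂ (fun s => f (c + d s)) s :=
        DifferentiableAt.comp (f := fun s => c + d s) (g := f) s
          (hB _ (hadd c hcB s hs')).1.differentiableAt (by fun_prop)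
      exact (h1.inv (hno s hs')).differentiableWithinAt
    have := Complex.norm_le_of_forall_mem_frontier_norm_le Metric.isBounded_ball hdiff
      (C := m⁻¹) (fun s hs => by
        rw [frontier_ball _ hr2.ne'] at hs
        rw [norm_inv]
        exact inv_anti₀ hm0 (hc1 s hs).le) (z := 0)
      (subset_closure (Metric.mem_ball_self hr2))
    have hd0 : d 0 = 0 := rfl
    rw [hd0, add_zero, norm_inv] at this
    have hfc : 0 < ‖f c‖ := by
      have := hno 0 (by simpa using hr2.le)
      rw [hd0, add_zero] at this
      exact norm_pos_iff.2 this
    have := (inv_le_inv₀ hfc hm0).1 this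
    linarith
  obtain ⟨s, hs, hs0⟩ := hex
  -- A zero on the line must have some coordinate `c j + s` equal to zero with `j ∈ J`, which
  -- determines `s`.
  by_contra! hno
  refine (hB _ (hadd c hcB s hs)).2 (fun j hj h0 => ?_) hs0
  have hsj : s = -c j := by
    have : c j + s = 0 := h0
    linear_combination this
  apply hno j hj
  rw [← hs0, hsj]
  congr 1

/-- For each `c` near `a`, one of finitely many analytic functions `c ↦ f (c - c_j (1, …, 1))`
vanishes, so their product is the zero germ. Since germs form a domain, a single `j` works for all
`c`. -/
theorem exists_eventually_eq_zero_of_coord_eq_zero {f : (Fin n → ℂ) → ℂ} {a : Fin n → ℂ}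
    (hf : AnalyticAt ℂ f a) (hfa : f a = 0) {J : Finset (Fin n)}
    (ha : ∀ j ∈ J, a j = 0) (h : ∀ᶠ z in 𝓝 a, (∀ j ∈ J, z j ≠ 0) → f z ≠ 0) :
    ∃ j ∈ J, ∀ᶠ z in 𝓝 a, z j = 0 → f z = 0 := by
  have h1 := eventually_exists_eq_zero_on_diagonal hf hfa ha h
  have h2 : ∀ᶠ c in 𝓝 a, ∏ j ∈ J, f (c - fun _ => c j) = 0 := by
    filter_upwards [h1] with c hc
    obtain ⟨j, hj, hj'⟩ := hc
    exact Finset.prod_eq_zero hj hj'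
  have h4 : ∀ j ∈ J, AnalyticAt ℂ (fun c : Fin n → ℂ => f (c - fun _ => c j)) a := by
    intro j hj
    have h3 : AnalyticAt ℂ (fun c : Fin n → ℂ => c - fun _ : Fin n => c j) a := by
      refine analyticAt_id.sub (AnalyticAt.pi fun _ => ?_)
      exact (ContinuousLinearMap.proj (R := ℂ) (φ := fun _ : Fin n => ℂ) j).analyticAt a
    refine AnalyticAt.fun_comp (g := f) (f := fun c : Fin n → ℂ => c - fun _ : Fin n => c j) ?_ h3
    convert hf
    ext i
    simp [ha j hj]
  obtain ⟨j, hj, hj'⟩ := exists_eventually_eq_zero_of_prod J h4 h2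
  refine ⟨j, hj, ?_⟩
  -- On the hyperplane `z j = 0` the translation by `z j` along the diagonal is trivial.
  filter_upwards [hj'] with z hz hzj
  rw [← hz, hzj]
  congr 1
  ext i
  simp

/-- A holomorphic germ without zeros outside the hyperplanes `z_j = 0`, `j ∈ J`, is the product of
a unit and a monomial in the `z_j`. -/
theorem exists_eq_unit_mul_monomial {f : (Fin n → ℂ) → ℂ} {a : Fin n → ℂ}
    (hf : AnalyticAt ℂ f a) {J : Finset (Fin n)}
    (ha : ∀ j ∈ J, a j = 0) (h : ∀ᶠ z in 𝓝 a, (∀ j ∈ J, z j ≠ 0) → f z ≠ 0) :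
    ∃ (u : (Fin n → ℂ) → ℂ) (m : Fin n → ℕ), AnalyticAt ℂ u a ∧ u a ≠ 0 ∧
      ∀ᶠ z in 𝓝 a, f z = u z * ∏ j ∈ J, z j ^ m j := by
  classical
  -- The induction is on the order of vanishing along the diagonal line through `a`: on this line
  -- each `z j` with `j ∈ J` is the parameter, so dividing by `z j` lowers the order by exactly one,
  -- and order `0` means a unit.
  have hdiag : Tendsto (fun τ : ℂ => a + fun _ => τ) (𝓝 0) (𝓝 a) := by
    have : Continuous (fun τ : ℂ => a + fun _ : Fin n => τ) := by fun_prop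
    have h1 := this.tendsto 0
    have h2 : (a + fun _ : Fin n => (0 : ℂ)) = a := by ext i; simp
    rwa [h2] at h1
  have key : ∀ N : ℕ, ∀ f : (Fin n → ℂ) → ℂ, AnalyticAt ℂ f a →
      (∀ᶠ z in 𝓝 a, (∀ j ∈ J, z j ≠ 0) → f z ≠ 0) →
      (∃ g : ℂ → ℂ, ContinuousAt g 0 ∧ g 0 ≠ 0 ∧
        ∀ᶠ τ in 𝓝[≠] (0 : ℂ), f (a + fun _ => τ) = τ ^ N * g τ) →
      ∃ (u : (Fin n → ℂ) → ℂ) (m : Fin n → ℕ), AnalyticAt ℂ u a ∧ u a ≠ 0 ∧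
        ∀ᶠ z in 𝓝 a, f z = u z * ∏ j ∈ J, z j ^ m j := by
    intro N
    induction N with
    | zero =>
      rintro f hf - ⟨g, hg, hg0, hfg⟩
      refine ⟨f, 0, hf, ?_, by simp⟩
      have h1 : Tendsto (fun τ : ℂ => f (a + fun _ => τ)) (𝓝[≠] 0) (𝓝 (f a)) :=
        (hf.continuousAt.tendsto.comp hdiag).mono_left nhdsWithin_le_nhds
      have h2 : Tendsto (fun τ : ℂ => f (a + fun _ => τ)) (𝓝[≠] 0) (𝓝 (g 0)) :=
        (hg.tendsto.mono_left nhdsWithin_le_nhds).congr' (hfg.mono fun τ h => by simp [h])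
      rwa [tendsto_nhds_unique h1 h2]
    | succ N ih =>
      rintro f hf hz ⟨g, hg, hg0, hfg⟩
      have hfa : f a = 0 := by
        have h1 : Tendsto (fun τ : ℂ => f (a + fun _ => τ)) (𝓝[≠] 0) (𝓝 (f a)) :=
          (hf.continuousAt.tendsto.comp hdiag).mono_left nhdsWithin_le_nhds
        have h2 : Tendsto (fun τ : ℂ => τ ^ (N + 1) * g τ) (𝓝[≠] 0) (𝓝 (0 ^ (N + 1) * g 0)) :=
          (((continuous_pow (N + 1)).continuousAt (x := (0 : ℂ))).mul hg).tendsto.mono_left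
            nhdsWithin_le_nhds
        have h3 := tendsto_nhds_unique h1 (h2.congr' (hfg.mono fun τ h => h.symm))
        simpa using h3
      obtain ⟨j, hj, hj'⟩ := exists_eventually_eq_zero_of_coord_eq_zero hf hfa ha hz
      obtain ⟨f1, hf1, hff1⟩ := exists_eq_coord_mul hf (ha j hj) hj'
      have hz1 : ∀ᶠ z in 𝓝 a, (∀ j ∈ J, z j ≠ 0) → f1 z ≠ 0 := by
        filter_upwards [hz, hff1] with z h1 h2 h3 h4
        exact h1 h3 (by rw [h2, h4, mul_zero])
      obtain ⟨u, m, hu, hu0, hum⟩ := ih f1 hf1 hz1 ⟨g, hg, hg0, by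
        filter_upwards [hfg, nhdsWithin_le_nhds (hdiag.eventually hff1), self_mem_nhdsWithin]
          with τ h1 h2 h3
        have h4 : τ ≠ 0 := h3
        rw [h1] at h2
        simp only [Pi.add_apply, ha j hj, zero_add] at h2
        apply mul_left_cancel₀ h4
        rw [← h2]
        ring⟩
      refine ⟨u, m + Pi.single j 1, hu, hu0, ?_⟩
      filter_upwards [hff1, hum] with z h1 h2
      rw [h1, h2]
      simp only [Pi.add_apply, pow_add, Finset.prod_mul_distrib]
      have : ∏ i ∈ J, z i ^ (Pi.single j 1 : Fin n → ℕ) i = z j := by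
        rw [Finset.prod_eq_single_of_mem j hj]
        · simp
        · intro i _ hi
          simp [hi]
      rw [this]
      ring
  have h1 : AnalyticAt ℂ (fun τ : ℂ => f (a + fun _ => τ)) 0 := by
    refine AnalyticAt.fun_comp (g := f) (f := fun τ : ℂ => a + fun _ : Fin n => τ) ?_
      (analyticAt_const.add (AnalyticAt.pi fun _ => analyticAt_id))
    have h2 : (a + fun _ : Fin n => (0 : ℂ)) = a := by ext i; simp
    rwa [h2]
  have hne : ∀ᶠ τ in 𝓝[≠] (0 : ℂ), f (a + fun _ => τ) ≠ 0 := by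
    filter_upwards [nhdsWithin_le_nhds (hdiag.eventually h), self_mem_nhdsWithin] with τ h2 h3
    refine h2 fun j hj => ?_
    have h4 : τ ≠ 0 := h3
    simpa [ha j hj] using h4
  obtain ⟨N, g, hg, hg0, hfg⟩ := h1.exists_eventuallyEq_pow_smul_nonzero_iff.2 fun h0 => by
    obtain ⟨τ, hτ, hτ'⟩ := (hne.and (nhdsWithin_le_nhds h0)).exists
    exact hτ hτ'
  exact key N f hf h ⟨g, hg.continuousAt, hg0, nhdsWithin_le_nhds (hfg.mono fun τ h => by simpa using h)⟩

end SeveralVariables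

end SemistableDegeneration

namespace SemistableDegeneration

open Set Filter

/-! ### Holomorphic germs on a complex manifold and their differentials -/

section Germs

variable (n : ℕ) {X : Type*} [TopologicalSpace X] [ChartedSpace (Fin n → ℂ) X]

/-- `f` is holomorphic near `p`. -/
abbrev HolAt (f : X → ℂ) (p : X) : Prop := ContMDiffAt 𝓘(ℂ, Fin n → ℂ) 𝓘(ℂ, ℂ) ω f p

/-- The differential of `f` at `p`, in the preferred chart at `p`. -/
noncomputable def diffAt (f : X → ℂ) (p : X) : (Fin n → ℂ) →L[ℂ] ℂ :=
  fderiv ℂ (f ∘ (chartAt (Fin n → ℂ) p).symm) (chartAt (Fin n → ℂ) p p)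

variable {n}

theorem contDiffAt_omega_iff {E F : Type*} [NormedAddCommGroup E] [NormedSpace ℂ E]
    [NormedAddCommGroup F] [NormedSpace ℂ F] [CompleteSpace F] {f : E → F} {x : E} :
    ContDiffAt ℂ ω f x ↔ AnalyticAt ℂ f x := by
  rw [← contDiffWithinAt_univ, contDiffWithinAt_omega_iff_analyticWithinAt, analyticWithinAt_univ]

theorem holAt_iff_analyticAt [IsManifold 𝓘(ℂ, Fin n → ℂ) ω X]
    {e : OpenPartialHomeomorph X (Fin n → ℂ)}
    (he : e ∈ IsManifold.maximalAtlas 𝓘(ℂ, Fin n → ℂ) ω X) {f : X → ℂ} {p : X}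
    (hp : p ∈ e.source) : HolAt n f p ↔ AnalyticAt ℂ (f ∘ e.symm) (e p) := by
  rw [← contDiffAt_omega_iff, ← contMDiffAt_iff_contDiffAt]
  constructor
  · intro h
    have h1 := contMDiffAt_symm_of_mem_maximalAtlas he (e.map_source hp)
    refine ContMDiffAt.comp (e p) ?_ h1
    rwa [e.left_inv hp]
  · intro h
    have h1 := contMDiffAt_of_mem_maximalAtlas he hp
    have h2 := ContMDiffAt.comp p h h1
    refine h2.congr_of_eventuallyEq ?_
    filter_upwards [e.open_source.mem_nhds hp] with x hx
    simp [e.left_inv hx]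

theorem HolAt.analyticAt_chartAt [IsManifold 𝓘(ℂ, Fin n → ℂ) ω X] {f : X → ℂ} {p : X}
    (h : HolAt n f p) :
    AnalyticAt ℂ (f ∘ (chartAt (Fin n → ℂ) p).symm) (chartAt (Fin n → ℂ) p p) :=
  (holAt_iff_analyticAt (IsManifold.chart_mem_maximalAtlas p) (mem_chart_source _ p)).1 h

theorem HolAt.hasFDerivAt [IsManifold 𝓘(ℂ, Fin n → ℂ) ω X] {f : X → ℂ} {p : X}
    (h : HolAt n f p) :
    HasFDerivAt (f ∘ (chartAt (Fin n → ℂ) p).symm) (diffAt n f p) (chartAt (Fin n → ℂ) p p) :=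
  h.analyticAt_chartAt.differentiableAt.hasFDerivAt

theorem tendsto_chartAt_symm (p : X) :
    Tendsto (chartAt (Fin n → ℂ) p).symm (𝓝 (chartAt (Fin n → ℂ) p p)) (𝓝 p) := by
  have := (chartAt (Fin n → ℂ) p).continuousAt_symm (mem_chart_target _ p)
  rwa [ContinuousAt, (chartAt (Fin n → ℂ) p).left_inv (mem_chart_source _ p)] at this

theorem diffAt_congr {f g : X → ℂ} {p : X} (h : f =ᶠ[𝓝 p] g) : diffAt n f p = diffAt n g p :=
  Filter.EventuallyEq.fderiv_eq (h.comp_tendsto (tendsto_chartAt_symm p))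

theorem diffAt_add [IsManifold 𝓘(ℂ, Fin n → ℂ) ω X] {f g : X → ℂ} {p : X} (hf : HolAt n f p)
    (hg : HolAt n g p) : diffAt n (fun x => f x + g x) p = diffAt n f p + diffAt n g p :=
  (hf.hasFDerivAt.add hg.hasFDerivAt).fderiv

theorem diffAt_mul [IsManifold 𝓘(ℂ, Fin n → ℂ) ω X] {f g : X → ℂ} {p : X} (hf : HolAt n f p)
    (hg : HolAt n g p) :
    diffAt n (fun x => f x * g x) p = f p • diffAt n g p + g p • diffAt n f p := by
  refine (hf.hasFDerivAt.mul hg.hasFDerivAt).fderiv.trans ?_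
  simp [(chartAt (Fin n → ℂ) p).left_inv (mem_chart_source _ p)]

theorem diffAt_mul_of_eq_zero [IsManifold 𝓘(ℂ, Fin n → ℂ) ω X] {f g : X → ℂ} {p : X}
    (hf : HolAt n f p) (hg : HolAt n g p) (hf0 : f p = 0) :
    diffAt n (fun x => f x * g x) p = g p • diffAt n f p := by
  ext v
  simp [diffAt_mul hf hg, hf0]

theorem diffAt_const_mul [IsManifold 𝓘(ℂ, Fin n → ℂ) ω X] {f : X → ℂ} {p : X} (c : ℂ)
    (hf : HolAt n f p) : diffAt n (fun x => c * f x) p = c • diffAt n f p :=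
  (hf.hasFDerivAt.const_mul c).fderiv

theorem diffAt_eq_mfderiv [IsManifold 𝓘(ℂ, Fin n → ℂ) ω X] {f : X → ℂ} {p : X} (hf : HolAt n f p)
    (v : Fin n → ℂ) : diffAt n f p v = mfderiv 𝓘(ℂ, Fin n → ℂ) 𝓘(ℂ, ℂ) f p v := by
  rw [(hf.mdifferentiableAt (by simp)).mfderiv]
  simp [diffAt, fderivWithin_univ, writtenInExtChartAt, Function.comp_def]
  rfl

theorem holAt_linear_comp_chartAt [IsManifold 𝓘(ℂ, Fin n → ℂ) ω X] (p : X)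
    (l : (Fin n → ℂ) →L[ℂ] ℂ) :
    HolAt n (fun x => l (chartAt (Fin n → ℂ) p x)) p ∧
      diffAt n (fun x => l (chartAt (Fin n → ℂ) p x)) p = l := by
  have h1 : (fun x => l (chartAt (Fin n → ℂ) p x)) ∘ (chartAt (Fin n → ℂ) p).symm
      =ᶠ[𝓝 (chartAt (Fin n → ℂ) p p)] l := by
    filter_upwards [(chartAt (Fin n → ℂ) p).open_target.mem_nhds (mem_chart_target _ p)] with z hz
    simp [(chartAt (Fin n → ℂ) p).right_inv hz]
  constructor
  · rw [holAt_iff_analyticAt (IsManifold.chart_mem_maximalAtlas p) (mem_chart_source _ p)]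
    exact (l.analyticAt _).congr h1.symm
  · rw [diffAt, h1.fderiv_eq, l.fderiv]

theorem holAt_coord [IsManifold 𝓘(ℂ, Fin n → ℂ) ω X] {e : OpenPartialHomeomorph X (Fin n → ℂ)}
    (he : e ∈ IsManifold.maximalAtlas 𝓘(ℂ, Fin n → ℂ) ω X) {p : X} (hp : p ∈ e.source)
    (j : Fin n) : HolAt n (fun x => e x j) p := by
  rw [holAt_iff_analyticAt he hp]
  refine ((ContinuousLinearMap.proj (R := ℂ) (φ := fun _ : Fin n => ℂ) j).analyticAt _).congr ?_
  filter_upwards [e.open_target.mem_nhds (e.map_source hp)] with z hz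
  simp [e.right_inv hz]

/-- The dual basis consists of the images of the standard vectors under the derivative of the
transition map to the preferred chart. -/
theorem linearIndependent_diffAt_coord [IsManifold 𝓘(ℂ, Fin n → ℂ) ω X]
    {e : OpenPartialHomeomorph X (Fin n → ℂ)}
    (he : e ∈ IsManifold.maximalAtlas 𝓘(ℂ, Fin n → ℂ) ω X) {p : X} (hp : p ∈ e.source) :
    ∃ b : Fin n → Fin n → ℂ, ∀ i j, diffAt n (fun x => e x i) p (b j) = if i = j then 1 else 0 := by
  let φ := chartAt (Fin n → ℂ) p
  have h1 : DifferentiableAt ℂ (φ ∘ e.symm) (e p) := by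
    have : ContMDiffAt 𝓘(ℂ, Fin n → ℂ) 𝓘(ℂ, Fin n → ℂ) ω (φ ∘ e.symm) (e p) := by
      refine ContMDiffAt.comp (e p) (I' := 𝓘(ℂ, Fin n → ℂ)) ?_
        (contMDiffAt_symm_of_mem_maximalAtlas he (e.map_source hp))
      rw [e.left_inv hp]
      exact contMDiffAt_of_mem_maximalAtlas (IsManifold.chart_mem_maximalAtlas p)
        (mem_chart_source _ p)
    exact (contMDiffAt_iff_contDiffAt.1 this).differentiableAt (by simp)
  refine ⟨fun j => fderiv ℂ (φ ∘ e.symm) (e p) (Pi.single j 1), fun i j => ?_⟩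
  have h2 : HasFDerivAt ((fun x => e x i) ∘ φ.symm) (diffAt n (fun x => e x i) p)
      ((φ ∘ e.symm) (e p)) := by
    have := (holAt_coord he hp i).hasFDerivAt
    simpa [e.left_inv hp] using this
  have h3 := h2.comp (e p) h1.hasFDerivAt
  have h4 : ((fun x => e x i) ∘ φ.symm) ∘ (φ ∘ e.symm) =ᶠ[𝓝 (e p)]
      (ContinuousLinearMap.proj (R := ℂ) (φ := fun _ : Fin n => ℂ) i) := by
    have h5 : ∀ᶠ z in 𝓝 (e p), e.symm z ∈ φ.source := by
      have := e.continuousAt_symm (e.map_source hp)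
      rw [ContinuousAt, e.left_inv hp] at this
      exact this.eventually (φ.open_source.mem_nhds (mem_chart_source _ p))
    filter_upwards [e.open_target.mem_nhds (e.map_source hp), h5] with z hz hz'
    simp [φ.left_inv hz', e.right_inv hz]
  have h6 := h3.congr_of_eventuallyEq h4.symm
  have h7 := (ContinuousLinearMap.proj (R := ℂ) (φ := fun _ : Fin n => ℂ) i).hasFDerivAt (x := e p)
  have h8 := congrArg (fun l => l (Pi.single j 1)) (h6.unique h7)
  simpa [Pi.single_apply] using h8

/-- The holomorphic inverse function theorem: functions with independent differentials are
the coordinates of a holomorphic chart. -/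
theorem exists_chart_of_linearIndependent [IsManifold 𝓘(ℂ, Fin n → ℂ) ω X] {F : Fin n → X → ℂ}
    {p : X} (hF : ∀ j, HolAt n (F j) p) (hli : LinearIndependent ℂ fun j => diffAt n (F j) p) :
    ∃ e ∈ IsManifold.maximalAtlas 𝓘(ℂ, Fin n → ℂ) ω X, p ∈ e.source ∧
      ∀ x ∈ e.source, ∀ j, e x j = F j x := by
  let φ := chartAt (Fin n → ℂ) p
  let G : (Fin n → ℂ) → (Fin n → ℂ) := fun z j => F j (φ.symm z)
  have hG : ContDiffAt ℂ ω G (φ p) :=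
    contDiffAt_pi.2 fun j => contDiffAt_omega_iff.2 (hF j).analyticAt_chartAt
  let T : (Fin n → ℂ) →L[ℂ] (Fin n → ℂ) := ContinuousLinearMap.pi fun j => diffAt n (F j) p
  have hGT : HasFDerivAt G T (φ p) := hasFDerivAt_pi.2 fun j => (hF j).hasFDerivAt
  have hT : Function.Injective T := by
    rw [injective_iff_map_eq_zero]
    intro v hv
    -- The `n` independent differentials span the dual space, so a vector killed by all of them is
    -- killed by every functional.
    have hspan : Submodule.span ℂ (range fun j => (diffAt n (F j) p : (Fin n → ℂ) →ₗ[ℂ] ℂ)) = ⊤ := by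
      apply LinearIndependent.span_eq_top_of_card_eq_finrank'
      · exact hli.map' (ContinuousLinearMap.coeLM ℂ) (LinearMap.ker_eq_bot.2
          ContinuousLinearMap.coe_injective)
      · rw [Subspace.dual_finrank_eq]
        simp
    have hz : ∀ l : (Fin n → ℂ) →ₗ[ℂ] ℂ, l v = 0 := by
      intro l
      have hl : l ∈ Submodule.span ℂ (range fun j => (diffAt n (F j) p : (Fin n → ℂ) →ₗ[ℂ] ℂ)) := by
        rw [hspan]
        trivial
      induction hl using Submodule.span_induction with
      | mem l hl =>
        obtain ⟨j, rfl⟩ := hl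
        exact congrFun hv j
      | zero => rfl
      | add _ _ _ _ h1 h2 => simp [h1, h2]
      | smul c _ _ h => simp [h]
    ext j
    exact hz (LinearMap.proj j)
  let T' : (Fin n → ℂ) ≃L[ℂ] (Fin n → ℂ) :=
    (LinearEquiv.ofInjectiveEndo (T : (Fin n → ℂ) →ₗ[ℂ] (Fin n → ℂ)) hT).toContinuousLinearEquiv
  have hT' : (T' : (Fin n → ℂ) →L[ℂ] (Fin n → ℂ)) = T := by
    ext v
    rfl
  have hGT' : HasFDerivAt G (T' : (Fin n → ℂ) →L[ℂ] (Fin n → ℂ)) (φ p) := by rwa [hT']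
  let g := hG.toOpenPartialHomeomorph G hGT' (by simp)
  have hga : φ p ∈ g.source := hG.mem_toOpenPartialHomeomorph_source hGT' (by simp)
  have hginv : ContDiffAt ℂ ω g.symm (G (φ p)) := hG.to_localInverse hGT' (by simp)
  -- The inverse function theorem gives analyticity at one point only. The domain is shrunk to where
  -- both `G` and its inverse are analytic, as compatibility with the atlas requires.
  obtain ⟨V, hV, hVo, hpV⟩ := eventually_nhds_iff.1
    (contDiffAt_omega_iff.1 hginv).eventually_analyticAt
  obtain ⟨W, hW, hWo, hpW⟩ := eventually_nhds_iff.1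
    (contDiffAt_omega_iff.1 hG).eventually_analyticAt
  let s := W ∩ g.source ∩ g ⁻¹' V
  have hso : IsOpen (g.source ∩ g ⁻¹' V) := g.isOpen_inter_preimage hVo
  let g' := g.restrOpen (W ∩ (g.source ∩ g ⁻¹' V)) (hWo.inter hso)
  have hg's : g'.source = g.source ∩ (W ∩ (g.source ∩ g ⁻¹' V)) := g.restrOpen_source _ _
  let e := φ.trans g'
  have hes : ∀ x ∈ e.source, x ∈ φ.source ∧ φ x ∈ W ∧ φ x ∈ g'.source := by
    intro x hx
    rw [OpenPartialHomeomorph.trans_source] at hx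
    have h2 : φ x ∈ g'.source := hx.2
    have h3 := h2
    rw [hg's] at h3
    exact ⟨hx.1, h3.2.1, h2⟩
  have hex : ∀ x, e x = G (φ x) := fun x => rfl
  refine ⟨e, ?_, ?_, ?_⟩
  · apply OpenPartialHomeomorph.mem_maximalAtlas_of_contMDiffOn
    · intro x hx
      obtain ⟨h1, h2, h3⟩ := hes x hx
      have h4 : ContMDiffAt 𝓘(ℂ, Fin n → ℂ) 𝓘(ℂ, Fin n → ℂ) ω G (φ x) :=
        contMDiffAt_iff_contDiffAt.2 (contDiffAt_omega_iff.2 (hW _ h2))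
      exact (ContMDiffAt.comp x h4 (contMDiffAt_of_mem_maximalAtlas
        (IsManifold.chart_mem_maximalAtlas p) h1)).contMDiffWithinAt
    · intro y hy
      have hx := e.map_target hy
      obtain ⟨h1, h2, h3⟩ := hes _ hx
      have hyV : y ∈ V := by
        have h4 := h3
        rw [hg's] at h4
        have h5 : g (φ (e.symm y)) ∈ V := h4.2.2.2
        have h6 : e (e.symm y) = y := e.right_inv hy
        rw [hex] at h6
        rw [← h6]
        exact h5
      have h4 : ContMDiffAt 𝓘(ℂ, Fin n → ℂ) 𝓘(ℂ, Fin n → ℂ) ω g.symm y :=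
        contMDiffAt_iff_contDiffAt.2 (contDiffAt_omega_iff.2 (hV _ hyV))
      have h5 : g.symm y ∈ φ.target := by
        rw [OpenPartialHomeomorph.trans_target] at hy
        exact hy.2
      exact (ContMDiffAt.comp y (contMDiffAt_symm_of_mem_maximalAtlas
        (IsManifold.chart_mem_maximalAtlas p) h5) h4).contMDiffWithinAt
  · rw [OpenPartialHomeomorph.trans_source]
    refine ⟨mem_chart_source _ p, ?_⟩
    change φ p ∈ g'.source
    rw [hg's]
    exact ⟨hga, hpW, hga, hpV⟩
  · intro x hx j
    rw [hex]
    change F j (φ.symm (φ x)) = F j x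
    rw [φ.left_inv (hes x hx).1]

/-- Steinitz exchange: while an index is missing, the current span is proper, so some vector of `S`
lies outside it. It completes prescribed differentials by differentials of real functions. -/
theorem exists_linearIndependent_extension {V : Type*} [AddCommGroup V] [Module ℂ V]
    [FiniteDimensional ℂ V] (hV : Module.finrank ℂ V = n) {S : Set V}
    (hS : Submodule.span ℂ S = ⊤) (J : Finset (Fin n)) (g : Fin n → V)
    (hg : LinearIndepOn ℂ g (J : Set (Fin n))) :
    ∃ g' : Fin n → V, (∀ j ∈ J, g' j = g j) ∧ (∀ j ∉ J, g' j ∈ S) ∧ LinearIndependent ℂ g' := by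
  classical
  by_cases hJ : J = Finset.univ
  · refine ⟨g, fun _ _ => rfl, fun j hj => absurd (hJ ▸ Finset.mem_univ j) hj, ?_⟩
    rw [hJ, Finset.coe_univ] at hg
    exact linearIndepOn_univ_iff.1 hg
  obtain ⟨i, hi⟩ : ∃ i, i ∉ J := by
    by_contra! h
    exact hJ (Finset.eq_univ_iff_forall.2 h)
  obtain ⟨s, hs, hs'⟩ : ∃ s ∈ S, s ∉ Submodule.span ℂ (g '' J) := by
    by_contra! h
    have h1 : (⊤ : Submodule ℂ V) ≤ Submodule.span ℂ (g '' J) := by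
      rw [← hS]
      exact Submodule.span_le.2 h
    have h2 : Module.finrank ℂ (Submodule.span ℂ (g '' J)) ≤ J.card := by
      rw [← Finset.coe_image]
      exact (finrank_span_finset_le_card _).trans Finset.card_image_le
    rw [top_le_iff.1 h1, finrank_top, hV] at h2
    have h3 := Finset.card_lt_univ_of_notMem hi
    rw [Fintype.card_fin] at h3
    omega
  have hup : ∀ j ∈ J, Function.update g i s j = g j := fun j hj =>
    Function.update_of_ne (ne_of_mem_of_not_mem hj hi) _ _
  have h1 : LinearIndepOn ℂ (Function.update g i s) ((insert i J : Finset (Fin n)) : Set (Fin n)) := by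
    rw [Finset.coe_insert]
    refine LinearIndepOn.insert (hg.congr fun j hj => (hup j hj).symm) ?_
    rw [Function.update_self]
    have : Function.update g i s '' J = g '' J := image_congr fun j hj => hup j hj
    rwa [this]
  have hcard : n - (insert i J).card < n - J.card := by
    have h3 := Finset.card_lt_univ_of_notMem hi
    rw [Fintype.card_fin] at h3
    rw [Finset.card_insert_of_notMem hi]
    omega
  obtain ⟨g', hg1, hg2, hg3⟩ := exists_linearIndependent_extension hV hS (insert i J) _ h1
  refine ⟨g', fun j hj => ?_, fun j hj => ?_, hg3⟩
  · rw [hg1 j (Finset.mem_insert_of_mem hj), hup j hj]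
  · by_cases hji : j = i
    · subst hji
      rw [hg1 j (Finset.mem_insert_self _ _), Function.update_self]
      exact hs
    · exact hg2 j (by simp [hji, hj])
termination_by n - J.card

end Germs

end SemistableDegeneration

namespace SemistableDegeneration

open Set Filter

/-! ### Real coordinates in which `π` is a product of coordinates -/

section RealCharts

variable {n : ℕ} {X : Type*} [TopologicalSpace X] [ChartedSpace (Fin n → ℂ) X]
  {π : X → 𝔻} {ι : X → X}

/-- `e` is a holomorphic chart in which `ι` is the complex conjugation and `π` is the product of
the coordinates `z_j`, `j ∈ J`. -/
structure IsRealChart (π : X → 𝔻) (ι : X → X) (e : OpenPartialHomeomorph X (Fin n → ℂ))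
    (J : Finset (Fin n)) : Prop where
  mem_maximalAtlas : e ∈ IsManifold.maximalAtlas 𝓘(ℂ, Fin n → ℂ) ω X
  nonempty : J.Nonempty
  map_mem : ∀ x ∈ e.source, ι x ∈ e.source
  map_conj : ∀ x ∈ e.source, ∀ j, e (ι x) j = conj (e x j)
  eq_prod : ∀ x ∈ e.source, (π x : ℂ) = ∏ j ∈ J, e x j

theorem IsRealStructure.holAt_conj (hι : IsRealStructure n π ι) {p : X} (hp : ι p = p) {f : X → ℂ}
    (hf : HolAt n f p) : HolAt n (fun x => conj (f (ι x))) p :=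
  hι.antiholomorphic p f (by rwa [hp])

theorem IsRealStructure.eventually (hι : IsRealStructure n π ι) {p : X} (hp : ι p = p)
    {P : X → Prop} (h : ∀ᶠ x in 𝓝 p, P x) : ∀ᶠ x in 𝓝 p, P (ι x) := by
  have := hι.continuous.tendsto p
  rw [hp] at this
  exact this.eventually h

variable [IsManifold 𝓘(ℂ, Fin n → ℂ) ω X]

/-- Every holomorphic `w` is a complex combination of the real functions `w + w'` and `i w - i w'`,
where `w' = conj ∘ w ∘ ι`. -/
theorem IsRealStructure.span_real_diffAt (hι : IsRealStructure n π ι) {p : X} (hp : ι p = p) :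
    Submodule.span ℂ {l | ∃ f : X → ℂ, HolAt n f p ∧ (∀ x, f (ι x) = conj (f x)) ∧
      diffAt n f p = l} = ⊤ := by
  rw [eq_top_iff]
  intro l _
  set S := {l | ∃ f : X → ℂ, HolAt n f p ∧ (∀ x, f (ι x) = conj (f x)) ∧ diffAt n f p = l}
  obtain ⟨hw, hwl⟩ := holAt_linear_comp_chartAt p l
  set w : X → ℂ := fun x => l (chartAt (Fin n → ℂ) p x)
  have hwc := hι.holAt_conj hp hw
  have hiw : HolAt n (fun x => Complex.I * w x) p := contMDiffAt_const.mul hw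
  have hiwc : HolAt n (fun x => -Complex.I * conj (w (ι x))) p := contMDiffAt_const.mul hwc
  have h1 : diffAt n (fun x => w x + conj (w (ι x))) p ∈ S := by
    refine ⟨_, hw.add hwc, fun x => ?_, rfl⟩
    simp [hι.involutive x, add_comm]
  have h2 : diffAt n (fun x => Complex.I * w x + -Complex.I * conj (w (ι x))) p ∈ S := by
    refine ⟨_, hiw.add hiwc, fun x => ?_, rfl⟩
    simp [hι.involutive x, add_comm]
  rw [diffAt_add hw hwc] at h1
  rw [diffAt_add hiw hiwc, diffAt_const_mul _ hw, diffAt_const_mul _ hwc] at h2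
  have h3 : l = (1 / 2 : ℂ) • (diffAt n w p + diffAt n (fun x => conj (w (ι x))) p) +
      (-Complex.I / 2) • (Complex.I • diffAt n w p +
        -Complex.I • diffAt n (fun x => conj (w (ι x))) p) := by
    ext v
    simp only [hwl, add_apply, smul_apply, smul_eq_mul]
    linear_combination (l v / 2 - (diffAt n (fun x => conj (w (ι x))) p) v / 2) * Complex.I_mul_I
  rw [h3]
  exact Submodule.add_mem _ (Submodule.smul_mem _ _ (Submodule.subset_span h1))
    (Submodule.smul_mem _ _ (Submodule.subset_span h2))

/-- The given real functions are completed to coordinates by further real functions, which is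
possible because real differentials span. The chart is then restricted to a domain stable under `ι`.
-/
theorem IsRealStructure.exists_isRealChart (hι : IsRealStructure n π ι) {p : X} (hp : ι p = p)
    {J : Finset (Fin n)} (hJ : J.Nonempty) {F : Fin n → X → ℂ} (hF : ∀ j ∈ J, HolAt n (F j) p)
    (hreal : ∀ j ∈ J, ∀ᶠ x in 𝓝 p, F j (ι x) = conj (F j x))
    (hli : LinearIndepOn ℂ (fun j => diffAt n (F j) p) (J : Set (Fin n)))
    (hprod : ∀ᶠ x in 𝓝 p, (π x : ℂ) = ∏ j ∈ J, F j x) :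
    ∃ e : OpenPartialHomeomorph X (Fin n → ℂ), p ∈ e.source ∧ IsRealChart π ι e J := by
  classical
  have hfin : Module.finrank ℂ ((Fin n → ℂ) →L[ℂ] ℂ) = n := by
    rw [← (LinearMap.toContinuousLinearMap (𝕜 := ℂ) (E := Fin n → ℂ) (F' := ℂ)).finrank_eq]
    simp [Subspace.dual_finrank_eq (K := ℂ) (V := Fin n → ℂ)]
  have : FiniteDimensional ℂ ((Fin n → ℂ) →L[ℂ] ℂ) :=
    Module.Finite.equiv (LinearMap.toContinuousLinearMap (𝕜 := ℂ) (E := Fin n → ℂ) (F' := ℂ))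
  obtain ⟨g, hg1, hg2, hg3⟩ := exists_linearIndependent_extension hfin (hι.span_real_diffAt hp) J _ hli
  have hG : ∀ j, ∃ G : X → ℂ, HolAt n G p ∧ (∀ᶠ x in 𝓝 p, G (ι x) = conj (G x)) ∧
      diffAt n G p = g j ∧ (j ∈ J → G = F j) := by
    intro j
    by_cases hj : j ∈ J
    · exact ⟨F j, hF j hj, hreal j hj, (hg1 j hj).symm, fun _ => rfl⟩
    · obtain ⟨f, hf, hf', hf''⟩ := hg2 j hj
      exact ⟨f, hf, Eventually.of_forall hf', hf'', fun h => absurd h hj⟩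
  choose G hG1 hG2 hG3 hG4 using hG
  obtain ⟨e, he, hpe, heG⟩ := exists_chart_of_linearIndependent hG1 (by simpa only [hG3] using hg3)
  have hall : ∀ᶠ x in 𝓝 p, x ∈ e.source ∧ (∀ j, G j (ι x) = conj (G j x)) ∧
      (π x : ℂ) = ∏ j ∈ J, G j x := by
    filter_upwards [e.open_source.mem_nhds hpe, eventually_all.2 hG2, hprod] with x h1 h2 h3
    refine ⟨h1, h2, ?_⟩
    rw [h3]
    exact Finset.prod_congr rfl fun j hj => by rw [hG4 j hj]
  obtain ⟨U, hU, hUo, hpU⟩ := eventually_nhds_iff.1 hall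
  have hVo : IsOpen (U ∩ ι ⁻¹' U) := hUo.inter (hUo.preimage hι.continuous)
  have hs : ∀ x, x ∈ (e.restr (U ∩ ι ⁻¹' U)).source ↔ x ∈ U ∩ ι ⁻¹' U := by
    intro x
    rw [e.restr_source' _ hVo]
    exact ⟨fun h => h.2, fun h => ⟨(hU x h.1).1, h⟩⟩
  refine ⟨e.restr (U ∩ ι ⁻¹' U), (hs p).2 ⟨hpU, by rwa [mem_preimage, hp]⟩,
    restr_mem_maximalAtlas (contDiffGroupoid ω 𝓘(ℂ, Fin n → ℂ)) he hVo, hJ, ?_, ?_, ?_⟩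
  · intro x hx
    rw [hs] at hx ⊢
    exact ⟨hx.2, by rw [mem_preimage, hι.involutive x]; exact hx.1⟩
  · intro x hx j
    rw [hs] at hx
    change e (ι x) j = conj (e x j)
    rw [heG _ (hU _ hx.2).1, heG _ (hU _ hx.1).1]
    exact (hU _ hx.1).2.1 j
  · intro x hx
    rw [hs] at hx
    change (π x : ℂ) = ∏ j ∈ J, e x j
    rw [(hU _ hx.1).2.2]
    exact Finset.prod_congr rfl fun j _ => (heG _ (hU _ hx.1).1 j).symm

theorem IsSemistable.exists_isRealChart_of_ne_zero (hπ : IsSemistable n π)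
    (hι : IsRealStructure n π ι) {p : X} (hp : ι p = p) (h0 : (π p : ℂ) ≠ 0) :
    ∃ (e : OpenPartialHomeomorph X (Fin n → ℂ)) (J : Finset (Fin n)), p ∈ e.source ∧ IsRealChart π ι e J := by
  have hd : diffAt n (fun x => (π x : ℂ)) p ≠ 0 := by
    intro h
    obtain ⟨v, hv⟩ := hπ.regular p h0 (1 : ℂ)
    have h1 := diffAt_eq_mfderiv (hπ.holomorphic p) v
    rw [h] at h1
    exact zero_ne_one (h1.trans hv)
  have hn : 0 < n := by
    rcases Nat.eq_zero_or_pos n with rfl | h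
    · refine absurd ?_ hd
      ext v
      exact (congrArg _ (Subsingleton.elim v 0)).trans (map_zero _)
    · exact h
  refine Exists.imp (fun e he => ⟨_, he⟩) (hι.exists_isRealChart hp (J := {⟨0, hn⟩})
    (Finset.singleton_nonempty _) (F := fun _ x => (π x : ℂ)) (fun _ _ => hπ.holomorphic p)
    (fun _ _ => ?_) ?_ ?_)
  · refine Eventually.of_forall fun x => ?_
    simp [hι.map_conj]
  · rw [Finset.coe_singleton]
    exact LinearIndepOn.singleton hd
  · simp

theorem eventually_eq_zero_or_eq_zero_of_holAt_mul {p : X} {f g : X → ℂ} (hf : HolAt n f p)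
    (hg : HolAt n g p) (h : ∀ᶠ x in 𝓝 p, f x * g x = 0) :
    (∀ᶠ x in 𝓝 p, f x = 0) ∨ ∀ᶠ x in 𝓝 p, g x = 0 := by
  have key : ∀ {f : X → ℂ}, (∀ᶠ z in 𝓝 (chartAt (Fin n → ℂ) p p),
      (f ∘ (chartAt (Fin n → ℂ) p).symm) z = 0) → ∀ᶠ x in 𝓝 p, f x = 0 := by
    intro f h
    filter_upwards [((chartAt (Fin n → ℂ) p).continuousAt (mem_chart_source _ p)).eventually h,
      (chartAt (Fin n → ℂ) p).open_source.mem_nhds (mem_chart_source _ p)] with x h1 h2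
    simpa [(chartAt (Fin n → ℂ) p).left_inv h2] using h1
  exact (eventually_eq_zero_or_eq_zero_of_mul hf.analyticAt_chartAt hg.analyticAt_chartAt
    ((tendsto_chartAt_symm p).eventually h)).imp key key

/-- Factorization of the elements of `divisorMonoid`, on a manifold. -/
theorem exists_holAt_eq_unit_mul_monomial {e : OpenPartialHomeomorph X (Fin n → ℂ)}
    (he : e ∈ IsManifold.maximalAtlas 𝓘(ℂ, Fin n → ℂ) ω X) {p : X} (hp : p ∈ e.source)
    {f : X → ℂ} (hf : HolAt n f p) {J : Finset (Fin n)} (ha : ∀ j ∈ J, e p j = 0)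
    (h : ∀ᶠ x in 𝓝 p, (∀ j ∈ J, e x j ≠ 0) → f x ≠ 0) :
    ∃ (u : X → ℂ) (m : Fin n → ℕ), HolAt n u p ∧ u p ≠ 0 ∧
      ∀ᶠ x in 𝓝 p, f x = u x * ∏ j ∈ J, e x j ^ m j := by
  have hsymm : Tendsto e.symm (𝓝 (e p)) (𝓝 p) := by
    have := e.continuousAt_symm (e.map_source hp)
    rwa [ContinuousAt, e.left_inv hp] at this
  obtain ⟨u, m, hu, hu0, hum⟩ := exists_eq_unit_mul_monomial ((holAt_iff_analyticAt he hp).1 hf) ha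
    (by
      filter_upwards [hsymm.eventually h, e.open_target.mem_nhds (e.map_source hp)] with z h1 h2
      simpa [e.right_inv h2] using h1)
  refine ⟨u ∘ e, m, ?_, hu0, ?_⟩
  · rw [holAt_iff_analyticAt he hp]
    refine hu.congr ?_
    filter_upwards [e.open_target.mem_nhds (e.map_source hp)] with z h2
    simp [e.right_inv h2]
  · filter_upwards [(e.continuousAt hp).eventually hum, e.open_source.mem_nhds hp] with x h1 h2
    simpa [e.left_inv h2] using h1

/-- The components of `g` are conjugates of holomorphic functions, hence real differentiable. This
identifies the real manifold derivative used in `IsTotallyReal` with an honest derivative in the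
chart. -/
theorem hasFDerivAt_real_of_coord {g : X → X} {p : X} (hg : Continuous g) (hgp : g p = p)
    (h : ∀ j, HolAt n (fun x => conj (chartAt (Fin n → ℂ) p (g x) j)) p) :
    ∃ D : (Fin n → ℂ) →L[ℝ] (Fin n → ℂ),
      HasFDerivAt (fun z => chartAt (Fin n → ℂ) p (g ((chartAt (Fin n → ℂ) p).symm z))) D
        (chartAt (Fin n → ℂ) p p) ∧
      ∀ v : Fin n → ℂ,
        (mfderiv 𝓘(ℝ, Fin n → ℂ) 𝓘(ℝ, Fin n → ℂ) g p : (Fin n → ℂ) → (Fin n → ℂ)) v = D v := by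
  let D : (Fin n → ℂ) →L[ℝ] (Fin n → ℂ) :=
    ContinuousLinearMap.pi fun j => (Complex.conjCLE : ℂ →L[ℝ] ℂ).comp
      ((diffAt n (fun x => conj (chartAt (Fin n → ℂ) p (g x) j)) p).restrictScalars ℝ)
  have h1 : HasFDerivAt (fun z => chartAt (Fin n → ℂ) p (g ((chartAt (Fin n → ℂ) p).symm z))) D
      (chartAt (Fin n → ℂ) p p) := by
    rw [hasFDerivAt_pi']
    intro j
    have h2 := (Complex.conjCLE : ℂ →L[ℝ] ℂ).hasFDerivAt.comp (chartAt (Fin n → ℂ) p p)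
      ((h j).hasFDerivAt.restrictScalars ℝ)
    refine (h2.congr_fderiv ?_).congr_of_eventuallyEq ?_
    · ext v
      simp [D]
    · refine Eventually.of_forall fun z => ?_
      simp
  have hw : writtenInExtChartAt 𝓘(ℝ, Fin n → ℂ) 𝓘(ℝ, Fin n → ℂ) p g =
      fun z => chartAt (Fin n → ℂ) p (g ((chartAt (Fin n → ℂ) p).symm z)) := by
    ext z
    simp [writtenInExtChartAt, hgp]
  have hmd : MDifferentiableAt 𝓘(ℝ, Fin n → ℂ) 𝓘(ℝ, Fin n → ℂ) g p := by
    rw [mdifferentiableAt_iff]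
    refine ⟨hg.continuousAt, ?_⟩
    rw [hw]
    exact h1.differentiableAt.differentiableWithinAt
  have hf : fderivWithin ℝ (writtenInExtChartAt 𝓘(ℝ, Fin n → ℂ) 𝓘(ℝ, Fin n → ℂ) p g)
      (range 𝓘(ℝ, Fin n → ℂ)) (extChartAt 𝓘(ℝ, Fin n → ℂ) p p) = D := by
    rw [hw, show range 𝓘(ℝ, Fin n → ℂ) = univ by simp, fderivWithin_univ]
    exact h1.fderiv
  refine ⟨D, h1, fun v => ?_⟩
  rw [hmd.mfderiv]
  exact congrArg (fun l => l v) hf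

/-- The chain rule for `conj ∘ f ∘ ι` at a real point. -/
theorem IsRealStructure.diffAt_conj (hι : IsRealStructure n π ι) {p : X} (hp : ι p = p) {f : X → ℂ}
    (hf : HolAt n f p) (v : Fin n → ℂ) :
    diffAt n (fun x => conj (f (ι x))) p v = conj (diffAt n f p
      ((mfderiv 𝓘(ℝ, Fin n → ℂ) 𝓘(ℝ, Fin n → ℂ) ι p : (Fin n → ℂ) → (Fin n → ℂ)) v)) := by
  let φ := chartAt (Fin n → ℂ) p
  obtain ⟨D, h2, hD⟩ := hasFDerivAt_real_of_coord hι.continuous hp fun j =>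
    hι.holAt_conj hp (holAt_coord (IsManifold.chart_mem_maximalAtlas p) (mem_chart_source _ p) j)
  rw [hD]
  have h3 : HasFDerivAt (f ∘ φ.symm) (diffAt n f p) (φ (ι (φ.symm (φ p)))) := by
    rw [φ.left_inv (mem_chart_source _ p), hp]
    exact hf.hasFDerivAt
  have h4 := (Complex.conjCLE : ℂ →L[ℝ] ℂ).hasFDerivAt.comp (φ p)
    ((h3.restrictScalars ℝ).comp (φ p) h2)
  have h5 : (fun x => conj (f (ι x))) ∘ φ.symm =ᶠ[𝓝 (φ p)]
      (Complex.conjCLE : ℂ →L[ℝ] ℂ) ∘ ((f ∘ φ.symm) ∘ fun z => φ (ι (φ.symm z))) := by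
    have h6 : ∀ᶠ x in 𝓝 p, ι x ∈ φ.source :=
      hι.eventually hp (φ.open_source.mem_nhds (mem_chart_source _ p))
    filter_upwards [(tendsto_chartAt_symm p).eventually h6] with z hz
    have hz' : ι (φ.symm z) ∈ φ.source := hz
    simp [φ.left_inv hz']
  have h7 := (h4.congr_of_eventuallyEq h5).unique
    ((hι.holAt_conj hp hf).hasFDerivAt.restrictScalars ℝ)
  have h8 := congrArg (fun l => l v) h7
  simpa using h8.symm

theorem exists_holAt_eq_coord_mul {e : OpenPartialHomeomorph X (Fin n → ℂ)}
    (he : e ∈ IsManifold.maximalAtlas 𝓘(ℂ, Fin n → ℂ) ω X) {p : X} (hp : p ∈ e.source)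
    {f : X → ℂ} (hf : HolAt n f p) (hf0 : f p = 0) {J : Finset (Fin n)} (ha : ∀ j ∈ J, e p j = 0)
    (h : ∀ᶠ x in 𝓝 p, (∀ j ∈ J, e x j ≠ 0) → f x ≠ 0) :
    ∃ l ∈ J, ∃ u : X → ℂ, HolAt n u p ∧ ∀ᶠ x in 𝓝 p, f x = e x l * u x := by
  obtain ⟨u, m, hu, hu0, hum⟩ := exists_holAt_eq_unit_mul_monomial he hp hf ha h
  have h1 := hum.self_of_nhds
  rw [hf0] at h1
  obtain ⟨l, hl, hl0⟩ := Finset.prod_eq_zero_iff.1 ((mul_eq_zero.1 h1.symm).resolve_left hu0)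
  have hml : m l ≠ 0 := by
    intro h2
    rw [h2, pow_zero] at hl0
    exact one_ne_zero hl0
  refine ⟨l, hl, fun x => u x * (e x l ^ (m l - 1) * ∏ j ∈ J.erase l, e x j ^ m j), ?_, ?_⟩
  · refine hu.mul (((holAt_coord he hp l).pow _).mul ?_)
    exact contMDiffAt_finsetProd fun j _ => (holAt_coord he hp j).pow _
  · filter_upwards [hum] with x hx
    rw [hx, ← Finset.mul_prod_erase J _ hl]
    nth_rewrite 1 [← Nat.sub_add_cancel (Nat.one_le_iff_ne_zero.2 hml)]
    rw [pow_succ]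
    ring

/-- At a real point of a totally real degeneration, each branch of the special fibre is
preserved by `ι`. -/
theorem IsNormalCrossingChart.conj_coord_eq (hι : IsRealStructure n π ι)
    (hreal : IsTotallyReal n π ι) {p : X} (hp : ι p = p) {e : OpenPartialHomeomorph X (Fin n → ℂ)}
    {J : Finset (Fin n)} (he : IsNormalCrossingChart n π p e J) {j : Fin n} (hj : j ∈ J) :
    ∃ B : X → ℂ, HolAt n B p ∧ B p ≠ 0 ∧ ∀ᶠ x in 𝓝 p, conj (e (ι x) j) = e x j * B x := by
  obtain ⟨u, hu, hπu⟩ := he.eq_mul_prod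
  have hcoord := fun i => holAt_coord he.mem_maximalAtlas he.mem_source i
  have hz0 : ∀ i, e p i = 0 := fun i => by rw [he.centred]; rfl
  have hc := hι.holAt_conj hp (hcoord j)
  -- As `ι` preserves the special fibre, `conj ∘ z_j ∘ ι` vanishes only there. By factorization it
  -- is divisible by some `z_l`, a priori with `l ≠ j`.
  have hnv : ∀ᶠ x in 𝓝 p, (∀ i ∈ J, e x i ≠ 0) → conj (e (ι x) j) ≠ 0 := by
    have h1 := e.open_source.mem_nhds he.mem_source
    filter_upwards [h1, hι.eventually hp h1] with x hx hx' hne h0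
    have h2 : e (ι x) j = 0 := by simpa using h0
    have h3 := (hπu _ hx').2
    rw [Finset.prod_eq_zero hj h2, mul_zero, hι.map_conj, Complex.UnitDisc.coe_star,
      map_eq_zero, (hπu _ hx).2] at h3
    exact mul_ne_zero (hπu _ hx).1 (Finset.prod_ne_zero_iff.2 hne) h3
  obtain ⟨l, hl, B, hB, hBe⟩ := exists_holAt_eq_coord_mul he.mem_maximalAtlas he.mem_source hc
    (by simp [hp, hz0]) (fun i _ => hz0 i) hnv
  obtain ⟨b, hb⟩ := linearIndependent_diffAt_coord he.mem_maximalAtlas he.mem_source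
  have hdne : ∀ i, diffAt n (fun x => e x i) p ≠ 0 := fun i h0 => by
    have := hb i i
    simp [h0] at this
  -- Applying the involution once more expresses `z_j` as `conj ∘ z_l ∘ ι` times a factor with value
  -- `conj (B p)` at `p`; if this were zero, `dz_j` would vanish.
  have hBp : B p ≠ 0 := by
    intro hB0
    have h1 : (fun x => e x j) =ᶠ[𝓝 p] fun x => conj (e (ι x) l) * conj (B (ι x)) := by
      filter_upwards [hι.eventually hp hBe] with x hx
      rw [hι.involutive x] at hx
      simpa using congrArg conj hx
    have h2 := diffAt_congr (n := n) h1
    rw [diffAt_mul_of_eq_zero (hι.holAt_conj hp (hcoord l)) (hι.holAt_conj hp hB)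
      (by simp [hp, hz0])] at h2
    apply hdne j
    rw [h2]
    ext v
    simp [hp, hB0]
  have hd : diffAt n (fun x => conj (e (ι x) j)) p = B p • diffAt n (fun x => e x l) p := by
    rw [diffAt_congr (n := n) hBe, diffAt_mul_of_eq_zero (hcoord l) hB (hz0 l)]
  -- This is where total reality is used. If `l ≠ j`, the dual vector `b l` lies in `ker dz_j`, so
  -- `dι (b l)` does too; the chain rule then gives `B p * dz_l (b l) = 0`, whereas `dz_l (b l) =
  -- 1`.
  have hlj : l = j := by
    by_contra hne
    let H : Submodule ℂ (Fin n → ℂ) := LinearMap.ker (diffAt n (fun x => e x j) p).toLinearMap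
    have hπ0 : (π p : ℂ) = 0 := by
      rw [(hπu p he.mem_source).2, Finset.prod_eq_zero hj (hz0 j), mul_zero]
    have hH : H ∈ tangentConeHyperplanes n π p :=
      ⟨e, J, he, j, hj, fun v => by rw [← diffAt_eq_mfderiv (hcoord j)]; rfl⟩
    have h1 := hreal p hp hπ0 H hH
    have h2 : b l ∈ H := by
      change diffAt n (fun x => e x j) p (b l) = 0
      rw [hb, if_neg (Ne.symm hne)]
    have h3 : (mfderiv 𝓘(ℝ, Fin n → ℂ) 𝓘(ℝ, Fin n → ℂ) ι p : (Fin n → ℂ) → (Fin n → ℂ)) (b l)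
        ∈ (H : Set (Fin n → ℂ)) := by
      rw [← h1]
      exact mem_image_of_mem _ h2
    have h4 : diffAt n (fun x => e x j) p
        ((mfderiv 𝓘(ℝ, Fin n → ℂ) 𝓘(ℝ, Fin n → ℂ) ι p : (Fin n → ℂ) → (Fin n → ℂ)) (b l)) = 0 := h3
    have h5 := hι.diffAt_conj hp (hcoord j) (b l)
    rw [h4, hd, map_zero] at h5
    simp [hb, hBp] at h5
  exact ⟨B, hB, hBp, hlj ▸ hBe⟩

theorem IsNormalCrossingChart.exists_real_coord (hι : IsRealStructure n π ι)
    (hreal : IsTotallyReal n π ι) {p : X} (hp : ι p = p) {e : OpenPartialHomeomorph X (Fin n → ℂ)}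
    {J : Finset (Fin n)} (he : IsNormalCrossingChart n π p e J) {j : Fin n} (hj : j ∈ J) :
    ∃ f B : X → ℂ, HolAt n f p ∧ HolAt n B p ∧ B p ≠ 0 ∧ (∀ x, f (ι x) = conj (f x)) ∧
      ∀ᶠ x in 𝓝 p, f x = B x * e x j := by
  obtain ⟨B, hB, hBp, hBe⟩ := he.conj_coord_eq hι hreal hp hj
  have hcoord := holAt_coord he.mem_maximalAtlas he.mem_source j
  -- The symmetrization of `c z_j` is `(c + conj c * B) z_j`. The factor cannot vanish at `p` for
  -- both `c = 1` and `c = i`, which would require `B p = -1` and `B p = 1`.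
  obtain ⟨c, hc⟩ : ∃ c : ℂ, c + conj c * B p ≠ 0 := by
    by_contra! h
    have h1 := h 1
    have h2 := h Complex.I
    simp only [map_one, Complex.conj_I] at h1 h2
    have h3 : B p = -1 := by linear_combination h1
    rw [h3] at h2
    have h4 : (2 : ℂ) * Complex.I = 0 := by linear_combination h2
    simp at h4
  have h1 : HolAt n (fun x => c * e x j) p := contMDiffAt_const.mul hcoord
  refine ⟨fun x => c * e x j + conj (c * e (ι x) j), fun x => c + conj c * B x,
    h1.add (hι.holAt_conj hp h1), contMDiffAt_const.add (contMDiffAt_const.mul hB), hc, ?_, ?_⟩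
  · intro x
    simp [hι.involutive x, add_comm]
  · filter_upwards [hBe] with x hx
    rw [map_mul, hx]
    ring

theorem IsSemistable.exists_isRealChart_of_eq_zero (hπ : IsSemistable n π)
    (hι : IsRealStructure n π ι) (hreal : IsTotallyReal n π ι) {p : X} (hp : ι p = p)
    (h0 : (π p : ℂ) = 0) : ∃ (e : OpenPartialHomeomorph X (Fin n → ℂ)) (J : Finset (Fin n)), p ∈ e.source ∧ IsRealChart π ι e J := by
  classical
  obtain ⟨e, J, he⟩ := hπ.normalCrossing p h0
  obtain ⟨u, hu, hπu⟩ := he.eq_mul_prod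
  have hcoord := fun i => holAt_coord he.mem_maximalAtlas he.mem_source i
  have hz0 : ∀ i, e p i = 0 := fun i => by rw [he.centred]; rfl
  have hup : HolAt n u p := hu.contMDiffAt (e.open_source.mem_nhds he.mem_source)
  have key : ∀ j, ∃ f B : X → ℂ, j ∈ J → HolAt n f p ∧ HolAt n B p ∧ B p ≠ 0 ∧
      (∀ x, f (ι x) = conj (f x)) ∧ ∀ᶠ x in 𝓝 p, f x = B x * e x j := by
    intro j
    by_cases hj : j ∈ J
    · obtain ⟨f, B, h⟩ := he.exists_real_coord hι hreal hp hj
      exact ⟨f, B, fun _ => h⟩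
    · exact ⟨0, 0, fun h => absurd h hj⟩
  choose f B hfB using key
  have hfd : ∀ j ∈ J, diffAt n (f j) p = B j p • diffAt n (fun x => e x j) p := by
    intro j hj
    obtain ⟨h1, h2, h3, h4, h5⟩ := hfB j hj
    rw [diffAt_congr (n := n) h5]
    simp only [mul_comm (B j _)]
    exact diffAt_mul_of_eq_zero (hcoord j) h2 (hz0 j)
  obtain ⟨b, hb⟩ := linearIndependent_diffAt_coord he.mem_maximalAtlas he.mem_source
  let W : X → ℂ := fun x => u x * (∏ j ∈ J, B j x)⁻¹
  have hprodB : ∏ j ∈ J, B j p ≠ 0 := Finset.prod_ne_zero_iff.2 fun j hj => (hfB j hj).2.2.1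
  have hWp : W p ≠ 0 := mul_ne_zero (hπu p he.mem_source).1 (inv_ne_zero hprodB)
  have hWhol : HolAt n W p := by
    refine hup.mul (ContMDiffAt.inv₀ (contMDiffAt_finsetProd fun j hj => (hfB j hj).2.1) hprodB)
  have hπW : ∀ᶠ x in 𝓝 p, (π x : ℂ) = W x * ∏ j ∈ J, f j x := by
    have h1 : ∀ᶠ x in 𝓝 p, ∀ j ∈ J, f j x = B j x * e x j :=
      (Finset.eventually_all J).2 fun j hj => (hfB j hj).2.2.2.2
    have h2 : ∀ᶠ x in 𝓝 p, ∀ j ∈ J, B j x ≠ 0 :=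
      (Finset.eventually_all J).2 fun j hj =>
        (hfB j hj).2.1.continuousAt.eventually_ne (hfB j hj).2.2.1
    filter_upwards [h1, h2, e.open_source.mem_nhds he.mem_source] with x h1 h2 h3
    rw [(hπu x h3).2, Finset.prod_congr rfl h1, Finset.prod_mul_distrib]
    have := Finset.prod_ne_zero_iff.2 h2
    simp only [W]
    field_simp
  have hprodf : HolAt n (fun x => ∏ j ∈ J, f j x) p :=
    contMDiffAt_finsetProd fun j hj => (hfB j hj).1
  -- Both `π` and the `f j` are real, so `W` and `conj ∘ W ∘ ι` have the same product with `∏ f j`.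
  -- This product is not the zero germ, because each `f j` has non-zero differential, and it can be
  -- cancelled.
  have hWreal : ∀ᶠ x in 𝓝 p, W (ι x) = conj (W x) := by
    have h1 : ∀ᶠ x in 𝓝 p, (conj (W (ι x)) - W x) * ∏ j ∈ J, f j x = 0 := by
      filter_upwards [hπW, hι.eventually hp hπW] with x h2 h3
      rw [hι.map_conj, Complex.UnitDisc.coe_star,
        Finset.prod_congr rfl fun j hj => (hfB j hj).2.2.2.1 x] at h3
      have h4 := congrArg conj h3
      rw [Complex.conj_conj, map_mul, map_prod] at h4
      simp only [Complex.conj_conj] at h4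
      rw [sub_mul, ← h4, ← h2, sub_self]
    rcases eventually_eq_zero_or_eq_zero_of_holAt_mul ((hι.holAt_conj hp hWhol).sub hWhol)
      hprodf h1 with h2 | h2
    · filter_upwards [h2] with x hx
      rw [← sub_eq_zero.1 hx, Complex.conj_conj]
    · exfalso
      have h3 : ∃ j ∈ J, ∀ᶠ x in 𝓝 p, f j x = 0 := by
        have key2 : ∀ J' ⊆ J, (∀ᶠ x in 𝓝 p, ∏ j ∈ J', f j x = 0) →
            ∃ j ∈ J', ∀ᶠ x in 𝓝 p, f j x = 0 := by
          intro J'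
          induction J' using Finset.induction_on with
          | empty =>
            intro _ h
            simpa using h.self_of_nhds
          | insert i J' hi ih =>
            intro hsub h
            simp only [Finset.prod_insert hi] at h
            rw [Finset.insert_subset_iff] at hsub
            rcases eventually_eq_zero_or_eq_zero_of_holAt_mul (hfB i hsub.1).1
              (contMDiffAt_finsetProd fun j hj => (hfB j (hsub.2 hj)).1) h with h | h
            · exact ⟨i, Finset.mem_insert_self _ _, h⟩
            · obtain ⟨j, hj, hj'⟩ := ih hsub.2 h
              exact ⟨j, Finset.mem_insert_of_mem hj, hj'⟩
        exact key2 J subset_rfl h2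
      obtain ⟨j, hj, hj0⟩ := h3
      have h4 : diffAt n (f j) p = diffAt n (fun x => (0 : ℂ) * e x j) p :=
        diffAt_congr (n := n) (hj0.mono fun x hx => by simp [hx])
      rw [diffAt_const_mul _ (hcoord j), hfd j hj] at h4
      have h5 := congrArg (fun l => l (b j)) h4
      simp [hb, (hfB j hj).2.2.1] at h5
  obtain ⟨i, hi⟩ := he.nonempty
  -- The real unit `W` is absorbed into one coordinate; this only rescales its differential at `p`.
  let F : Fin n → X → ℂ := fun j x => if j = i then W x * f j x else f j x
  have hFi : ∀ x, F i x = W x * f i x := fun x => if_pos rfl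
  have hFj : ∀ j, j ≠ i → F j = f j := fun j hj => by
    ext x
    exact if_neg hj
  have hF : ∀ j ∈ J, HolAt n (F j) p := by
    intro j hj
    by_cases hji : j = i
    · subst hji
      rw [show F j = fun x => W x * f j x from funext hFi]
      exact hWhol.mul (hfB j hj).1
    · rw [hFj j hji]
      exact (hfB j hj).1
  have hf0 : ∀ j ∈ J, f j p = 0 := fun j hj => by
    rw [(hfB j hj).2.2.2.2.self_of_nhds, hz0, mul_zero]
  have hFd : ∀ j ∈ J, ∃ c : ℂ, c ≠ 0 ∧ diffAt n (F j) p = c • diffAt n (fun x => e x j) p := by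
    intro j hj
    by_cases hji : j = i
    · subst hji
      refine ⟨W p * B j p, mul_ne_zero hWp (hfB j hj).2.2.1, ?_⟩
      rw [show F j = fun x => f j x * W x from funext fun x => (hFi x).trans (mul_comm _ _),
        diffAt_mul_of_eq_zero (hfB j hj).1 hWhol (hf0 j hj), hfd j hj]
      ext v
      simp [mul_assoc]
    · rw [hFj j hji]
      exact ⟨_, (hfB j hj).2.2.1, hfd j hj⟩
  refine Exists.imp (fun e he => ⟨J, he⟩) (hι.exists_isRealChart hp he.nonempty hF ?_ ?_ ?_)
  · intro j hj
    by_cases hji : j = i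
    · subst hji
      filter_upwards [hWreal] with x hx
      rw [hFi, hFi, hx, (hfB j hj).2.2.2.1, ← map_mul]
    · rw [hFj j hji]
      exact Eventually.of_forall (hfB j hj).2.2.2.1
  · rw [linearIndepOn_finset_iff]
    intro g hg j hj
    obtain ⟨c, hc, hcd⟩ := hFd j hj
    have h1 := congrArg (fun l => l (b j)) hg
    simp only [sum_apply, smul_apply, zero_apply] at h1
    rw [Finset.sum_eq_single_of_mem j hj] at h1
    · rw [hcd] at h1
      simpa [hb, hc] using h1
    · intro k hk hkj
      obtain ⟨c', -, hcd'⟩ := hFd k hk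
      rw [hcd']
      simp [hb, hkj]
  · filter_upwards [hπW] with x hx
    have h1 : ∏ j ∈ J.erase i, F j x = ∏ j ∈ J.erase i, f j x :=
      Finset.prod_congr rfl fun j hj => by rw [hFj j (Finset.ne_of_mem_erase hj)]
    rw [hx, ← Finset.mul_prod_erase J _ hi, ← Finset.mul_prod_erase J (fun j => F j x) hi, hFi,
      h1, ← mul_assoc]

/-- Every real point has real coordinates in which `π` is a product of coordinates. -/
theorem IsSemistable.exists_isRealChart (hπ : IsSemistable n π)
    (hι : IsRealStructure n π ι) (hreal : IsTotallyReal n π ι) {p : X} (hp : ι p = p) :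
    ∃ (e : OpenPartialHomeomorph X (Fin n → ℂ)) (J : Finset (Fin n)), p ∈ e.source ∧ IsRealChart π ι e J := by
  by_cases h0 : (π p : ℂ) = 0
  · exact hπ.exists_isRealChart_of_eq_zero hι hreal hp h0
  · exact hπ.exists_isRealChart_of_ne_zero hι hp h0

end RealCharts

end SemistableDegeneration

namespace SemistableDegeneration

open Set Filter

/-! ### Phases on the real-oriented blow-up -/

section Phases

variable {n : ℕ} {X : Type*} [TopologicalSpace X] [ChartedSpace (Fin n → ℂ) X]
  {π : X → 𝔻} {ι : X → X}

/-- The germ of `f` at `p` is holomorphic and has no zeros outside the special fibre. -/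
abbrev DivAt (n : ℕ) {X : Type*} [TopologicalSpace X] [ChartedSpace (Fin n → ℂ) X] (π : X → 𝔻)
    (f : X → ℂ) (p : X) : Prop :=
  (f : (𝓝 p).Germ ℂ) ∈ divisorMonoid n π p

theorem divAt_iff {f : X → ℂ} {p : X} :
    DivAt n π f p ↔ HolAt n f p ∧ ∀ᶠ x in 𝓝 p, (π x : ℂ) ≠ 0 → f x ≠ 0 := by
  constructor
  · rintro ⟨g, hfg, hg, hg'⟩
    have hfg' : f =ᶠ[𝓝 p] g := Germ.coe_eq.1 hfg
    refine ⟨hg.congr_of_eventuallyEq hfg', ?_⟩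
    filter_upwards [hfg', hg'] with x h1 h2
    rwa [h1]
  · rintro ⟨h1, h2⟩
    exact ⟨f, rfl, h1, h2⟩

theorem DivAt.congr {f g : X → ℂ} {p : X} (hf : DivAt n π f p) (h : f =ᶠ[𝓝 p] g) :
    DivAt n π g p := by
  rwa [DivAt, ← Germ.coe_eq.2 h]

theorem DivAt.mul {f g : X → ℂ} {p : X} (hf : DivAt n π f p) (hg : DivAt n π g p) :
    DivAt n π (fun x => f x * g x) p :=
  (divisorMonoid n π p).mul_mem hf hg

theorem divAt_one (p : X) : DivAt n π (fun _ => 1) p := (divisorMonoid n π p).one_mem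

theorem divAt_of_ne_zero {f : X → ℂ} {p : X} (hf : HolAt n f p) (h0 : f p ≠ 0) : DivAt n π f p :=
  divAt_iff.2 ⟨hf, (hf.continuousAt.eventually_ne h0).mono fun _ h _ => h⟩

theorem HolAt.eventually [IsManifold 𝓘(ℂ, Fin n → ℂ) ω X] {f : X → ℂ} {p : X} (hf : HolAt n f p) :
    ∀ᶠ x in 𝓝 p, HolAt n f x := by
  have hφ := IsManifold.chart_mem_maximalAtlas (I := 𝓘(ℂ, Fin n → ℂ)) (n := ω) p
  filter_upwards [((chartAt (Fin n → ℂ) p).continuousAt (mem_chart_source _ p)).eventually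
    hf.analyticAt_chartAt.eventually_analyticAt,
    (chartAt (Fin n → ℂ) p).open_source.mem_nhds (mem_chart_source _ p)] with x h1 h2
  exact (holAt_iff_analyticAt hφ h2).2 h1

theorem DivAt.eventually [IsManifold 𝓘(ℂ, Fin n → ℂ) ω X] {f : X → ℂ} {p : X}
    (hf : DivAt n π f p) : ∀ᶠ x in 𝓝 p, DivAt n π f x := by
  obtain ⟨h1, h2⟩ := divAt_iff.1 hf
  filter_upwards [h1.eventually, h2.eventually_nhds] with x h3 h4
  exact divAt_iff.2 ⟨h3, h4⟩

open Classical in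
/-- The phase of `f` at `x`, with value `1` if `f` is not a germ of the divisor monoid. -/
noncomputable def Blowup.ph (x : Blowup n π) (f : X → ℂ) : Circle :=
  if h : DivAt n π f x.pt then x.phase ⟨_, h⟩ else 1

namespace Blowup

theorem ph_eq (x : Blowup n π) {f : X → ℂ} (h : DivAt n π f x.pt) : x.ph f = x.phase ⟨_, h⟩ :=
  dif_pos h

theorem ph_congr (x : Blowup n π) {f g : X → ℂ} (h : f =ᶠ[𝓝 x.pt] g) : x.ph f = x.ph g := by
  by_cases hf : DivAt n π f x.pt
  · rw [ph_eq x hf, ph_eq x (hf.congr h)]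
    exact congrArg x.phase (Subtype.ext (Germ.coe_eq.2 h))
  · rw [ph, ph, dif_neg hf, dif_neg fun hg => hf (hg.congr h.symm)]

theorem ph_mul (x : Blowup n π) {f g : X → ℂ} (hf : DivAt n π f x.pt) (hg : DivAt n π g x.pt) :
    x.ph (fun x => f x * g x) = x.ph f * x.ph g := by
  rw [ph_eq x hf, ph_eq x hg, ph_eq x (hf.mul hg), ← map_mul]
  rfl

theorem ph_one (x : Blowup n π) : x.ph (fun _ => 1) = 1 := by
  rw [ph_eq x (divAt_one _)]
  exact map_one _

theorem ph_pow (x : Blowup n π) {f : X → ℂ} (hf : DivAt n π f x.pt) (m : ℕ) :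
    DivAt n π (fun y => f y ^ m) x.pt ∧ x.ph (fun y => f y ^ m) = x.ph f ^ m := by
  induction m with
  | zero => simpa using ⟨divAt_one _, ph_one x⟩
  | succ m ih =>
    simp only [pow_succ]
    exact ⟨ih.1.mul hf, by rw [ph_mul x ih.1 hf, ih.2]⟩

theorem ph_prod (x : Blowup n π) {κ : Type*} {f : κ → X → ℂ} (J : Finset κ)
    (hf : ∀ j ∈ J, DivAt n π (f j) x.pt) :
    DivAt n π (fun y => ∏ j ∈ J, f j y) x.pt ∧
      x.ph (fun y => ∏ j ∈ J, f j y) = ∏ j ∈ J, x.ph (f j) := by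
  classical
  induction J using Finset.induction_on with
  | empty => simpa using ⟨divAt_one _, ph_one x⟩
  | insert i J hi ih =>
    obtain ⟨h1, h2⟩ := ih fun j hj => hf j (Finset.mem_insert_of_mem hj)
    simp only [Finset.prod_insert hi]
    have h3 := hf i (Finset.mem_insert_self _ _)
    exact ⟨h3.mul h1, by rw [ph_mul x h3 h1, h2]⟩

theorem eq_norm_mul_ph (x : Blowup n π) {f : X → ℂ} (h : DivAt n π f x.pt) :
    f x.pt = (‖f x.pt‖ : ℂ) * (x.ph f : ℂ) := by
  rw [ph_eq x h]
  exact x.value_eq ⟨_, h⟩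

theorem ph_of_ne_zero (x : Blowup n π) {f : X → ℂ} (h : DivAt n π f x.pt) (h0 : f x.pt ≠ 0) :
    (x.ph f : ℂ) = f x.pt / ‖f x.pt‖ := by
  have h1 : (‖f x.pt‖ : ℂ) ≠ 0 := by
    rw [Complex.ofReal_ne_zero]
    exact norm_ne_zero_iff.2 h0
  rw [eq_div_iff h1, mul_comm]
  exact (eq_norm_mul_ph x h).symm

/-- Working with `ph` on functions instead of `phase` on germs avoids the dependence of the type of
the phases on the base point. -/
theorem ext_ph {x y : Blowup n π} (h : x.pt = y.pt)
    (h' : ∀ f, DivAt n π f x.pt → x.ph f = y.ph f) : x = y := by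
  obtain ⟨p, φ, hφ⟩ := x
  obtain ⟨q, ψ, hψ⟩ := y
  obtain rfl : p = q := h
  have : φ = ψ := by
    ext1 g
    obtain ⟨_, f, rfl, hf⟩ := g
    have hd : DivAt n π f p := divAt_iff.2 hf
    have h1 := h' f hd
    rw [ph_eq ⟨p, φ, hφ⟩ hd, ph_eq ⟨p, ψ, hψ⟩ hd] at h1
    exact h1
  subst this
  rfl

theorem continuous_pt : Continuous (Blowup.pt : Blowup n π → X) := by
  rw [continuous_def]
  intro U hU
  exact TopologicalSpace.isOpen_generateFrom_of_mem (Or.inl ⟨U, hU, rfl⟩)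

theorem isOpen_ph {U : Set X} {f : X → ℂ} (hU : IsOpen U) (hf : ∀ p ∈ U, DivAt n π f p)
    {V : Set Circle} (hV : IsOpen V) : IsOpen {x : Blowup n π | x.pt ∈ U ∧ x.ph f ∈ V} := by
  refine TopologicalSpace.isOpen_generateFrom_of_mem (Or.inr ⟨U, f, hf, V, hU, hV, ?_⟩)
  ext x
  constructor
  · rintro ⟨h1, h2⟩
    refine ⟨h1, ?_⟩
    rwa [ph_eq x (hf _ h1)] at h2
  · rintro ⟨h1, h2⟩
    refine ⟨h1, ?_⟩
    rwa [ph_eq x (hf _ h1)]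

/-- The subbasis uses `f` only over open sets where it is in the divisor monoid, so the conventional
value `1` of `ph` elsewhere plays no role. -/
theorem continuous_of_ph {Y : Type*} [TopologicalSpace Y] {g : Y → Blowup n π}
    (hpt : Continuous fun y => (g y).pt)
    (hph : ∀ y f, DivAt n π f (g y).pt → ContinuousAt (fun y' => (g y').ph f) y) :
    Continuous g := by
  rw [continuous_generateFrom_iff]
  rintro W (⟨U, hU, rfl⟩ | ⟨U, f, hf, V, hU, hV, rfl⟩)
  · exact hU.preimage hpt
  · rw [isOpen_iff_mem_nhds]
    rintro y ⟨hy, hy'⟩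
    rw [← ph_eq _ (hf _ hy)] at hy'
    filter_upwards [(hU.preimage hpt).mem_nhds hy, (hph y f (hf _ hy)).eventually
      (hV.mem_nhds hy')] with z h1 h2
    refine ⟨h1, ?_⟩
    rwa [← ph_eq _ (hf _ h1)]

/-- Points over the same base point differ in the phase of some `f`, which remains in the divisor
monoid over a neighbourhood. -/
theorem t2Space [IsManifold 𝓘(ℂ, Fin n → ℂ) ω X] [T2Space X] : T2Space (Blowup n π) := by
  refine ⟨fun x y hxy => ?_⟩
  by_cases h : x.pt = y.pt
  · have h1 : ∃ f, DivAt n π f x.pt ∧ x.ph f ≠ y.ph f := by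
      by_contra! h2
      exact hxy (ext_ph h h2)
    obtain ⟨f, hf, hne⟩ := h1
    have hf' : DivAt n π f y.pt := h ▸ hf
    obtain ⟨U, hU, hUo, hxU⟩ := eventually_nhds_iff.1 hf.eventually
    obtain ⟨V, W, hV, hW, hxV, hyW, hVW⟩ := t2_separation hne
    refine ⟨_, _, isOpen_ph hUo hU hV, isOpen_ph hUo hU hW, ⟨hxU, hxV⟩, ⟨h ▸ hxU, hyW⟩, ?_⟩
    exact Set.disjoint_left.2 fun z hz hz' => Set.disjoint_left.1 hVW hz.2 hz'.2
  · obtain ⟨U, V, hU, hV, hxU, hyV, hUV⟩ := t2_separation h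
    exact ⟨_, _, hU.preimage continuous_pt, hV.preimage continuous_pt, hxU, hyV,
      hUV.preimage _⟩

/-- The point of the blow-up whose phases are the limits of the phases along a path. -/
theorem exists_of_path (γ : ℝ → X) (q : X) (hγ : Tendsto γ (𝓝[>] 0) (𝓝 q))
    (h : ∀ f, DivAt n π f q → ∃ c : Circle,
      Tendsto (fun τ => f (γ τ) / ‖f (γ τ)‖) (𝓝[>] 0) (𝓝 (c : ℂ))) :
    ∃ x : Blowup n π, x.pt = q ∧ ∀ f, DivAt n π f q →
      Tendsto (fun τ => f (γ τ) / ‖f (γ τ)‖) (𝓝[>] 0) (𝓝 (x.ph f : ℂ)) := by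
  have key : ∀ φ : divisorMonoid n π q, ∃ c : Circle, ∀ f : X → ℂ, φ.1 = (f : (𝓝 q).Germ ℂ) →
      Tendsto (fun τ => f (γ τ) / ‖f (γ τ)‖) (𝓝[>] 0) (𝓝 (c : ℂ)) := by
    rintro ⟨_, f, rfl, hf⟩
    obtain ⟨c, hc⟩ := h f (divAt_iff.2 hf)
    refine ⟨c, fun g hg => hc.congr' ?_⟩
    have hfg : f =ᶠ[𝓝 q] g := Germ.coe_eq.1 hg
    filter_upwards [hγ.eventually hfg] with τ hτ
    rw [hτ]
  choose c hc using key
  have huniq : ∀ φ (f : X → ℂ), φ.1 = (f : (𝓝 q).Germ ℂ) → ∀ d : Circle,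
      Tendsto (fun τ => f (γ τ) / ‖f (γ τ)‖) (𝓝[>] 0) (𝓝 (d : ℂ)) → c φ = d :=
    fun φ f hf d hd => Circle.ext (tendsto_nhds_unique (hc φ f hf) hd)
  let x : Blowup n π :=
    { pt := q
      phase :=
        { toFun := c
          map_one' := by
            refine huniq 1 (fun _ => 1) rfl 1 ?_
            simp
          map_mul' := by
            rintro ⟨_, f, rfl, hf⟩ ⟨_, g, rfl, hg⟩
            refine huniq _ (f * g) rfl _ ?_
            refine ((hc _ f rfl).mul (hc _ g rfl)).congr fun τ => ?_
            simp only [Pi.mul_apply, norm_mul, Complex.ofReal_mul]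
            rw [div_mul_div_comm] }
      value_eq := by
        rintro ⟨_, f, rfl, hf⟩
        have h1 : Tendsto (fun τ => f (γ τ)) (𝓝[>] 0) (𝓝 (f q)) :=
          hf.1.continuousAt.tendsto.comp hγ
        have h2 := (Complex.continuous_ofReal.tendsto _).comp h1.norm
        refine tendsto_nhds_unique h1 ((h2.mul (hc ⟨_, f, rfl, hf⟩ f rfl)).congr fun τ => ?_)
        simp only [Function.comp]
        by_cases h0 : f (γ τ) = 0
        · simp [h0]
        · have : (‖f (γ τ)‖ : ℂ) ≠ 0 := by
            rw [Complex.ofReal_ne_zero]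
            exact norm_ne_zero_iff.2 h0
          field_simp }
  refine ⟨x, rfl, fun f hf => ?_⟩
  rw [ph_eq x hf]
  exact hc ⟨_, hf⟩ f rfl

end Blowup

theorem IsRealStructure.divAt_conj (hι : IsRealStructure n π ι) {f : X → ℂ} {p : X}
    (hf : DivAt n π f (ι p)) : DivAt n π (fun x => conj (f (ι x))) p :=
  (hι.pullback p ⟨_, hf⟩).2

theorem IsRealStructure.ph_blowupConj (hι : IsRealStructure n π ι) (x : Blowup n π) {f : X → ℂ}
    (hf : DivAt n π f (ι x.pt)) :
    (hι.blowupConj x).ph f = (x.ph fun y => conj (f (ι y)))⁻¹ := by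
  rw [Blowup.ph_eq _ (show DivAt n π f (hι.blowupConj x).pt from hf),
    Blowup.ph_eq _ (hι.divAt_conj hf)]
  rfl

theorem IsRealStructure.mem_realBlowup_iff (hι : IsRealStructure n π ι) {x : Blowup n π} :
    x ∈ hι.realBlowup ↔ ι x.pt = x.pt ∧
      ∀ f, DivAt n π f x.pt → (x.ph fun y => conj (f (ι y))) = (x.ph f)⁻¹ := by
  constructor
  · intro h
    have h1 : hι.blowupConj x = x := h
    have h2 : ι x.pt = x.pt := congrArg Blowup.pt h1
    refine ⟨h2, fun f hf => ?_⟩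
    have h3 := hι.ph_blowupConj x (f := f) (by rwa [h2])
    rw [h1] at h3
    rw [h3, inv_inv]
  · rintro ⟨h1, h2⟩
    refine Blowup.ext_ph h1 fun f hf => ?_
    have hf' : DivAt n π f (ι x.pt) := hf
    rw [hι.ph_blowupConj x hf', h2 f (by rwa [← h1]), inv_inv]

theorem IsSemistable.divAt (hπ : IsSemistable n π) (p : X) : DivAt n π (fun x => (π x : ℂ)) p :=
  hπ.germ_mem p

theorem IsSemistable.mem_positivePart_iff (hπ : IsSemistable n π) {x : Blowup n π} :
    x ∈ hπ.positivePart ↔ x.ph (fun y => (π y : ℂ)) = 1 := by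
  rw [Blowup.ph_eq x (hπ.divAt _)]
  simp [positivePart, blowupMap]

theorem IsSemistable.mem_positiveSpecialFibre_iff (hπ : IsSemistable n π) {x : Blowup n π} :
    x ∈ hπ.positiveSpecialFibre ↔ x ∈ hπ.positivePart ∧ (π x.pt : ℂ) = 0 := by
  simp [positivePart, positiveSpecialFibre, blowupMap, Subtype.ext_iff]

end Phases

end SemistableDegeneration

namespace SemistableDegeneration

open Set Filter

/-! ### The sheets of the real locus of the blow-up over a real chart -/

section Sheets

variable {n : ℕ} {X : Type*} [TopologicalSpace X] [ChartedSpace (Fin n → ℂ) X]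
  {π : X → 𝔻} {ι : X → X}

/-- The inclusion of `ℝ^n` into `ℂ^n`. -/
def cplx (a : Fin n → ℝ) : Fin n → ℂ := fun j => (a j : ℂ)

theorem continuous_cplx : Continuous (cplx : (Fin n → ℝ) → Fin n → ℂ) := by
  unfold cplx
  fun_prop

theorem cplx_injective : Function.Injective (cplx : (Fin n → ℝ) → Fin n → ℂ) := fun a b h => by
  ext j
  exact Complex.ofReal_injective (congrFun h j)

theorem norm_cplx_sub (a b : Fin n → ℝ) : ‖cplx a - cplx b‖ = ‖a - b‖ := by
  have : ∀ j, ‖(cplx a - cplx b) j‖ = ‖(a - b) j‖ := fun j => by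
    rw [Pi.sub_apply, Pi.sub_apply, cplx, cplx, ← Complex.ofReal_sub, Complex.norm_real]
  apply le_antisymm
  · refine (pi_norm_le_iff_of_nonneg (norm_nonneg _)).2 fun j => ?_
    rw [this]
    exact norm_le_pi_norm _ _
  · refine (pi_norm_le_iff_of_nonneg (norm_nonneg _)).2 fun j => ?_
    rw [← this]
    exact norm_le_pi_norm _ _

/-- Vectors with entries `±1` on `J`, with product `1`, and `0` elsewhere: they index the sheets,
and are the directions of the fibres along which points are moved. -/
structure IsSignVector (J : Finset (Fin n)) (v : Fin n → ℝ) : Prop where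
  sign : ∀ j ∈ J, v j = 1 ∨ v j = -1
  zero : ∀ j ∉ J, v j = 0
  prod : ∏ j ∈ J, v j = 1

theorem IsSignVector.mul_self {J : Finset (Fin n)} {v : Fin n → ℝ} (hv : IsSignVector J v)
    {j : Fin n} (hj : j ∈ J) : v j * v j = 1 := by
  rcases hv.sign j hj with h | h <;> rw [h] <;> norm_num

theorem IsSignVector.abs_le_one {J : Finset (Fin n)} {v : Fin n → ℝ} (hv : IsSignVector J v)
    (j : Fin n) : |v j| ≤ 1 := by
  by_cases hj : j ∈ J
  · rcases hv.sign j hj with h | h <;> rw [h] <;> norm_num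
  · rw [hv.zero j hj]
    norm_num

theorem finite_isSignVector (J : Finset (Fin n)) : {v : Fin n → ℝ | IsSignVector J v}.Finite := by
  refine (Set.Finite.pi' (t := fun _ : Fin n => ({1, -1, 0} : Set ℝ))
    fun _ => by simp).subset fun v hv j => ?_
  by_cases hj : j ∈ J
  · rcases hv.sign j hj with h | h <;> simp [h]
  · simp [hv.zero j hj]

/-- The closed orthant of `ℝ^n` with signs `v`. -/
def orthant (J : Finset (Fin n)) (v : Fin n → ℝ) : Set (Fin n → ℝ) :=
  {a | ∀ j ∈ J, 0 ≤ v j * a j}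

theorem IsSignVector.norm_eq {J : Finset (Fin n)} {v a : Fin n → ℝ} (hv : IsSignVector J v)
    (ha : a ∈ orthant J v) {j : Fin n} (hj : j ∈ J) : ‖cplx a j‖ = v j * a j := by
  have h1 := ha j hj
  rw [cplx, Complex.norm_real, Real.norm_eq_abs]
  rcases hv.sign j hj with h | h <;> rw [h] at h1 ⊢
  · rw [one_mul] at h1 ⊢
    exact abs_of_nonneg h1
  · rw [abs_of_nonpos (by linarith)]
    ring

theorem IsSignVector.add_smul_mem {J : Finset (Fin n)} {v a : Fin n → ℝ} (hv : IsSignVector J v)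
    (ha : a ∈ orthant J v) {τ : ℝ} (hτ : 0 ≤ τ) : a + τ • v ∈ orthant J v := by
  intro j hj
  have h1 := ha j hj
  have h2 := hv.mul_self hj
  simp only [Pi.add_apply, Pi.smul_apply, smul_eq_mul]
  nlinarith

theorem coe_circle_prod {κ : Type*} (s : Finset κ) (f : κ → Circle) :
    ((∏ j ∈ s, f j : Circle) : ℂ) = ∏ j ∈ s, (f j : ℂ) :=
  map_prod Circle.coeHom f s

theorem IsRealChart.conj_symm_cplx {e : OpenPartialHomeomorph X (Fin n → ℂ)}
    {J : Finset (Fin n)} (hR : IsRealChart π ι e J) {a : Fin n → ℝ} (ha : cplx a ∈ e.target) :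
    ι (e.symm (cplx a)) = e.symm (cplx a) := by
  have hq := e.map_target ha
  refine e.injOn (hR.map_mem _ hq) hq ?_
  ext j
  rw [hR.map_conj _ hq, e.right_inv ha]
  exact Complex.conj_ofReal _

variable [IsManifold 𝓘(ℂ, Fin n → ℂ) ω X] {e : OpenPartialHomeomorph X (Fin n → ℂ)}
  {J : Finset (Fin n)}

namespace IsRealChart

theorem divAt_coord (hR : IsRealChart π ι e J) {q : X} (hq : q ∈ e.source) {j : Fin n}
    (hj : j ∈ J) : DivAt n π (fun x => e x j) q := by
  refine divAt_iff.2 ⟨holAt_coord hR.mem_maximalAtlas hq j, ?_⟩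
  filter_upwards [e.open_source.mem_nhds hq] with x hx h1 h2
  rw [hR.eq_prod x hx] at h1
  exact h1 (Finset.prod_eq_zero hj h2)

theorem exists_factorization (hR : IsRealChart π ι e J) {q : X} (hq : q ∈ e.source) {f : X → ℂ}
    (hf : DivAt n π f q) : ∃ (J' : Finset (Fin n)) (u : X → ℂ) (m : Fin n → ℕ), J' ⊆ J ∧
      HolAt n u q ∧ u q ≠ 0 ∧ f =ᶠ[𝓝 q] fun x => u x * ∏ j ∈ J', e x j ^ m j := by
  classical
  obtain ⟨hf1, hf2⟩ := divAt_iff.1 hf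
  obtain ⟨u, m, hu, hu0, hum⟩ := exists_holAt_eq_unit_mul_monomial hR.mem_maximalAtlas hq hf1
    -- Only the coordinates vanishing at `q` enter the monomial; the others are units near `q`.
    (J := J.filter fun j => e q j = 0) (fun j hj => (Finset.mem_filter.1 hj).2) (by
      have h1 : ∀ᶠ x in 𝓝 q, ∀ j ∈ J, e q j ≠ 0 → e x j ≠ 0 := by
        refine (Finset.eventually_all J).2 fun j _ => ?_
        by_cases hj : e q j = 0
        · exact Eventually.of_forall fun x h => absurd hj h
        · exact ((holAt_coord hR.mem_maximalAtlas hq j).continuousAt.eventually_ne hj).mono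
            fun x h _ => h
      filter_upwards [h1, hf2, e.open_source.mem_nhds hq] with x h1 h2 h3 h4
      apply h2
      rw [hR.eq_prod x h3, Finset.prod_ne_zero_iff]
      intro j hj
      by_cases hj0 : e q j = 0
      · exact h4 j (Finset.mem_filter.2 ⟨hj, hj0⟩)
      · exact h1 j hj hj0)
  exact ⟨_, u, m, Finset.filter_subset _ _, hu, hu0, hum⟩

/-- One factorization at `q` computes the phases at all points of the blow-up over a neighbourhood
of `q`. This uniformity gives the continuity of the sheets. -/
theorem ph_factorization (hR : IsRealChart π ι e J) {q : X} (hq : q ∈ e.source)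
    {J' : Finset (Fin n)} (hJ' : J' ⊆ J) {f u : X → ℂ} {m : Fin n → ℕ} (hu : HolAt n u q)
    (hu0 : u q ≠ 0) (h : f =ᶠ[𝓝 q] fun x => u x * ∏ j ∈ J', e x j ^ m j) :
    ∀ᶠ p in 𝓝 q, ∀ x : Blowup n π, x.pt = p →
      (x.ph f : ℂ) = u p / ‖u p‖ * ∏ j ∈ J', (x.ph fun y => e y j : ℂ) ^ m j := by
  filter_upwards [h.eventually_nhds, hu.eventually, hu.continuousAt.eventually_ne hu0,
    e.open_source.mem_nhds hq] with p h1 h2 h3 h4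
  rintro x rfl
  have h5 : ∀ j ∈ J', DivAt n π (fun y => e y j) x.pt := fun j hj => hR.divAt_coord h4 (hJ' hj)
  have h6 := x.ph_prod J' fun j hj => (x.ph_pow (h5 j hj) (m j)).1
  have h7 : DivAt n π u x.pt := divAt_of_ne_zero h2 h3
  rw [x.ph_congr h1, x.ph_mul h7 h6.1, h6.2, Circle.coe_mul, x.ph_of_ne_zero h7 h3]
  congr 1
  rw [coe_circle_prod]
  refine Finset.prod_congr rfl fun j hj => ?_
  rw [(x.ph_pow (h5 j hj) (m j)).2, Circle.coe_pow]

theorem ext_blowup (hR : IsRealChart π ι e J) {x y : Blowup n π} (hx : x.pt ∈ e.source)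
    (h : x.pt = y.pt) (hxy : ∀ j ∈ J, (x.ph fun z => e z j) = y.ph fun z => e z j) : x = y := by
  refine Blowup.ext_ph h fun f hf => ?_
  obtain ⟨J', u, m, hJ', hu, hu0, hum⟩ := hR.exists_factorization hx hf
  have h1 := (hR.ph_factorization hx hJ' hu hu0 hum).self_of_nhds
  refine Circle.ext ?_
  rw [h1 x rfl, h1 y h.symm]
  congr 1
  exact Finset.prod_congr rfl fun j hj => by rw [hxy j (hJ' hj)]

theorem ph_eq_prod (hR : IsRealChart π ι e J) {x : Blowup n π} (hx : x.pt ∈ e.source) :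
    x.ph (fun y => (π y : ℂ)) = ∏ j ∈ J, x.ph fun y => e y j := by
  rw [← (x.ph_prod J fun j hj => hR.divAt_coord hx hj).2]
  refine x.ph_congr ?_
  filter_upwards [e.open_source.mem_nhds hx] with y hy using hR.eq_prod y hy

/-- The point is the limit of the path `a + τ v`, which for `τ > 0` lies in the interior of the
orthant, where the phases of the coordinates are exactly `v`. Reality is inherited from the path,
and positivity from the product of the signs. -/
theorem exists_blowup (hR : IsRealChart π ι e J) (hπ : IsSemistable n π)
    (hι : IsRealStructure n π ι) {v a : Fin n → ℝ} (hv : IsSignVector J v)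
    (ha : a ∈ orthant J v) (hat : cplx a ∈ e.target) :
    ∃ x : Blowup n π, x ∈ hι.realBlowup ∩ hπ.positivePart ∧ x.pt = e.symm (cplx a) ∧
      ∀ j ∈ J, (x.ph fun y => e y j : ℂ) = v j := by
  set q := e.symm (cplx a) with hq_def
  have hq : q ∈ e.source := e.map_target hat
  let γ : ℝ → X := fun τ => e.symm (cplx (a + τ • v))
  have hγ1 : Tendsto (fun τ : ℝ => cplx (a + τ • v)) (𝓝[>] 0) (𝓝 (cplx a)) := by
    have h1 : Continuous fun τ : ℝ => cplx (a + τ • v) := continuous_cplx.comp (by fun_prop)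
    have h2 := (h1.tendsto 0).mono_left (nhdsWithin_le_nhds (s := Ioi 0))
    simpa using h2
  have hγ : Tendsto γ (𝓝[>] 0) (𝓝 q) := (e.continuousAt_symm hat).tendsto.comp hγ1
  have hγt : ∀ᶠ τ in 𝓝[>] (0 : ℝ), cplx (a + τ • v) ∈ e.target :=
    hγ1.eventually (e.open_target.mem_nhds hat)
  have hcoord : ∀ j ∈ J, Tendsto (fun τ => e (γ τ) j / ‖e (γ τ) j‖) (𝓝[>] 0) (𝓝 (v j : ℂ)) := by
    intro j hj
    refine tendsto_const_nhds.congr' ?_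
    filter_upwards [hγt, self_mem_nhdsWithin] with τ h1 h2
    have h2' : 0 < τ := h2
    rw [e.right_inv h1, hv.norm_eq (hv.add_smul_mem ha h2'.le) hj]
    have h3 := ha j hj
    have h4 := hv.mul_self hj
    have h5 : v j * (a + τ • v) j = v j * a j + τ := by
      simp only [Pi.add_apply, Pi.smul_apply, smul_eq_mul]
      linear_combination τ * h4
    have h6 : v j * (a + τ • v) j ≠ 0 := by
      rw [h5]
      positivity
    rw [eq_div_iff (Complex.ofReal_ne_zero.2 h6), cplx, ← Complex.ofReal_mul, ← mul_assoc, h4,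
      one_mul]
  have hlim : ∀ f, DivAt n π f q → ∃ c : Circle,
      Tendsto (fun τ => f (γ τ) / ‖f (γ τ)‖) (𝓝[>] 0) (𝓝 (c : ℂ)) := by
    intro f hf
    obtain ⟨J', u, m, hJ', hu, hu0, hum⟩ := hR.exists_factorization hq hf
    have hu0' : (‖u q‖ : ℂ) ≠ 0 := Complex.ofReal_ne_zero.2 (norm_ne_zero_iff.2 hu0)
    let z : ℂ := u q / ‖u q‖ * ∏ j ∈ J', (v j : ℂ) ^ m j
    have hz : ‖z‖ = 1 := by
      simp only [z, norm_mul, norm_div, norm_prod, norm_pow, Complex.norm_real, norm_norm]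
      rw [div_self (norm_ne_zero_iff.2 hu0), one_mul]
      refine Finset.prod_eq_one fun j hj => ?_
      rcases hv.sign j (hJ' hj) with h | h <;> rw [h] <;> simp
    refine ⟨⟨z, mem_sphere_zero_iff_norm.2 hz⟩, ?_⟩
    change Tendsto _ _ (𝓝 z)
    have h1 : Tendsto (fun τ => u (γ τ)) (𝓝[>] 0) (𝓝 (u q)) := hu.continuousAt.tendsto.comp hγ
    have h2 := h1.div ((Complex.continuous_ofReal.tendsto _).comp h1.norm) hu0'
    have h3 : Tendsto (fun τ => ∏ j ∈ J', (e (γ τ) j / ‖e (γ τ) j‖) ^ m j) (𝓝[>] 0)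
        (𝓝 (∏ j ∈ J', (v j : ℂ) ^ m j)) :=
      tendsto_finsetProd _ fun j hj => (hcoord j (hJ' hj)).pow _
    refine (h2.mul h3).congr' ?_
    filter_upwards [hγ.eventually hum] with τ hτ
    rw [hτ]
    simp only [Function.comp, norm_mul, norm_prod, norm_pow, Complex.ofReal_mul,
      Complex.ofReal_prod, Complex.ofReal_pow, div_pow, Finset.prod_div_distrib, Pi.div_apply]
    rw [div_mul_div_comm]
  obtain ⟨x, hxq, hx⟩ := Blowup.exists_of_path γ q hγ hlim
  have hxv : ∀ j ∈ J, (x.ph fun y => e y j : ℂ) = v j := fun j hj =>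
    tendsto_nhds_unique (hx _ (hR.divAt_coord hq hj)) (hcoord j hj)
  have hιq : ι q = q := hR.conj_symm_cplx hat
  refine ⟨x, ⟨?_, ?_⟩, hxq, hxv⟩
  · refine hι.mem_realBlowup_iff.2 ⟨by rw [hxq, hιq], fun f hf => ?_⟩
    rw [hxq] at hf
    have hfc := hι.divAt_conj (f := f) (p := q) (by rwa [hιq])
    refine Circle.ext ?_
    rw [Circle.coe_inv_eq_conj]
    refine tendsto_nhds_unique (hx _ hfc) ?_
    refine ((Complex.continuous_conj.tendsto _).comp (hx f hf)).congr' ?_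
    filter_upwards [hγt] with τ hτ
    have h1 : ι (γ τ) = γ τ := hR.conj_symm_cplx hτ
    simp [h1]
  · rw [hπ.mem_positivePart_iff, hR.ph_eq_prod (by rwa [hxq])]
    refine Circle.ext ?_
    rw [coe_circle_prod, Circle.coe_one]
    rw [Finset.prod_congr rfl hxv, ← Complex.ofReal_prod, hv.prod, Complex.ofReal_one]

theorem exists_sheet (hR : IsRealChart π ι e J) (hπ : IsSemistable n π)
    (hι : IsRealStructure n π ι) {v : Fin n → ℝ} (hv : IsSignVector J v) :
    ∃ σ : {a : Fin n → ℝ // a ∈ orthant J v ∧ cplx a ∈ e.target} →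
        ↥(hι.realBlowup ∩ hπ.positivePart), Continuous σ ∧
      ∀ a, (σ a).1.pt = e.symm (cplx a) ∧ ∀ j ∈ J, ((σ a).1.ph fun y => e y j : ℂ) = v j := by
  have key : ∀ a : {a : Fin n → ℝ // a ∈ orthant J v ∧ cplx a ∈ e.target},
      ∃ x : ↥(hι.realBlowup ∩ hπ.positivePart), x.1.pt = e.symm (cplx a) ∧
        ∀ j ∈ J, (x.1.ph fun y => e y j : ℂ) = v j := by
    rintro ⟨a, ha, hat⟩
    obtain ⟨x, hx, hx'⟩ := hR.exists_blowup hπ hι hv ha hat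
    exact ⟨⟨x, hx⟩, hx'⟩
  choose σ hσ using key
  refine ⟨σ, ?_, hσ⟩
  have hpt : Continuous fun a => (σ a).1.pt := by
    simp only [(hσ _).1]
    exact e.continuousOn_symm.comp_continuous (continuous_cplx.comp continuous_subtype_val)
      fun a => a.2.2
  refine Continuous.subtype_mk (Blowup.continuous_of_ph (g := fun a => (σ a).1) hpt
    fun a f hf => ?_) fun a => (σ a).2
  have hq : (σ a).1.pt ∈ e.source := by
    rw [(hσ a).1]
    exact e.map_target a.2.2
  obtain ⟨J', u, m, hJ', hu, hu0, hum⟩ := hR.exists_factorization hq hf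
  have h1 : ∀ᶠ b in 𝓝 a, ((σ b).1.ph f : ℂ) =
      u (σ b).1.pt / ‖u (σ b).1.pt‖ * ∏ j ∈ J', (v j : ℂ) ^ m j := by
    filter_upwards [(hpt.tendsto a).eventually (hR.ph_factorization hq hJ' hu hu0 hum)] with b hb
    rw [hb _ rfl]
    congr 1
    exact Finset.prod_congr rfl fun j hj => by rw [(hσ b).2 j (hJ' hj)]
  have h2 : ContinuousAt (fun b => u (σ b).1.pt) a :=
    ContinuousAt.comp (f := fun b => (σ b).1.pt) (g := u) hu.continuousAt hpt.continuousAt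
  have h3 : ContinuousAt (fun b => u (σ b).1.pt / ‖u (σ b).1.pt‖ * ∏ j ∈ J', (v j : ℂ) ^ m j) a := by
    refine (h2.div ?_ (Complex.ofReal_ne_zero.2 (norm_ne_zero_iff.2 hu0))).mul continuousAt_const
    exact Complex.continuous_ofReal.continuousAt.comp h2.norm
  exact (⟨rfl⟩ : Topology.IsInducing ((↑) : Circle → ℂ)).continuousAt_iff.2
    (h3.congr (h1.mono fun _ h => h.symm))

theorem exists_sign_of_mem (hR : IsRealChart π ι e J) (hπ : IsSemistable n π)
    (hι : IsRealStructure n π ι) {x : Blowup n π} (hx : x ∈ hι.realBlowup ∩ hπ.positivePart)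
    (hxe : x.pt ∈ e.source) :
    ∃ v a : Fin n → ℝ, IsSignVector J v ∧ a ∈ orthant J v ∧ e x.pt = cplx a ∧
      ∀ j ∈ J, (x.ph fun y => e y j : ℂ) = v j := by
  classical
  obtain ⟨h1, h2⟩ := hι.mem_realBlowup_iff.1 hx.1
  have hreal : ∀ j, ((e x.pt j).re : ℂ) = e x.pt j := by
    intro j
    have h3 := hR.map_conj _ hxe j
    rw [h1] at h3
    exact Complex.conj_eq_iff_re.1 h3.symm
  have hsign : ∀ j ∈ J, ((x.ph fun y => e y j : Circle) : ℂ) = 1 ∨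
      ((x.ph fun y => e y j : Circle) : ℂ) = -1 := by
    intro j hj
    have h3 := h2 _ (hR.divAt_coord hxe hj)
    -- The coordinate is its own conjugate under `ι`, so at a real point its phase equals its
    -- inverse.
    have h4 : (fun y => conj (e (ι y) j)) =ᶠ[𝓝 x.pt] fun y => e y j := by
      filter_upwards [e.open_source.mem_nhds hxe] with y hy
      rw [hR.map_conj y hy, Complex.conj_conj]
    rw [x.ph_congr h4, eq_inv_iff_mul_eq_one] at h3
    have h5 := congrArg (fun z : Circle => (z : ℂ)) h3
    simp only [Circle.coe_mul, Circle.coe_one] at h5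
    exact mul_self_eq_one_iff.1 h5
  let v : Fin n → ℝ := fun j => if j ∈ J then ((x.ph fun y => e y j : Circle) : ℂ).re else 0
  have hv : ∀ j ∈ J, ((x.ph fun y => e y j : Circle) : ℂ) = v j := by
    intro j hj
    simp only [v, if_pos hj]
    rcases hsign j hj with h | h <;> rw [h] <;> simp
  refine ⟨v, fun j => (e x.pt j).re, ⟨?_, ?_, ?_⟩, ?_, ?_, hv⟩
  · intro j hj
    simp only [v, if_pos hj]
    rcases hsign j hj with h | h <;> rw [h] <;> simp
  · intro j hj
    exact if_neg hj
  · have h3 := hπ.mem_positivePart_iff.1 hx.2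
    rw [hR.ph_eq_prod hxe] at h3
    have h4 := congrArg (fun z : Circle => (z : ℂ)) h3
    rw [coe_circle_prod, Circle.coe_one] at h4
    rw [Finset.prod_congr rfl hv, ← Complex.ofReal_prod] at h4
    exact_mod_cast h4
  · intro j hj
    have h3 : e x.pt j = _ := x.eq_norm_mul_ph (hR.divAt_coord hxe hj)
    rw [hv j hj, ← hreal j, ← Complex.ofReal_mul] at h3
    have h4 : (e x.pt j).re = ‖((e x.pt j).re : ℂ)‖ * v j := by exact_mod_cast h3
    have h5 : v j * v j = 1 := by
      have := hv j hj
      rcases hsign j hj with h | h <;> rw [h] at this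
      · have : v j = 1 := by exact_mod_cast this.symm
        rw [this, one_mul]
      · have : v j = -1 := by exact_mod_cast this.symm
        rw [this]
        norm_num
    change 0 ≤ v j * (e x.pt j).re
    rw [h4, mul_comm, mul_assoc, h5, mul_one]
    positivity
  · ext j
    exact (hreal j).symm

end IsRealChart

end Sheets

end SemistableDegeneration

namespace SemistableDegeneration

open Set Filter

/-! ### Superadditivity of the geometric mean -/

theorem geom_mean_le_sum {n : ℕ} (hn : 0 < n) {z : Fin n → ℝ} (hz : ∀ i, 0 ≤ z i) :
    (∏ i, z i) ^ (n : ℝ)⁻¹ ≤ ∑ i, (n : ℝ)⁻¹ * z i := by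
  rw [← Real.finsetProd_rpow _ _ fun i _ => hz i]
  refine Real.geom_mean_le_arith_mean_weighted _ _ _ (fun _ _ => by positivity) ?_ fun i _ => hz i
  have : (n : ℝ) ≠ 0 := by positivity
  simp [this]

/-- The arithmetic-geometric mean inequality is applied to `r i / (r i + τ)` and to `τ / (r i + τ)`,
whose arithmetic means add up to `1`. -/
theorem geom_mean_add_le {n : ℕ} (hn : 0 < n) {r : Fin n → ℝ} (hr : ∀ i, 0 ≤ r i) {τ : ℝ}
    (hτ : 0 ≤ τ) : (∏ i, r i) ^ (n : ℝ)⁻¹ + τ ≤ (∏ i, (r i + τ)) ^ (n : ℝ)⁻¹ := by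
  rcases hτ.eq_or_lt with rfl | hτ
  · simp
  have hn' : (n : ℝ) ≠ 0 := by positivity
  have h0 : ∀ i, 0 < r i + τ := fun i => by linarith [hr i]
  have hD : 0 < ∏ i, (r i + τ) := Finset.prod_pos fun i _ => h0 i
  have h1 := geom_mean_le_sum hn (z := fun i => r i / (r i + τ))
    fun i => div_nonneg (hr i) (h0 i).le
  have h2 := geom_mean_le_sum hn (z := fun i => τ / (r i + τ)) fun i => div_nonneg hτ.le (h0 i).le
  rw [Finset.prod_div_distrib, Real.div_rpow (Finset.prod_nonneg fun i _ => hr i) hD.le] at h1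
  rw [Finset.prod_div_distrib, Real.div_rpow (Finset.prod_nonneg fun i _ => hτ.le) hD.le,
    Finset.prod_const, Finset.card_univ, Fintype.card_fin, Real.pow_rpow_inv_natCast hτ.le hn.ne']
    at h2
  have h3 : ∑ i, (n : ℝ)⁻¹ * (r i / (r i + τ)) + ∑ i, (n : ℝ)⁻¹ * (τ / (r i + τ)) = 1 := by
    rw [← Finset.sum_add_distrib]
    have : ∀ i, (n : ℝ)⁻¹ * (r i / (r i + τ)) + (n : ℝ)⁻¹ * (τ / (r i + τ)) = (n : ℝ)⁻¹ :=
      fun i => by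
        have := (h0 i).ne'
        field_simp
    simp [this, hn']
  have h4 := add_le_add h1 h2
  rwa [h3, ← add_div, div_le_one (Real.rpow_pos_of_pos hD _)] at h4

/-- Translating some of the factors by `τ` increases the geometric mean at least linearly, as long
as the product remains below `m < 1`. -/
theorem rpow_prod_add_le {n : ℕ} (hn : 0 < n) (J : Finset (Fin n)) {r : Fin n → ℝ}
    (hr : ∀ i ∈ J, 0 ≤ r i) {τ m : ℝ} (hτ : 0 ≤ τ) (hm : ∏ i ∈ J, (r i + τ) ≤ m) :
    (∏ i ∈ J, r i) ^ (n : ℝ)⁻¹ + (1 - m ^ (n : ℝ)⁻¹) * τ ≤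
      (∏ i ∈ J, (r i + τ)) ^ (n : ℝ)⁻¹ := by
  classical
  -- Padding by ones gives `n` factors. The padded ones contribute at most `1 + τ` to the geometric
  -- mean, and this costs the correction `m ^ (1/n) * τ`.
  let r' : Fin n → ℝ := fun i => if i ∈ J then r i else 1
  have hr' : ∀ i, 0 ≤ r' i := fun i => by
    by_cases hi : i ∈ J
    · simp only [r', if_pos hi, hr i hi]
    · simp only [r', if_neg hi, zero_le_one]
  have h1 := geom_mean_add_le hn hr' hτ
  have hP : 0 ≤ ∏ i ∈ J, (r i + τ) := Finset.prod_nonneg fun i hi => add_nonneg (hr i hi) hτ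
  have h2 : ∏ i, r' i = ∏ i ∈ J, r i := by simp [r', Finset.prod_ite_mem]
  have h3 : ∏ i, (r' i + τ) ≤ (∏ i ∈ J, (r i + τ)) * (1 + τ) ^ n := by
    have h4 : ∏ i, (r' i + τ) = (∏ i ∈ J, (r i + τ)) * ∏ i ∈ Jᶜ, (1 + τ) := by
      rw [← Finset.prod_mul_prod_compl J]
      congr 1
      · exact Finset.prod_congr rfl fun i hi => by simp only [r', if_pos hi]
      · exact Finset.prod_congr rfl fun i hi => by
          simp only [r', if_neg (Finset.mem_compl.1 hi)]
    rw [h4, Finset.prod_const]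
    gcongr
    · linarith
    · exact (Finset.card_le_univ _).trans (by simp)
  have h5 : (∏ i, (r' i + τ)) ^ (n : ℝ)⁻¹ ≤ (∏ i ∈ J, (r i + τ)) ^ (n : ℝ)⁻¹ * (1 + τ) := by
    refine (Real.rpow_le_rpow (Finset.prod_nonneg fun i _ => add_nonneg (hr' i) hτ) h3
      (by positivity)).trans_eq ?_
    rw [Real.mul_rpow hP (by positivity), Real.pow_rpow_inv_natCast (by positivity) hn.ne']
  have h6 : (∏ i ∈ J, (r i + τ)) ^ (n : ℝ)⁻¹ ≤ m ^ (n : ℝ)⁻¹ :=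
    Real.rpow_le_rpow hP hm (by positivity)
  rw [h2] at h1
  nlinarith

/-! ### Functions of class `C¹` -/

section Test

variable {n : ℕ} {X : Type*} [TopologicalSpace X] [ChartedSpace (Fin n → ℂ) X]

variable (n) in
/-- Real functions on `X` of class `C¹`. -/
def IsC1 (χ : X → ℝ) : Prop :=
  ∀ e ∈ IsManifold.maximalAtlas 𝓘(ℂ, Fin n → ℂ) ω X, ∀ x ∈ e.source,
    ContDiffAt ℝ 1 (χ ∘ e.symm) (e x)

theorem IsC1.exists_lipschitz {χ : X → ℝ} (h : IsC1 n χ) {e : OpenPartialHomeomorph X (Fin n → ℂ)}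
    (he : e ∈ IsManifold.maximalAtlas 𝓘(ℂ, Fin n → ℂ) ω X) {z : Fin n → ℂ} {R : ℝ}
    (hR : Metric.closedBall z R ⊆ e.target) :
    ∃ K : NNReal, LipschitzOnWith K (χ ∘ e.symm) (Metric.closedBall z R) := by
  refine ContDiffOn.exists_lipschitzOnWith (n := 1) (fun w hw => ?_) one_ne_zero
    (convex_closedBall _ _) (isCompact_closedBall _ _)
  have h1 := h e he _ (e.map_target (hR hw))
  rw [e.right_inv (hR hw)] at h1
  exact h1.contDiffWithinAt

variable [IsManifold 𝓘(ℂ, Fin n → ℂ) ω X]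

theorem IsC1.continuous {χ : X → ℝ} (h : IsC1 n χ) : Continuous χ := by
  refine continuous_iff_continuousAt.2 fun x => ?_
  have h1 := (h _ (IsManifold.chart_mem_maximalAtlas x) x (mem_chart_source _ x)).continuousAt
  refine (h1.comp ((chartAt (Fin n → ℂ) x).continuousAt (mem_chart_source _ x))).congr ?_
  filter_upwards [(chartAt (Fin n → ℂ) x).open_source.mem_nhds (mem_chart_source _ x)] with y hy
  simp [(chartAt (Fin n → ℂ) x).left_inv hy]

theorem exists_isC1_bump [T2Space X] {U : Set X} (hU : IsOpen U) {p : X} (hp : p ∈ U) :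
    ∃ χ : X → ℝ, IsC1 n χ ∧ (∀ x, 0 ≤ χ x) ∧ (∀ᶠ x in 𝓝 p, χ x = 1) ∧ ∀ x, χ x ≠ 0 → x ∈ U := by
  classical
  set e := chartAt (Fin n → ℂ) p
  have hpe : p ∈ e.source := mem_chart_source _ p
  have he : e ∈ IsManifold.maximalAtlas 𝓘(ℂ, Fin n → ℂ) ω X := IsManifold.chart_mem_maximalAtlas p
  have h1 : e.target ∩ e.symm ⁻¹' U ∈ 𝓝 (e p) :=
    (e.isOpen_inter_preimage_symm hU).mem_nhds
      ⟨e.map_source hpe, by rwa [mem_preimage, e.left_inv hpe]⟩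
  obtain ⟨r, hr, hrU⟩ := Metric.nhds_basis_closedBall.mem_iff.1 h1
  let f : ContDiffBump (e p) := ⟨r / 2, r, by positivity, by linarith⟩
  let K : Set X := e.symm '' Metric.closedBall (e p) r
  -- As `X` is Hausdorff, the compact support is closed in `X`, so the extension by zero is `C¹`
  -- outside the chart too.
  have hK : IsClosed K := ((isCompact_closedBall _ _).image_of_continuousOn
    (e.continuousOn_symm.mono fun z hz => (hrU hz).1)).isClosed
  let χ : X → ℝ := fun x => if x ∈ e.source then f (e x) else 0
  have hχ : ∀ x ∈ e.source, χ x = f (e x) := fun x hx => if_pos hx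
  have hχK : ∀ x, x ∉ K → χ x = 0 := by
    intro x hx
    by_cases hxe : x ∈ e.source
    · rw [hχ x hxe]
      refine f.zero_of_le_dist (le_of_not_gt fun h => hx ⟨e x, ?_, e.left_inv hxe⟩)
      exact h.le
    · exact if_neg hxe
  refine ⟨χ, ?_, ?_, ?_, ?_⟩
  · intro e' he' x hx
    have htend : ContinuousAt e'.symm (e' x) := e'.continuousAt_symm (e'.map_source hx)
    by_cases hxe : x ∈ e.source
    · have h2 : ContDiffAt ℝ 1 (e ∘ e'.symm) (e' x) := by
        rw [contDiffAt_pi]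
        intro j
        have h3 := (holAt_iff_analyticAt he' hx).1 (holAt_coord he hxe j)
        exact (contDiffAt_omega_iff.2 h3).restrict_scalars ℝ |>.of_le (by simp)
      refine ((f.contDiff.contDiffAt (x := (e ∘ e'.symm) (e' x))).comp (e' x) h2).congr_of_eventuallyEq ?_
      have h3 : e'.symm (e' x) ∈ e.source := by rwa [e'.left_inv hx]
      filter_upwards [htend.eventually (e.open_source.mem_nhds h3)] with z hz
      exact hχ _ hz
    · have hxK : x ∉ K := by
        rintro ⟨z, hz, rfl⟩
        exact hxe (e.map_target (hrU hz).1)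
      refine (contDiffAt_const (c := (0 : ℝ))).congr_of_eventuallyEq ?_
      have h3 : e'.symm (e' x) ∈ Kᶜ := by rwa [e'.left_inv hx]
      filter_upwards [htend.eventually (hK.isOpen_compl.mem_nhds h3)] with z hz
      exact hχK _ hz
  · intro x
    by_cases hxe : x ∈ e.source
    · rw [hχ x hxe]
      exact f.nonneg
    · exact (if_neg hxe).ge
  · filter_upwards [e.open_source.mem_nhds hpe,
      (e.continuousAt hpe).eventually f.eventuallyEq_one] with x hx h2
    rw [hχ x hx, h2]
    rfl
  · intro x hx
    by_contra hxU
    refine hx (hχK x ?_)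
    rintro ⟨z, hz, rfl⟩
    exact hxU (hrU hz).2

end Test

end SemistableDegeneration

namespace SemistableDegeneration

open Set Filter

/-! ### Sliding in a real chart -/

section Box

variable {n : ℕ} {X : Type*} [TopologicalSpace X] [ChartedSpace (Fin n → ℂ) X]
  {π : X → 𝔻} {ι : X → X}

variable (n π) in
/-- The height `|π|^(1/n)` on the blow-up. -/
noncomputable def height (x : Blowup n π) : ℝ := ‖(π x.pt : ℂ)‖ ^ (n : ℝ)⁻¹

/-- `x` is the point of the sheet with signs `v` whose coordinates are `a`. -/
structure OnSheet (e : OpenPartialHomeomorph X (Fin n → ℂ)) (J : Finset (Fin n)) (v a : Fin n → ℝ)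
    (x : Blowup n π) : Prop where
  sign : IsSignVector J v
  orthant : a ∈ orthant J v
  target : cplx a ∈ e.target
  pt_eq : x.pt = e.symm (cplx a)
  ph_eq : ∀ j ∈ J, (x.ph fun y => e y j : ℂ) = v j

variable {e : OpenPartialHomeomorph X (Fin n → ℂ)}
  {J : Finset (Fin n)} {v v' a a' : Fin n → ℝ} {x y : Blowup n π}

namespace OnSheet

theorem source (h : OnSheet e J v a x) : x.pt ∈ e.source := by
  rw [h.pt_eq]
  exact e.map_target h.target

theorem chart_eq (h : OnSheet e J v a x) : e x.pt = cplx a := by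
  rw [h.pt_eq, e.right_inv h.target]

theorem coord_unique (h : OnSheet e J v a x) (h' : OnSheet e J v' a' x) : a = a' :=
  cplx_injective (by rw [← h.chart_eq, ← h'.chart_eq])

theorem sign_unique (h : OnSheet e J v a x) (h' : OnSheet e J v' a' x) : v = v' := by
  ext j
  by_cases hj : j ∈ J
  · exact_mod_cast (h.ph_eq j hj).symm.trans (h'.ph_eq j hj)
  · rw [h.sign.zero j hj, h'.sign.zero j hj]

theorem norm_eq (h : OnSheet e J v a x) (hR : IsRealChart π ι e J) :
    ‖(π x.pt : ℂ)‖ = ∏ j ∈ J, v j * a j := by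
  rw [hR.eq_prod _ h.source, norm_prod, h.chart_eq]
  exact Finset.prod_congr rfl fun j hj => h.sign.norm_eq h.orthant hj

theorem height_add_le (h : OnSheet e J v a x) (hR : IsRealChart π ι e J) {τ : ℝ} (hτ : 0 ≤ τ)
    (h' : OnSheet e J v (a + τ • v) y) {m : ℝ} (hm : ‖(π y.pt : ℂ)‖ ≤ m) :
    height n π x + (1 - m ^ (n : ℝ)⁻¹) * τ ≤ height n π y := by
  have hn : 0 < n := by
    obtain ⟨j, -⟩ := hR.nonempty
    exact j.pos
  have h1 : ∏ j ∈ J, v j * (a + τ • v) j = ∏ j ∈ J, (v j * a j + τ) :=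
    Finset.prod_congr rfl fun j hj => by
      have := h.sign.mul_self hj
      simp only [Pi.add_apply, Pi.smul_apply, smul_eq_mul]
      linear_combination τ * this
  have h2 := rpow_prod_add_le hn J (r := fun j => v j * a j) h.orthant hτ (m := m) (by
    rw [← h1, ← h'.norm_eq hR]
    exact hm)
  rwa [← h1, ← h.norm_eq hR, ← h'.norm_eq hR] at h2

/-- For negative `τ` the roles of the two ends are exchanged in `height_add_le`. -/
theorem mul_abs_le (h : OnSheet e J v a x) (hR : IsRealChart π ι e J) {τ : ℝ}
    (h' : OnSheet e J v (a + τ • v) y) {m : ℝ} (hmx : ‖(π x.pt : ℂ)‖ ≤ m)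
    (hmy : ‖(π y.pt : ℂ)‖ ≤ m) :
    (1 - m ^ (n : ℝ)⁻¹) * |τ| ≤ |height n π x - height n π y| := by
  rcases le_total 0 τ with hτ | hτ
  · have h1 := h.height_add_le hR hτ h' hmy
    rw [abs_of_nonneg hτ, abs_sub_comm]
    exact (by linarith : _ ≤ height n π y - height n π x).trans (le_abs_self _)
  · have h2 : a = (a + τ • v) + (-τ) • v := by
      ext j
      simp
    rw [h2] at h
    have h1 := h'.height_add_le hR (neg_nonneg.2 hτ) h hmx
    rw [abs_of_nonpos hτ]
    exact (by linarith : _ ≤ height n π x - height n π y).trans (le_abs_self _)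

variable [IsManifold 𝓘(ℂ, Fin n → ℂ) ω X]

theorem eq_of_eq (h : OnSheet e J v a x) (hR : IsRealChart π ι e J) (h' : OnSheet e J v a y) :
    x = y :=
  hR.ext_blowup h.source (h.pt_eq.trans h'.pt_eq.symm) fun j hj =>
    Circle.ext ((h.ph_eq j hj).trans (h'.ph_eq j hj).symm)

end OnSheet

theorem cplx_mem_target {Y : Type*} [TopologicalSpace Y]
    {e : OpenPartialHomeomorph Y (Fin n → ℂ)} {z : Fin n → ℝ} {R : ℝ}
    (hz : Metric.closedBall (cplx z) R ⊆ e.target) (ha : a ∈ Metric.closedBall z R) :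
    cplx a ∈ e.target := by
  apply hz
  rwa [mem_closedBall_iff_norm, norm_cplx_sub, ← mem_closedBall_iff_norm]

theorem isClosed_orthant (J : Finset (Fin n)) (v : Fin n → ℝ) : IsClosed (orthant J v) := by
  have : orthant J v = ⋂ j ∈ J, {a | 0 ≤ v j * a j} := by
    ext a
    simp [orthant]
  rw [this]
  exact isClosed_biInter fun j _ => isClosed_le continuous_const (by fun_prop)

/-- Two points are related if they are equal or lie on the same sheet, over the ball of
radius `R` about `z`, and their difference is a multiple of the vector of signs. -/
def chartRel (e : OpenPartialHomeomorph X (Fin n → ℂ)) (J : Finset (Fin n)) (z : Fin n → ℝ) (R : ℝ)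
    (x y : Blowup n π) : Prop :=
  x = y ∨ ∃ v a a', a ∈ Metric.closedBall z R ∧ a' ∈ Metric.closedBall z R ∧
    a' - a ∈ Submodule.span ℝ {v} ∧ OnSheet e J v a x ∧ OnSheet e J v a' y

theorem equivalence_chartRel (z : Fin n → ℝ) (R : ℝ) :
    Equivalence (chartRel (π := π) e J z R) where
  refl x := Or.inl rfl
  symm := by
    rintro x y (rfl | ⟨v, a, a', h1, h2, h3, h4, h5⟩)
    · exact Or.inl rfl
    · exact Or.inr ⟨v, a', a, h2, h1, by simpa using neg_mem h3, h5, h4⟩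
  trans := by
    rintro x y w (rfl | ⟨v, a, a', h1, h2, h3, h4, h5⟩) hyw
    · exact hyw
    rcases hyw with rfl | ⟨v', b, b', k1, k2, k3, k4, k5⟩
    · exact Or.inr ⟨v, a, a', h1, h2, h3, h4, h5⟩
    -- The middle point determines its sheet and its coordinates, so both displacements are along
    -- the same line.
    · obtain rfl := h5.sign_unique k4
      obtain rfl := h5.coord_unique k4
      exact Or.inr ⟨v, a, b', h1, k2, by simpa using add_mem h3 k3, h4, k5⟩


variable [IsManifold 𝓘(ℂ, Fin n → ℂ) ω X]

theorem IsRealChart.exists_onSheet_section (hR : IsRealChart π ι e J) (hπ : IsSemistable n π)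
    (hι : IsRealStructure n π ι) (hv : IsSignVector J v) {Y : Type*} [TopologicalSpace Y]
    {g : Y → Fin n → ℝ} (hg : Continuous g) (hg1 : ∀ y, g y ∈ orthant J v)
    (hg2 : ∀ y, cplx (g y) ∈ e.target) :
    ∃ σ : Y → ↥(hι.realBlowup ∩ hπ.positivePart), Continuous σ ∧
      ∀ y, OnSheet e J v (g y) (σ y).1 := by
  obtain ⟨σ, hσ, hσ'⟩ := hR.exists_sheet hπ hι hv
  exact ⟨fun y => σ ⟨g y, hg1 y, hg2 y⟩, hσ.comp (hg.subtype_mk _), fun y =>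
    ⟨hv, hg1 y, hg2 y, (hσ' _).1, (hσ' _).2⟩⟩

theorem IsRealChart.isCompact_onSheet (hR : IsRealChart π ι e J) (hπ : IsSemistable n π)
    (hι : IsRealStructure n π ι) {z : Fin n → ℝ} {R : ℝ}
    (hz : Metric.closedBall (cplx z) R ⊆ e.target) :
    IsCompact {x : ↥(hι.realBlowup ∩ hπ.positivePart) |
      ∃ v a, a ∈ Metric.closedBall z R ∧ OnSheet e J v a x.1} := by
  have h1 : ∀ v ∈ {v | IsSignVector J v}, IsCompact {x : ↥(hι.realBlowup ∩ hπ.positivePart) |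
      ∃ a, a ∈ Metric.closedBall z R ∧ OnSheet e J v a x.1} := by
    intro v hv
    let D : Set (Fin n → ℝ) := Metric.closedBall z R ∩ orthant J v
    have hD : IsCompact D := (isCompact_closedBall z R).inter_right (isClosed_orthant J v)
    have := isCompact_iff_compactSpace.1 hD
    obtain ⟨σ, hσ, hσ'⟩ := hR.exists_onSheet_section hπ hι hv (Y := D) (g := Subtype.val)
      continuous_subtype_val (fun a => a.2.2) fun a => cplx_mem_target hz a.2.1
    convert! isCompact_range hσ
    ext x
    constructor
    · rintro ⟨a, ha, hx⟩
      exact ⟨⟨a, ha, hx.orthant⟩, Subtype.ext ((hσ' _).eq_of_eq hR hx)⟩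
    · rintro ⟨a, rfl⟩
      exact ⟨a, a.2.1, hσ' a⟩
  convert! (finite_isSignVector J).isCompact_biUnion h1
  ext x
  constructor
  · rintro ⟨v, a, ha, hx⟩
    exact mem_biUnion hx.sign ⟨a, ha, hx⟩
  · intro hx
    obtain ⟨v, -, a, ha, hx⟩ := mem_iUnion₂.1 hx
    exact ⟨v, a, ha, hx⟩

/-- The relation is the diagonal together with finitely many continuous images of compact sets of
pairs of coordinates, in a Hausdorff space. -/
theorem IsRealChart.isClosed_chartRel [T2Space X] (hR : IsRealChart π ι e J)
    (hπ : IsSemistable n π) (hι : IsRealStructure n π ι) {z : Fin n → ℝ} {R : ℝ}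
    (hz : Metric.closedBall (cplx z) R ⊆ e.target) :
    IsClosed {p : ↥(hι.realBlowup ∩ hπ.positivePart) × ↥(hι.realBlowup ∩ hπ.positivePart) |
      chartRel e J z R p.1.1 p.2.1} := by
  have : T2Space (Blowup n π) := Blowup.t2Space
  have h1 : ∀ v ∈ {v | IsSignVector J v}, IsClosed
      {p : ↥(hι.realBlowup ∩ hπ.positivePart) × ↥(hι.realBlowup ∩ hπ.positivePart) |
        ∃ a a', a ∈ Metric.closedBall z R ∧ a' ∈ Metric.closedBall z R ∧
          a' - a ∈ Submodule.span ℝ {v} ∧ OnSheet e J v a p.1.1 ∧ OnSheet e J v a' p.2.1} := by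
    intro v hv
    let D : Set (Fin n → ℝ) := Metric.closedBall z R ∩ orthant J v
    have hD : IsCompact D := (isCompact_closedBall z R).inter_right (isClosed_orthant J v)
    let E : Set ((Fin n → ℝ) × (Fin n → ℝ)) := D ×ˢ D ∩ {p | p.2 - p.1 ∈ Submodule.span ℝ {v}}
    have hE : IsCompact E := (hD.prod hD).inter_right
      ((Submodule.closed_of_finiteDimensional _).preimage (by fun_prop))
    have := isCompact_iff_compactSpace.1 hE
    obtain ⟨σ, hσ, hσ'⟩ := hR.exists_onSheet_section hπ hι hv (Y := E) (g := fun p => p.1.1)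
      (by fun_prop) (fun a => a.2.1.1.2) fun a => cplx_mem_target hz a.2.1.1.1
    obtain ⟨ρ, hρ, hρ'⟩ := hR.exists_onSheet_section hπ hι hv (Y := E) (g := fun p => p.1.2)
      (by fun_prop) (fun a => a.2.1.2.2) fun a => cplx_mem_target hz a.2.1.2.1
    convert! (isCompact_range (hσ.prodMk hρ)).isClosed
    ext p
    constructor
    · rintro ⟨a, a', ha, ha', hd, hx, hy⟩
      exact ⟨⟨(a, a'), ⟨⟨ha, hx.orthant⟩, ha', hy.orthant⟩, hd⟩, Prod.ext
        (Subtype.ext ((hσ' _).eq_of_eq hR hx)) (Subtype.ext ((hρ' _).eq_of_eq hR hy))⟩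
    · rintro ⟨q, rfl⟩
      exact ⟨q.1.1, q.1.2, q.2.1.1.1, q.2.1.2.1, q.2.2, hσ' q, hρ' q⟩
  convert! isClosed_diagonal.union ((finite_isSignVector J).isClosed_biUnion h1)
  ext p
  constructor
  · rintro (h | ⟨v, a, a', ha, ha', hd, hx, hy⟩)
    · exact Or.inl (Subtype.ext h)
    · exact Or.inr (mem_biUnion hx.sign ⟨a, a', ha, ha', hd, hx, hy⟩)
  · rintro (h | h)
    · exact Or.inl (congrArg Subtype.val (show p.1 = p.2 from h))
    · obtain ⟨v, -, a, a', h⟩ := mem_iUnion₂.1 h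
      exact Or.inr ⟨v, a, a', h⟩

/-- A segment in the direction of the signs lifts to a class of related points. -/
theorem IsRealChart.exists_segment (hR : IsRealChart π ι e J)
    (hπ : IsSemistable n π) (hι : IsRealStructure n π ι) {z : Fin n → ℝ} {R : ℝ}
    (hz : Metric.closedBall (cplx z) R ⊆ e.target) {x : ↥(hι.realBlowup ∩ hπ.positivePart)}
    (hx : OnSheet e J v a x.1) {α β : ℝ} (h0 : 0 ∈ Icc α β)
    (h1 : ∀ τ ∈ Icc α β, a + τ • v ∈ orthant J v)
    (h2 : ∀ τ ∈ Icc α β, a + τ • v ∈ Metric.closedBall z R) :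
    ∃ S : Set ↥(hι.realBlowup ∩ hπ.positivePart), IsPreconnected S ∧ x ∈ S ∧
      (∀ y ∈ S, chartRel e J z R x.1 y.1) ∧
      ∀ τ ∈ Icc α β, ∃ y ∈ S, OnSheet e J v (a + τ • v) y.1 := by
  obtain ⟨σ, hσ, hσ'⟩ := hR.exists_onSheet_section hπ hι hx.sign (Y := Icc α β)
    (g := fun τ => a + (τ : ℝ) • v) (by fun_prop) (fun τ => h1 _ τ.2)
    fun τ => cplx_mem_target hz (h2 _ τ.2)
  have ha : a + (0 : ℝ) • v = a := by simp
  have := isPreconnected_iff_preconnectedSpace.1 (isPreconnected_Icc (a := α) (b := β))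
  refine ⟨range σ, isPreconnected_range hσ, ⟨⟨0, h0⟩, Subtype.ext ?_⟩, ?_, fun τ hτ =>
    ⟨_, ⟨⟨τ, hτ⟩, rfl⟩, hσ' ⟨τ, hτ⟩⟩⟩
  · refine (hσ' _).eq_of_eq hR ?_
    change OnSheet e J v (a + (0 : ℝ) • v) x.1
    rwa [ha]
  · rintro _ ⟨τ, rfl⟩
    refine Or.inr ⟨v, a, _, ?_, h2 _ τ.2, ?_, hx, hσ' τ⟩
    · have := h2 0 h0
      rwa [ha] at this
    · rw [add_sub_cancel_left]
      exact Submodule.smul_mem _ _ (Submodule.mem_span_singleton_self v)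

theorem add_smul_mem_closedBall (hv : IsSignVector J v) {z : Fin n → ℝ} {r τ s : ℝ}
    (ha : ‖a - z‖ ≤ r) (hτ : |τ| ≤ s) : a + τ • v ∈ Metric.closedBall z (r + s) := by
  have hv1 : ‖v‖ ≤ 1 := (pi_norm_le_iff_of_nonneg zero_le_one).2 hv.abs_le_one
  rw [mem_closedBall_iff_norm, add_sub_right_comm]
  refine (norm_add_le _ _).trans (add_le_add ha ?_)
  rw [norm_smul, Real.norm_eq_abs]
  nlinarith [abs_nonneg τ, norm_nonneg v]

/-- The classes are the segments parallel to the sign vector in each sheet. The support of `χ` lies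
in the half ball, so a segment of length parameter `R / 2` stays in the ball, and the height changes
along it at rate at least `c`; hence `η = c R / 2`. -/
theorem IsRealChart.exists_slideBox [T2Space X] (hR : IsRealChart π ι e J)
    (hπ : IsSemistable n π) (hι : IsRealStructure n π ι) {z : Fin n → ℝ} {R m : ℝ} (hR0 : 0 < R)
    (hz : Metric.closedBall (cplx z) R ⊆ e.target) (hm0 : 0 ≤ m) (hm1 : m < 1)
    (hm : ∀ w ∈ Metric.closedBall (cplx z) R, ‖(π (e.symm w) : ℂ)‖ ≤ m) {χ : X → ℝ}
    (hχ : ∀ q, χ q ≠ 0 → q ∈ e.source ∧ ‖e q - cplx z‖ < R / 2) :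
    ∃ η > 0, ∃ B : SlideBox (fun x : ↥(hι.realBlowup ∩ hπ.positivePart) => height n π x.1)
      (fun x => χ x.1.pt) η, ∀ χ' : X → ℝ, IsC1 n χ' → ∃ C ≥ 0, ∀ x y, B.rel x y →
        |χ' x.1.pt - χ' y.1.pt| ≤ C * |height n π x.1 - height n π y.1| := by
  have hn : 0 < n := by
    obtain ⟨j, -⟩ := hR.nonempty
    exact j.pos
  have hc : 0 < 1 - m ^ (n : ℝ)⁻¹ := sub_pos.2 (Real.rpow_lt_one hm0 hm1 (by positivity))
  set c := 1 - m ^ (n : ℝ)⁻¹ with hc_def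
  have hmem : ∀ {a : Fin n → ℝ}, a ∈ Metric.closedBall z R →
      cplx a ∈ Metric.closedBall (cplx z) R := fun {a} ha => by
    rwa [mem_closedBall_iff_norm, norm_cplx_sub, ← mem_closedBall_iff_norm]
  have hle : ∀ {v a : Fin n → ℝ} {x : Blowup n π}, a ∈ Metric.closedBall z R →
      OnSheet e J v a x → ‖(π x.pt : ℂ)‖ ≤ m := fun {v a x} ha hx => by
    rw [hx.pt_eq]
    exact hm _ (hmem ha)
  -- the height grows at least linearly along the classes
  have key : ∀ {v a a' : Fin n → ℝ} {x y : Blowup n π}, a ∈ Metric.closedBall z R →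
      a' ∈ Metric.closedBall z R → a' - a ∈ Submodule.span ℝ {v} → OnSheet e J v a x →
      OnSheet e J v a' y → c * ‖a' - a‖ ≤ |height n π x - height n π y| := by
    intro v a a' x y ha ha' hd hx hy
    obtain ⟨τ, hτ⟩ := Submodule.mem_span_singleton.1 hd
    obtain rfl : a' = a + τ • v := by rw [hτ, add_sub_cancel]
    have hv1 : ‖v‖ ≤ 1 := (pi_norm_le_iff_of_nonneg zero_le_one).2 hx.sign.abs_le_one
    refine le_trans ?_ (hx.mul_abs_le hR hy (hle ha hx) (hle ha' hy))
    rw [add_sub_cancel_left, norm_smul, Real.norm_eq_abs]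
    gcongr
    exact mul_le_of_le_one_right (abs_nonneg _) hv1
  have hsheet : ∀ x : ↥(hι.realBlowup ∩ hπ.positivePart), 0 < χ x.1.pt →
      ∃ v a, OnSheet e J v a x.1 ∧ ‖a - z‖ ≤ R / 2 := by
    intro x hx
    obtain ⟨h1, h2⟩ := hχ _ hx.ne'
    obtain ⟨v, a, hv, ha, hxa, hph⟩ := hR.exists_sign_of_mem hπ hι x.2 h1
    refine ⟨v, a, ⟨hv, ha, ?_, ?_, hph⟩, ?_⟩
    · rw [← hxa]
      exact e.map_source h1
    · rw [← hxa, e.left_inv h1]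
    · rw [hxa, norm_cplx_sub] at h2
      exact h2.le
  have hhalf : R / 2 + R / 2 = R := by ring
  refine ⟨c * (R / 2), by positivity, ⟨fun x y => chartRel e J z R x.1 y.1,
    (equivalence_chartRel z R).comap _, hR.isClosed_chartRel hπ hι hz, ?_, ?_, ?_⟩, ?_⟩
  · rintro x y (h | ⟨v, a, a', h1, h2, h3, h4, h5⟩) hxy
    · exact Subtype.ext h
    · have h6 := key h1 h2 h3 h4 h5
      rw [show height n π x.1 = height n π y.1 from hxy, sub_self, abs_zero] at h6
      have h7 : ‖a' - a‖ ≤ 0 := nonpos_of_mul_nonpos_right h6 hc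
      obtain rfl : a' = a := sub_eq_zero.1 (norm_le_zero_iff.1 h7)
      exact Subtype.ext (h4.eq_of_eq hR h5)
  · intro x hx
    obtain ⟨v, a, hxa, haz⟩ := hsheet x hx
    obtain ⟨S, hS1, hS2, hS3, hS4⟩ := hR.exists_segment hπ hι hz hxa (α := 0) (β := R / 2)
      ⟨le_rfl, by positivity⟩ (fun τ hτ => hxa.sign.add_smul_mem hxa.orthant hτ.1)
      fun τ hτ => by
        have := add_smul_mem_closedBall hxa.sign haz (τ := τ) (s := R / 2)
          (by rw [abs_of_nonneg hτ.1]; exact hτ.2)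
        rwa [hhalf] at this
    obtain ⟨y, hyS, hy⟩ := hS4 (R / 2) ⟨by positivity, le_rfl⟩
    refine ⟨S, hS1, hS2, hS3, y, hyS, ?_⟩
    refine hxa.height_add_le hR (by positivity) hy (hle ?_ hy)
    have := add_smul_mem_closedBall hxa.sign haz (τ := R / 2) (s := R / 2)
      (by rw [abs_of_nonneg (by positivity)])
    rwa [hhalf] at this
  · intro x hx
    obtain ⟨v, a, hxa, haz⟩ := hsheet x hx
    -- Going down, the line leaves the orthant when the coordinate of smallest modulus reaches `0`.
    -- If this happens before `R / 2`, then `π` vanishes at the end and height `0` has been reached.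
    obtain ⟨j₀, hj₀, hmin⟩ := J.exists_min_image (fun j => v j * a j) hR.nonempty
    set τ₁ := min (R / 2) (v j₀ * a j₀) with hτ₁
    have hτ₁0 : 0 ≤ τ₁ := le_min (by positivity) (hxa.orthant j₀ hj₀)
    have hball : ∀ τ ∈ Icc (-τ₁) 0, a + τ • v ∈ Metric.closedBall z R := fun τ hτ => by
      have := add_smul_mem_closedBall hxa.sign haz (τ := τ) (s := R / 2)
        (by rw [abs_of_nonpos hτ.2]; linarith [hτ.1, min_le_left (R / 2) (v j₀ * a j₀)])
      rwa [hhalf] at this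
    have hcoord : ∀ τ : ℝ, ∀ j ∈ J, v j * (a + τ • v) j = v j * a j + τ := fun τ j hj => by
      have := hxa.sign.mul_self hj
      simp only [Pi.add_apply, Pi.smul_apply, smul_eq_mul]
      linear_combination τ * this
    obtain ⟨S, hS1, hS2, hS3, hS4⟩ := hR.exists_segment hπ hι hz hxa (α := -τ₁) (β := 0)
      ⟨by linarith, le_rfl⟩ (fun τ hτ j hj => by
        rw [hcoord τ j hj]
        linarith [hmin j hj, min_le_right (R / 2) (v j₀ * a j₀), hτ.1]) hball
    have hend : -τ₁ ∈ Icc (-τ₁) 0 := ⟨le_rfl, by linarith⟩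
    obtain ⟨y, hyS, hy⟩ := hS4 (-τ₁) hend
    refine ⟨S, hS1, hS2, hS3, y, hyS, ?_⟩
    rcases le_total (R / 2) (v j₀ * a j₀) with h | h
    · refine le_trans ?_ (le_max_right _ _)
      rw [hτ₁, min_eq_left h] at hy
      have h1 : a = (a + -(R / 2) • v) + (R / 2) • v := by
        ext j
        simp
      have h2 := hle (hball 0 ⟨by linarith, le_rfl⟩) (x := x.1) (v := v) (by simpa using hxa)
      rw [h1] at hxa
      have := hy.height_add_le hR (by positivity) hxa h2
      exact le_sub_iff_add_le.2 this
    · refine le_trans (le_of_eq ?_) (le_max_left _ _)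
      have h1 := hy.norm_eq hR
      rw [hτ₁, min_eq_right h, Finset.prod_eq_zero hj₀ (by rw [hcoord _ _ hj₀]; ring)] at h1
      change ‖(π y.1.pt : ℂ)‖ ^ (n : ℝ)⁻¹ = 0
      rw [h1, Real.zero_rpow (by positivity)]
  · intro χ' hχ'
    -- Lipschitz in the coordinates, combined with `c * ‖a' - a‖ ≤ |Δ height|`, gives the constant
    -- `K / c`.
    obtain ⟨K, hK⟩ := hχ'.exists_lipschitz hR.mem_maximalAtlas hz
    refine ⟨K / c, by positivity, ?_⟩
    rintro x y (h | ⟨v, a, a', h1, h2, h3, h4, h5⟩)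
    · rw [h, sub_self, abs_zero]
      positivity
    · have h6 := key h1 h2 h3 h4 h5
      have h7 := hK.dist_le_mul _ (hmem h1) _ (hmem h2)
      rw [Function.comp, Function.comp, ← h4.pt_eq, ← h5.pt_eq, Real.dist_eq, dist_eq_norm,
        norm_cplx_sub, norm_sub_rev] at h7
      refine h7.trans ?_
      rw [div_mul_eq_mul_div, le_div_iff₀ hc, mul_assoc, mul_comm _ c]
      gcongr

end Box

end SemistableDegeneration

namespace SemistableDegeneration

open Set Filter

/-! ### The real locus of the positive part -/

section Trivial

variable {n : ℕ} {X : Type*} [TopologicalSpace X] [ChartedSpace (Fin n → ℂ) X]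
  {π : X → 𝔻} {ι : X → X}

theorem IsSemistable.continuous_coe (hπ : IsSemistable n π) : Continuous fun x => (π x : ℂ) :=
  Complex.UnitDisc.continuous_coe.comp hπ.proper.continuous

theorem IsSemistable.dim_pos (hπ : IsSemistable n π) (p : X) : 0 < n := by
  by_cases h : (π p : ℂ) = 0
  · obtain ⟨e, J, he⟩ := hπ.normalCrossing p h
    obtain ⟨j, -⟩ := he.nonempty
    exact j.pos
  · obtain ⟨v, hv⟩ := hπ.regular p h (1 : ℂ)
    rcases Nat.eq_zero_or_pos n with rfl | hn
    · have : v = 0 := Subsingleton.elim (α := Fin 0 → ℂ) v 0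
      subst this
      have h0 : (0 : ℂ) = 1 := (map_zero (mfderiv 𝓘(ℂ, Fin 0 → ℂ) 𝓘(ℂ, ℂ)
        (fun x => (π x : ℂ)) p)).symm.trans hv
      exact absurd h0 zero_ne_one
    · exact hn

theorem height_nonneg (x : Blowup n π) : 0 ≤ height n π x := by
  unfold height
  positivity

theorem IsSemistable.height_pow (hπ : IsSemistable n π) (x : Blowup n π) :
    height n π x ^ n = ‖(π x.pt : ℂ)‖ :=
  Real.rpow_inv_natCast_pow (norm_nonneg _) (hπ.dim_pos x.pt).ne'

theorem IsSemistable.height_lt_one (hπ : IsSemistable n π) (x : Blowup n π) :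
    height n π x < 1 :=
  Real.rpow_lt_one (norm_nonneg _) (π x.pt).norm_lt_one
    (by have := hπ.dim_pos x.pt; positivity)

theorem IsSemistable.continuous_height (hπ : IsSemistable n π) :
    Continuous (height n π : Blowup n π → ℝ) := by
  have h := hπ.continuous_coe.norm.comp (Blowup.continuous_pt (n := n) (π := π))
  exact h.rpow_const fun _ => Or.inr (by positivity)

theorem IsSemistable.isCompact_preimage (hπ : IsSemistable n π) {s : ℝ} (hs : s < 1) :
    IsCompact {p : X | ‖(π p : ℂ)‖ ≤ s} := by
  refine hπ.proper.isCompact_preimage (K := {z : 𝔻 | ‖(z : ℂ)‖ ≤ s}) ?_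
  rw [Complex.UnitDisc.isEmbedding_coe.isCompact_iff]
  convert! isCompact_closedBall (0 : ℂ) s
  ext z
  rw [mem_closedBall_zero_iff]
  constructor
  · rintro ⟨w, hw, rfl⟩
    exact hw
  · intro hz
    exact ⟨Complex.UnitDisc.mk z (hz.trans_lt hs), hz, rfl⟩

/-- Finitely many boxes cover the part of the real locus below a given height. -/
theorem exists_finset_cover (hπ : IsSemistable n π) {b : ℝ} (hb0 : 0 ≤ b) (hb : b < 1)
    {P : X → X → Prop} (hP : ∀ p, ∀ᶠ q in 𝓝 p, P p q) :
    ∃ t : Finset X, ∀ x : Blowup n π, height n π x ≤ b → ∃ p ∈ t, P p x.pt := by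
  rcases isEmpty_or_nonempty X with hX | ⟨⟨p₀⟩⟩
  · exact ⟨∅, fun x => (hX.false x.pt).elim⟩
  have hn := hπ.dim_pos p₀
  have hK := hπ.isCompact_preimage (pow_lt_one₀ hb0 hb hn.ne')
  obtain ⟨t, -, ht⟩ := hK.elim_nhds_subcover (fun p => {q | P p q}) fun p _ => hP p
  refine ⟨t, fun x hx => ?_⟩
  have h1 : x.pt ∈ {p : X | ‖(π p : ℂ)‖ ≤ b ^ n} := by
    change ‖(π x.pt : ℂ)‖ ≤ b ^ n
    rw [← hπ.height_pow]
    exact pow_le_pow_left₀ (height_nonneg x) hx n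
  obtain ⟨p, hp, hpx⟩ := mem_iUnion₂.1 (ht h1)
  exact ⟨p, hp, hpx⟩

variable [IsManifold 𝓘(ℂ, Fin n → ℂ) ω X] [T2Space X]

/-- At a real point the box comes from a real chart, on a ball where `|π|` is bounded by some `m <
1`. Near a non-real point there are no points of the real locus, and equality serves as the
relation. -/
theorem exists_local_slideBox (hπ : IsSemistable n π) (hι : IsRealStructure n π ι)
    (hreal : IsTotallyReal n π ι) (p : X) :
    ∃ χ : X → ℝ, IsC1 n χ ∧ (∀ x, 0 ≤ χ x) ∧ (∀ᶠ x in 𝓝 p, χ x = 1) ∧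
      (∃ K : Set ↥(hι.realBlowup ∩ hπ.positivePart), IsCompact K ∧
        ∀ᶠ q in 𝓝 p, ∀ x : ↥(hι.realBlowup ∩ hπ.positivePart), x.1.pt = q → x ∈ K) ∧
      ∃ η > 0, ∃ B : SlideBox (fun x : ↥(hι.realBlowup ∩ hπ.positivePart) => height n π x.1)
        (fun x => χ x.1.pt) η, ∀ χ' : X → ℝ, IsC1 n χ' → ∃ C ≥ 0, ∀ x y, B.rel x y →
          |χ' x.1.pt - χ' y.1.pt| ≤ C * |height n π x.1 - height n π y.1| := by
  have : T2Space (Blowup n π) := Blowup.t2Space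
  by_cases hp : ι p = p
  · obtain ⟨e, J, hpe, hR⟩ := hπ.exists_isRealChart hι hreal hp
    obtain ⟨z, hz⟩ : ∃ z : Fin n → ℝ, cplx z = e p := by
      refine ⟨fun j => (e p j).re, ?_⟩
      ext j
      have h3 := hR.map_conj _ hpe j
      rw [hp] at h3
      exact Complex.conj_eq_iff_re.1 h3.symm
    obtain ⟨m, hm0, hm1⟩ := exists_between (π p).norm_lt_one
    have hU : IsOpen {q : X | ‖(π q : ℂ)‖ < m} := isOpen_lt hπ.continuous_coe.norm continuous_const
    have h1 : e.target ∩ e.symm ⁻¹' {q : X | ‖(π q : ℂ)‖ < m} ∈ 𝓝 (e p) := by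
      refine (e.isOpen_inter_preimage_symm hU).mem_nhds ⟨e.map_source hpe, ?_⟩
      rw [mem_preimage, e.left_inv hpe]
      exact hm0
    obtain ⟨R, hR0, hRU⟩ := Metric.nhds_basis_closedBall.mem_iff.1 h1
    rw [← hz] at hRU
    have hRt : Metric.closedBall (cplx z) R ⊆ e.target := hRU.trans inter_subset_left
    have hV : IsOpen (e.source ∩ e ⁻¹' Metric.ball (cplx z) (R / 2)) :=
      e.isOpen_inter_preimage Metric.isOpen_ball
    have hpV : p ∈ e.source ∩ e ⁻¹' Metric.ball (cplx z) (R / 2) := by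
      refine ⟨hpe, ?_⟩
      rw [mem_preimage, hz]
      exact Metric.mem_ball_self (by positivity)
    obtain ⟨χ, hχ, hχ0, hχ1, hχV⟩ := exists_isC1_bump (n := n) hV hpV
    refine ⟨χ, hχ, hχ0, hχ1, ⟨_, hR.isCompact_onSheet hπ hι hRt, ?_⟩,
      hR.exists_slideBox hπ hι hR0 hRt ((norm_nonneg _).trans hm0.le) hm1
        (fun w hw => le_of_lt (hRU hw).2) fun q hq => ?_⟩
    · filter_upwards [hV.mem_nhds hpV]
      rintro q ⟨hq1, hq2⟩ x rfl
      obtain ⟨v, a, hv, ha, hxa, hph⟩ := hR.exists_sign_of_mem hπ hι x.2 hq1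
      refine ⟨v, a, ?_, ⟨hv, ha, ?_, ?_, hph⟩⟩
      · rw [mem_preimage, hxa, mem_ball_iff_norm, norm_cplx_sub] at hq2
        rw [mem_closedBall_iff_norm]
        linarith
      · rw [← hxa]
        exact e.map_source hq1
      · rw [← hxa, e.left_inv hq1]
    · obtain ⟨h2, h3⟩ := hχV q hq
      exact ⟨h2, by rwa [mem_preimage, mem_ball_iff_norm] at h3⟩
  · have hU : IsOpen {q : X | ι q ≠ q} := isOpen_ne_fun hι.continuous continuous_id
    obtain ⟨χ, hχ, hχ0, hχ1, hχU⟩ := exists_isC1_bump (n := n) hU hp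
    have hreal : ∀ x : ↥(hι.realBlowup ∩ hπ.positivePart), ι x.1.pt = x.1.pt := fun x =>
      (hι.mem_realBlowup_iff.1 x.2.1).1
    have hno : ∀ x : ↥(hι.realBlowup ∩ hπ.positivePart), ¬ 0 < χ x.1.pt := fun x hx =>
      hχU _ hx.ne' (hreal x)
    refine ⟨χ, hχ, hχ0, hχ1, ⟨∅, isCompact_empty, ?_⟩, 1, one_pos,
      ⟨Eq, eq_equivalence, isClosed_diagonal, fun x y h _ => h, fun x hx => absurd hx (hno x),
        fun x hx => absurd hx (hno x)⟩, fun χ' _ => ⟨0, le_rfl, ?_⟩⟩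
    · filter_upwards [hU.mem_nhds hp]
      rintro q hq x rfl
      exact hq (hreal x)
    · rintro x y (rfl : x = y)
      simp

theorem isCompact_height_le (hπ : IsSemistable n π) (hι : IsRealStructure n π ι)
    (hreal : IsTotallyReal n π ι) {b : ℝ} (hb : b < 1) :
    IsCompact {x : ↥(hι.realBlowup ∩ hπ.positivePart) | height n π x.1 ≤ b} := by
  have hclosed : IsClosed {x : ↥(hι.realBlowup ∩ hπ.positivePart) | height n π x.1 ≤ b} :=
    isClosed_le (hπ.continuous_height.comp continuous_subtype_val) continuous_const
  have key : ∀ p : X, ∃ K : Set ↥(hι.realBlowup ∩ hπ.positivePart), IsCompact K ∧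
      ∀ᶠ q in 𝓝 p, ∀ x : ↥(hι.realBlowup ∩ hπ.positivePart), x.1.pt = q → x ∈ K := fun p => by
    obtain ⟨_, -, -, -, h, -⟩ := exists_local_slideBox hπ hι hreal p
    exact h
  choose K hK hKp using key
  obtain ⟨t, ht⟩ := exists_finset_cover hπ (le_max_right b 0) (max_lt hb one_pos) hKp
  refine (t.isCompact_biUnion fun p _ => hK p).of_isClosed_subset hclosed fun x hx => ?_
  obtain ⟨p, hp, hpx⟩ := ht x.1 (le_trans hx (le_max_left _ _))
  exact mem_biUnion hp (hpx x rfl)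

theorem exists_isTrivialization_height (hπ : IsSemistable n π) (hι : IsRealStructure n π ι)
    (hreal : IsTotallyReal n π ι) {a b : ℝ} (ha : 0 ≤ a) (hab : a ≤ b) (hb : b < 1) :
    ∃ q, IsTrivialization (fun x : ↥(hι.realBlowup ∩ hπ.positivePart) => height n π x.1) a b q := by
  have hc : Continuous fun x : ↥(hι.realBlowup ∩ hπ.positivePart) => height n π x.1 :=
    hπ.continuous_height.comp continuous_subtype_val
  choose χ hχ hχ0 hχ1 _ η hη B hB using exists_local_slideBox hπ hι hreal
  choose C hC0 hC using hB
  obtain ⟨t, ht⟩ := exists_finset_cover hπ (ha.trans hab) hb hχ1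
  obtain ⟨C₁, hC₁⟩ := Finite.exists_le fun i : t × t => C i.1 (χ i.2) (hχ i.2)
  obtain ⟨N, hN⟩ := Finite.exists_le fun i : t => (η i)⁻¹
  set C' := max C₁ 0 with hC'
  set k : ℝ := Fintype.card t * C' with hk
  have hk0 : 0 ≤ k := by positivity
  have hN0 : 0 < max N 1 := by positivity
  -- The first bound keeps a step below every `η i`; the second makes the Lipschitz constant of the
  -- tilted levels less than `1`. Both are uniform because finitely many boxes suffice up to height
  -- `b`.
  refine exists_isTrivialization_of_uniform hc (T := b) (δ := min (max N 1)⁻¹ (k + 1)⁻¹)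
    (by positivity) (fun s s' hs hss hs' hδ => ?_) ha hab le_rfl
  refine exists_isTrivialization_of_slideBoxes (fun i : t => B i) hc
    (fun i => (hχ i).continuous.comp (Blowup.continuous_pt.comp continuous_subtype_val))
    (fun i x => hχ0 i _) (C := C') (le_max_right _ _) ?_ hs hss (fun i => ?_) ?_
    (isCompact_height_le hπ hι hreal (hs'.trans_lt hb)) fun x hx => ?_
  · intro i l x y hxy
    refine (hC i (χ l) (hχ l) x y hxy).trans ?_
    gcongr
    exact (hC₁ (i, l)).trans (le_max_left _ _)
  · refine (hδ.trans (min_le_left _ _)).trans ?_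
    rw [inv_le_comm₀ hN0 (hη i)]
    exact (hN i).trans (le_max_left _ _)
  · calc (s' - s) * k ≤ (k + 1)⁻¹ * k := by
          gcongr
          exact hδ.trans (min_le_right _ _)
      _ < 1 := by
          rw [inv_mul_lt_iff₀ (by positivity)]
          linarith
  · obtain ⟨p, hp, hpx⟩ := ht x.1 (le_trans hx hs')
    have h1 := Finset.single_le_sum (f := fun i : t => χ i x.1.pt) (fun i _ => hχ0 i _)
      (Finset.mem_univ ⟨p, hp⟩)
    simpa only [hpx] using h1

theorem exists_homeomorph_height (hπ : IsSemistable n π) (hι : IsRealStructure n π ι)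
    (hreal : IsTotallyReal n π ι) :
    ∃ e : {x : ↥(hι.realBlowup ∩ hπ.positivePart) // height n π x.1 = 0} × Ico (0 : ℝ) 1 ≃ₜ
      ↥(hι.realBlowup ∩ hπ.positivePart), ∀ p, height n π (e p).1 = p.2 := by
  have : T2Space (Blowup n π) := Blowup.t2Space
  exact exists_homeomorph_of_isTrivialization
    (h := fun x : ↥(hι.realBlowup ∩ hπ.positivePart) => height n π x.1)
    (hπ.continuous_height.comp continuous_subtype_val)
    (fun x => height_nonneg x.1) (fun x => hπ.height_lt_one x.1)
    (fun T hT => isCompact_height_le hπ hι hreal hT)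
    fun a b ha hab hb => exists_isTrivialization_height hπ hι hreal ha hab hb

end Trivial

end SemistableDegeneration

namespace SemistableDegeneration

open Set Filter

/-! ### Return to the parameter `|π|`, and comparison with the real fibres of `π` -/

section Conclusion

variable {n : ℕ} {X : Type*} [TopologicalSpace X] [ChartedSpace (Fin n → ℂ) X]
  {π : X → 𝔻} {ι : X → X}

theorem exists_homeomorph_pow_eq {N : ℕ} (hN : N ≠ 0) :
    ∃ ψ : Ico (0 : ℝ) 1 ≃ₜ Ico (0 : ℝ) 1, ∀ t, (ψ t : ℝ) ^ N = t := by
  have hN' : 0 < (N : ℝ)⁻¹ := by positivity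
  refine ⟨⟨⟨fun t => ⟨(t : ℝ) ^ (N : ℝ)⁻¹, Real.rpow_nonneg t.2.1 _,
    Real.rpow_lt_one t.2.1 t.2.2 hN'⟩,
    fun t => ⟨(t : ℝ) ^ N, pow_nonneg t.2.1 _, pow_lt_one₀ t.2.1 t.2.2 hN⟩,
    fun t => Subtype.ext (Real.rpow_inv_natCast_pow t.2.1 hN),
    fun t => Subtype.ext (Real.pow_rpow_inv_natCast t.2.1 hN)⟩, ?_, ?_⟩, fun t =>
      Real.rpow_inv_natCast_pow t.2.1 hN⟩
  · exact (continuous_subtype_val.rpow_const fun _ => Or.inr hN'.le).subtype_mk _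
  · exact (continuous_subtype_val.pow N).subtype_mk _

theorem height_eq_zero_iff (hπ : IsSemistable n π) {x : Blowup n π} :
    height n π x = 0 ↔ (π x.pt : ℂ) = 0 := by
  rw [← norm_eq_zero (a := (π x.pt : ℂ)), ← hπ.height_pow, pow_eq_zero_iff (hπ.dim_pos x.pt).ne']

/-- The real locus of the positive special fibre consists of the points of height zero. -/
def homeomorphHeightZero (hπ : IsSemistable n π) (hι : IsRealStructure n π ι) :
    {x : ↥(hι.realBlowup ∩ hπ.positivePart) // height n π x.1 = 0} ≃ₜ
      ↥(hι.realBlowup ∩ hπ.positiveSpecialFibre) where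
  toFun x := ⟨x.1.1, x.1.2.1, hπ.mem_positiveSpecialFibre_iff.2
    ⟨x.1.2.2, (height_eq_zero_iff hπ).1 x.2⟩⟩
  invFun x := ⟨⟨x.1, x.2.1, (hπ.mem_positiveSpecialFibre_iff.1 x.2.2).1⟩,
    (height_eq_zero_iff hπ).2 (hπ.mem_positiveSpecialFibre_iff.1 x.2.2).2⟩
  left_inv _ := rfl
  right_inv _ := rfl
  continuous_toFun := by fun_prop
  continuous_invFun := by fun_prop

theorem IsSemistable.eq_norm_of_mem_positivePart (hπ : IsSemistable n π) {x : Blowup n π}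
    (hx : x ∈ hπ.positivePart) : (π x.pt : ℂ) = ‖(π x.pt : ℂ)‖ := by
  have h := x.eq_norm_mul_ph (hπ.divAt _)
  rwa [hπ.mem_positivePart_iff.1 hx, Circle.coe_one, mul_one] at h

theorem Blowup.ext_of_ne_zero {x y : Blowup n π} (h : x.pt = y.pt) (h0 : (π x.pt : ℂ) ≠ 0) :
    x = y := by
  refine Blowup.ext_ph h fun f hf => Circle.ext ?_
  have hf0 : f x.pt ≠ 0 := (divAt_iff.1 hf).2.self_of_nhds h0
  rw [x.ph_of_ne_zero hf hf0, y.ph_of_ne_zero (h ▸ hf) (h ▸ hf0), h]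

variable [IsManifold 𝓘(ℂ, Fin n → ℂ) ω X]

/-- In a real chart at `q` the coordinates in `J` are real with product `t > 0`, so their signs
multiply to `1` and select a sheet. -/
theorem exists_blowup_of_mem_realFibre (hπ : IsSemistable n π) (hι : IsRealStructure n π ι)
    (hreal : IsTotallyReal n π ι) {t : ℝ} (ht : 0 < t) {q : X} (hq : q ∈ realFibre π ι t) :
    ∃ x : Blowup n π, x ∈ hι.realBlowup ∩ hπ.positivePart ∧ x.pt = q := by
  classical
  obtain ⟨e, J, hqe, hR⟩ := hπ.exists_isRealChart hι hreal hq.1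
  let a : Fin n → ℝ := fun j => (e q j).re
  have ha : cplx a = e q := by
    ext j
    have h3 := hR.map_conj _ hqe j
    rw [hq.1] at h3
    exact Complex.conj_eq_iff_re.1 h3.symm
  have hprod : ∏ j ∈ J, a j = t := by
    have h := hR.eq_prod q hqe
    rw [hq.2, ← ha] at h
    simp only [cplx] at h
    exact_mod_cast h.symm
  have ha0 : ∀ j ∈ J, a j ≠ 0 := Finset.prod_ne_zero_iff.1 (hprod ▸ ht.ne')
  let v : Fin n → ℝ := fun j => if j ∈ J then a j / |a j| else 0
  have hvJ : ∀ j ∈ J, v j = a j / |a j| := fun j hj => if_pos hj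
  have hv : IsSignVector J v := by
    refine ⟨fun j hj => ?_, fun j hj => if_neg hj, ?_⟩
    · rw [hvJ j hj]
      rcases abs_choice (a j) with h | h <;> rw [h]
      · exact Or.inl (div_self (ha0 j hj))
      · exact Or.inr (by rw [div_neg, div_self (ha0 j hj)])
    · rw [Finset.prod_congr rfl hvJ, Finset.prod_div_distrib, ← Finset.abs_prod, hprod,
        abs_of_pos ht, div_self ht.ne']
  have hav : a ∈ orthant J v := fun j hj => by
    rw [hvJ j hj, div_mul_eq_mul_div]
    exact div_nonneg (mul_self_nonneg _) (abs_nonneg _)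
  obtain ⟨x, hx, hxq, -⟩ := hR.exists_blowup hπ hι hv hav (by
    rw [ha]
    exact e.map_source hqe)
  exact ⟨x, hx, by rw [hxq, ha, e.left_inv hqe]⟩

variable [T2Space X]

theorem exists_homeomorph_norm (hπ : IsSemistable n π) (hι : IsRealStructure n π ι)
    (hreal : IsTotallyReal n π ι) :
    ∃ H : ↥(hι.realBlowup ∩ hπ.positiveSpecialFibre) × Ico (0 : ℝ) 1 ≃ₜ
      ↥(hι.realBlowup ∩ hπ.positivePart), ∀ p, ‖(π (H p).1.pt : ℂ)‖ = p.2 := by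
  obtain ⟨e, he⟩ := exists_homeomorph_height hπ hι hreal
  -- Positivity of `n` is known only in the presence of a point, and `X` may be empty; `max n 1`
  -- gives a reparametrization in all cases.
  obtain ⟨ψ, hψ⟩ := exists_homeomorph_pow_eq (N := max n 1) (by positivity)
  refine ⟨((homeomorphHeightZero hπ hι).symm.prodCongr ψ).trans e, fun p => ?_⟩
  have hn : max n 1 = n := max_eq_left (hπ.dim_pos p.1.1.pt)
  rw [hn] at hψ
  rw [← hπ.height_pow]
  exact (congrArg (· ^ n) (he _)).trans (hψ p.2)

theorem compactSpace_positiveSpecialFibre (hπ : IsSemistable n π) (hι : IsRealStructure n π ι)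
    (hreal : IsTotallyReal n π ι) :
    CompactSpace ↥(hι.realBlowup ∩ hπ.positiveSpecialFibre) := by
  have h := isCompact_height_le hπ hι hreal (b := 0) one_pos
  have h1 : CompactSpace {x : ↥(hι.realBlowup ∩ hπ.positivePart) // height n π x.1 = 0} := by
    refine isCompact_iff_compactSpace (s := {x : ↥(hι.realBlowup ∩ hπ.positivePart) |
      height n π x.1 = 0}).1 ?_
    convert! h using 1
    ext x
    exact (height_nonneg x.1).ge_iff_eq'.symm
  exact (homeomorphHeightZero hπ hι).compactSpace

/-- Over `t > 0` all phases are determined by the values of the functions, so the blow-down is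
injective there. Composed with `H (·, t)` it is a continuous bijection from a compact space to a
Hausdorff one. -/
theorem nonempty_homeomorph_realFibre (hπ : IsSemistable n π) (hι : IsRealStructure n π ι)
    (hreal : IsTotallyReal n π ι)
    (H : ↥(hι.realBlowup ∩ hπ.positiveSpecialFibre) × Ico (0 : ℝ) 1 ≃ₜ
      ↥(hι.realBlowup ∩ hπ.positivePart)) (hH : ∀ p, ‖(π (H p).1.pt : ℂ)‖ = p.2) {t : ℝ}
    (ht : t ∈ Ioo (0 : ℝ) 1) :
    Nonempty (↥(hι.realBlowup ∩ hπ.positiveSpecialFibre) ≃ₜ ↥(realFibre π ι t)) := by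
  have := compactSpace_positiveSpecialFibre hπ hι hreal
  let t' : Ico (0 : ℝ) 1 := ⟨t, ht.1.le, ht.2⟩
  have hπt : ∀ x, (π (H (x, t')).1.pt : ℂ) = t := fun x => by
    rw [hπ.eq_norm_of_mem_positivePart (H (x, t')).2.2, hH]
  let f : ↥(hι.realBlowup ∩ hπ.positiveSpecialFibre) → ↥(realFibre π ι t) := fun x =>
    ⟨(H (x, t')).1.pt, (hι.mem_realBlowup_iff.1 (H (x, t')).2.1).1, hπt x⟩
  have hf : Continuous f := (Blowup.continuous_pt.comp (continuous_subtype_val.comp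
    (H.continuous.comp (by fun_prop)))).subtype_mk _
  have hfb : Function.Bijective f := by
    constructor
    · intro x y hxy
      have h1 := Blowup.ext_of_ne_zero (congrArg Subtype.val hxy) (by
        rw [hπt]
        exact_mod_cast ht.1.ne')
      exact congrArg Prod.fst (H.injective (Subtype.ext h1))
    · rintro ⟨q, hq⟩
      obtain ⟨x, hx, hxq⟩ := exists_blowup_of_mem_realFibre hπ hι hreal ht.1 hq
      obtain ⟨⟨y, s⟩, hy⟩ := H.surjective ⟨x, hx⟩
      have hs : s = t' := Subtype.ext (by
        rw [← hH (y, s), hy]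
        change ‖(π x.pt : ℂ)‖ = t
        rw [hxq, hq.2, Complex.norm_real, Real.norm_of_nonneg ht.1.le])
      subst hs
      exact ⟨y, Subtype.ext (by
        change (H (y, t')).1.pt = q
        rw [hy]
        exact hxq)⟩
  exact ⟨Continuous.homeoOfEquivCompactToT2 (f := Equiv.ofBijective f hfb) hf⟩

end Conclusion

end SemistableDegeneration

theorem mainTheorem2 {n : ℕ} {X : Type*} [TopologicalSpace X] [T2Space X]
    [ChartedSpace (Fin n → ℂ) X] [IsManifold 𝓘(ℂ, Fin n → ℂ) ω X]
    {π : X → 𝔻} {ι : X → X}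
    (hπ : SemistableDegeneration.IsSemistable n π)
    (hι : SemistableDegeneration.IsRealStructure n π ι)
    (hreal : SemistableDegeneration.IsTotallyReal n π ι) :
    (∃ H : ↥(hι.realBlowup ∩ hπ.positiveSpecialFibre) × Set.Ico (0 : ℝ) 1 ≃ₜ
        ↥(hι.realBlowup ∩ hπ.positivePart),
      ∀ (x : ↥(hι.realBlowup ∩ hπ.positiveSpecialFibre)) (t : Set.Ico (0 : ℝ) 1),
        hπ.blowupMap (H (x, t)) = (1, t)) ∧
    ∀ t ∈ Set.Ioo (0 : ℝ) 1,
      Nonempty (↥(hι.realBlowup ∩ hπ.positiveSpecialFibre) ≃ₜ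
        ↥(SemistableDegeneration.realFibre π ι t)) := by
  obtain ⟨H, hH⟩ := SemistableDegeneration.exists_homeomorph_norm hπ hι hreal
  exact ⟨⟨H, fun x t => Prod.ext (H (x, t)).2.2.1 (Subtype.ext (hH (x, t)))⟩, fun t ht =>
    SemistableDegeneration.nonempty_homeomorph_realFibre hπ hι hreal H hH ht⟩
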